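/- **Setting.** Composition is written $g f$ ("$g$ after $f$"). *Relative pseudomonads.* Let $J:\mathcal C\to\mathcal D$ be a pseudofunctor between 2-categories. A relative pseudomonad $T$ over $J$ consists of an object $TX\in\mathcal D$ and a morphism $i_X:JX\to TX$ for every $X\in\mathcal C$, functors $(-)^*:\mathcal D[JX,TY]\to\mathcal D[TX,TY]$, and natural families of invertible 2-cells $\mu_{f,g}:(g^*f)^*\to g^*f^*$, $\eta_f:f\to f^*i_X$, $\theta_X:i_X^*\to 1_{TX}$ such that, for $f:JX\to TY$, $g:JY\to TZ$, $h:JZ\to TV$, (i) the two composites $((h^*g)^*f)^*\to h^*g^*f^*$ built from $\mu$ agree, namely $\mu_{f,h^*g}$ followed by $\mu_{g,h}f^*$, and $(\mu_{g,h}f)^*$ followed by $\mu_{g^*f,h}$ and $h^*\mu_{f,g}$; (ii) $(\eta_f)^*$ followed by $\mu_{i_X,f}$ and $f^*\theta_X$ is the identity of $f^*$. Its Kleisli bicategory $\mathrm{Kl}(T)$ has the objects of $\mathcal C$, hom-categories $\mathrm{Kl}(T)[X,Y]=\mathcal D[JX,TY]$, identities $i_X$, composition $g\circ f=g^*f$,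 and the structural 2-cells given by $\mu,\eta,\theta$. There is a pseudofunctor $F^T:\mathcal C\to\mathrm{Kl}(T)$ that is the identity on objects and sends $f:X\to Y$ to $i_Y\,Jf$. *Pseudomonads.* A morphism of pseudomonads from $(\mathcal B,S)$ to $(\mathcal B',S')$ over a pseudofunctor $J:\mathcal B\to\mathcal B'$ is a pseudonatural transformation $\kappa_X:S'JX\to JSX$ together with invertible modifications $\kappa_X\,e'_{JX}\cong J(e_X)$ and $\kappa_X\,m'_{JX}\cong J(m_X)\,\kappa_{SX}\,S'\kappa_X$ that are compatible with the associativity and unit constraints of $S$ and $S'$. Such a morphism sends an $S$-pseudoalgebra $(A,a)$ to the $S'$-pseudoalgebra $JA$ with structure map $J(a)\,\kappa_A$. *Restriction.* A 2-monad $S$ on $\mathcal D$ restricts along $J$ if there are given a 2-monad on $\mathcal C$, also written $(S,m,e)$, and a morphism of pseudomonads from $(\mathcal C,S)$ to $(\mathcal D,S)$ over $J$ whose components $\kappa_X:SJX\to JSX$ are equivalences. (The case $SJ=JS$ with identity components is included.) So every strict $S$-algebra $A$ in $\mathcal C$ gives an $S$-pseudoalgebra $JA$ in $\mathcal D$. *Liftings.*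 A lifting of $T$ to pseudoalgebras for $S$ consists of - a pseudoalgebra structure on $TA$ for every strict $S$-algebra $A$ in $\mathcal C$, - a pseudomorphism structure on $f^*:TA\to TB$ for every pseudomorphism $f:JA\to TB$, - a pseudomorphism structure on $i_A:JA\to TA$ for every strict $S$-algebra $A$ in $\mathcal C$, such that $(-)^*$ sends algebra 2-cells between pseudomorphisms $JA\to TB$ to algebra 2-cells, and such that $\mu_{f,g}$, $\eta_f$ and $\theta_A$ are algebra 2-cells for all strict algebras $A,B,C$ in $\mathcal C$ and all pseudomorphisms $f:JA\to TB$ and $g:JB\to TC$. A lifting of $T$ to strict algebras is such a lifting in which the algebra structure on every $TA$ is strict. *Extensions.* An extension of $S$ to $\mathrm{Kl}(T)$ is a pseudomonad $\tilde S$ on $\mathrm{Kl}(T)$ with $\tilde SX=SX$ for every $X\in\mathcal C$, together with a morphism of pseudomonads from $(\mathcal C,S)$ to $(\mathrm{Kl}(T),\tilde S)$ over $F^T$ whose component $\tilde S F^TX\to F^T SX$ is the identity of $SX$ in $\mathrm{Kl}(T)$ for every $X$. In particular $\tilde S F^T\cong F^T S$, and the unit and multiplication of $\tilde S$ at $X$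 are isomorphic to $F^T(e_X)$ and $F^T(m_X)$. **Theorem.** Let $J:\mathcal C\to\mathcal D$ be a pseudofunctor between 2-categories, $T$ a relative pseudomonad over $J$, and $S$ a 2-monad on $\mathcal D$ that restricts along $J$. If $T$ has a lifting to strict algebras or a lifting to pseudoalgebras for $S$, then $S$ has an extension to a pseudomonad $\tilde S$ on the Kleisli bicategory $\mathrm{Kl}(T)$. -/

import Mathlib

open CategoryTheory Bicategory

universe w₁ w₂ w₃ v₁ v₂ v₃ u₁ u₂ u₃

/-- A relative pseudomonad over a pseudofunctor `J`: an object `T X` for every `X`, extension functors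
`f ↦ f^*` on hom-categories, unit morphisms `i_X : J X ⟶ T X`, and natural families of invertible
2-cells `μ : (g^* f)^* ≅ g^* f^*`, `η : f ≅ f^* i_X` and `θ : i_X^* ≅ 1`, subject to an associativity and
a unit axiom. Composition is written in diagrammatic order throughout. -/
structure RelPseudomonad {C : Type u₁} [Bicategory.{w₁, v₁} C] {D : Type u₂}
    [Bicategory.{w₂, v₂} D] (J : C ⥤ᵖ D) where
  obj : C → D
  ext {X Y : C} : (J.obj X ⟶ obj Y) ⥤ (obj X ⟶ obj Y)
  unit (X : C) : J.obj X ⟶ obj X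
  mu {X Y Z : C} (f : J.obj X ⟶ obj Y) (g : J.obj Y ⟶ obj Z) :
    ext.obj (f ≫ ext.obj g) ≅ ext.obj f ≫ ext.obj g
  eta {X Y : C} (f : J.obj X ⟶ obj Y) : f ≅ unit X ≫ ext.obj f
  theta (X : C) : ext.obj (unit X) ≅ 𝟙 (obj X)
  mu_natural_left {X Y Z : C} {f f' : J.obj X ⟶ obj Y} (φ : f ⟶ f') (g : J.obj Y ⟶ obj Z) :
    ext.map (φ ▷ ext.obj g) ≫ (mu f' g).hom = (mu f g).hom ≫ ext.map φ ▷ ext.obj g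
  mu_natural_right {X Y Z : C} (f : J.obj X ⟶ obj Y) {g g' : J.obj Y ⟶ obj Z} (ψ : g ⟶ g') :
    ext.map (f ◁ ext.map ψ) ≫ (mu f g').hom = (mu f g).hom ≫ ext.obj f ◁ ext.map ψ
  eta_natural {X Y : C} {f f' : J.obj X ⟶ obj Y} (φ : f ⟶ f') :
    φ ≫ (eta f').hom = (eta f).hom ≫ unit X ◁ ext.map φ
  assoc {X Y Z V : C} (f : J.obj X ⟶ obj Y) (g : J.obj Y ⟶ obj Z) (h : J.obj Z ⟶ obj V) :
    ext.map (f ◁ (mu g h).hom) ≫ ext.map (α_ f (ext.obj g) (ext.obj h)).inv ≫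
        (mu (f ≫ ext.obj g) h).hom ≫ (mu f g).hom ▷ ext.obj h ≫
          (α_ (ext.obj f) (ext.obj g) (ext.obj h)).hom =
      (mu f (g ≫ ext.obj h)).hom ≫ ext.obj f ◁ (mu g h).hom
  unit_comp {X Y : C} (f : J.obj X ⟶ obj Y) :
    ext.map (eta f).hom ≫ (mu (unit X) f).hom ≫ (theta X).hom ▷ ext.obj f =
      (λ_ (ext.obj f)).inv

namespace RelPseudomonad

variable {C : Type u₁} [Bicategory.{w₁, v₁} C] {D : Type u₂} [Bicategory.{w₂, v₂} D]
  {J : C ⥤ᵖ D}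

/-- The objects of the Kleisli bicategory of `T` are those of `C`. -/
def Kleisli (_T : RelPseudomonad J) : Type u₁ := C

variable (T : RelPseudomonad J)

/-- An object of `C`, seen as an object of the Kleisli bicategory. -/
def toKl (X : C) : T.Kleisli := X
/-- An object of the Kleisli bicategory, seen as an object of `C`. -/
def ofKl (X : T.Kleisli) : C := X

/-- Morphisms `X ⟶ Y` of the Kleisli bicategory: morphisms `J X ⟶ T Y` of `D`. -/
abbrev KlHom (X Y : T.Kleisli) : Type v₂ := J.obj (T.ofKl X) ⟶ T.obj (T.ofKl Y)

lemma mu_inv_natural_left {X Y Z : C} {f f' : J.obj X ⟶ T.obj Y} (φ : f ⟶ f') (g : J.obj Y ⟶ T.obj Z) :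
    (T.mu f g).inv ≫ T.ext.map (φ ▷ T.ext.obj g) = T.ext.map φ ▷ T.ext.obj g ≫ (T.mu f' g).inv := by
  rw [Iso.inv_comp_eq, ← Category.assoc, ← T.mu_natural_left]; simp

lemma mu_inv_natural_right {X Y Z : C} (f : J.obj X ⟶ T.obj Y) {g g' : J.obj Y ⟶ T.obj Z} (ψ : g ⟶ g') :
    (T.mu f g).inv ≫ T.ext.map (f ◁ T.ext.map ψ) = T.ext.obj f ◁ T.ext.map ψ ≫ (T.mu f g').inv := by
  rw [Iso.inv_comp_eq, ← Category.assoc, ← T.mu_natural_right]; simp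

lemma eta_inv_natural {X Y : C} {f f' : J.obj X ⟶ T.obj Y} (φ : f ⟶ f') :
    T.unit X ◁ T.ext.map φ ≫ (T.eta f').inv = (T.eta f).inv ≫ φ := by
  rw [Iso.eq_inv_comp, ← Category.assoc, ← T.eta_natural]; simp

lemma assoc_inv {X Y Z V : C} (f : J.obj X ⟶ T.obj Y) (g : J.obj Y ⟶ T.obj Z) (h : J.obj Z ⟶ T.obj V) :
    (α_ (T.ext.obj f) (T.ext.obj g) (T.ext.obj h)).inv ≫ (T.mu f g).inv ▷ T.ext.obj h ≫
      (T.mu (f ≫ T.ext.obj g) h).inv ≫ T.ext.map (α_ f (T.ext.obj g) (T.ext.obj h)).hom ≫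
      T.ext.map (f ◁ (T.mu g h).inv) = T.ext.obj f ◁ (T.mu g h).inv ≫ (T.mu f (g ≫ T.ext.obj h)).inv := by
  have := T.assoc f g h
  let i₁ := T.ext.mapIso (whiskerLeftIso f (T.mu g h)) ≪≫ T.ext.mapIso (α_ f (T.ext.obj g) (T.ext.obj h)).symm ≪≫ 
    T.mu (f ≫ T.ext.obj g) h ≪≫ whiskerRightIso (T.mu f g) (T.ext.obj h) ≪≫ α_ _ _ _
  let i₂ := T.mu f (g ≫ T.ext.obj h) ≪≫ whiskerLeftIso (T.ext.obj f) (T.mu g h)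
  have h12 : i₁ = i₂ := Iso.ext (by simpa [i₁, i₂] using this)
  simpa [i₁, i₂] using congrArg Iso.inv h12


section

variable {X Y Z V W : C}

/-- The associator of the Kleisli bicategory. -/
def klAssoc (f : J.obj X ⟶ T.obj Y) (g : J.obj Y ⟶ T.obj Z) (h : J.obj Z ⟶ T.obj V) :
    (f ≫ T.ext.obj g) ≫ T.ext.obj h ≅ f ≫ T.ext.obj (g ≫ T.ext.obj h) :=
  α_ f (T.ext.obj g) (T.ext.obj h) ≪≫ whiskerLeftIso f (T.mu g h).symm

/-- The right unitor of the Kleisli bicategory. -/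
def klRightUnitor (f : J.obj X ⟶ T.obj Y) : f ≫ T.ext.obj (T.unit Y) ≅ f :=
  whiskerLeftIso f (T.theta Y) ≪≫ ρ_ f

lemma kl_id_whiskerLeft {f g : J.obj X ⟶ T.obj Y} (η : f ⟶ g) :
    T.unit X ◁ T.ext.map η = (T.eta f).symm.hom ≫ η ≫ (T.eta g).symm.inv := by
  simp only [Iso.symm_hom, Iso.symm_inv]
  rw [T.eta_natural]
  simp

lemma kl_comp_whiskerLeft (f : J.obj X ⟶ T.obj Y) (g : J.obj Y ⟶ T.obj Z)
    {h h' : J.obj Z ⟶ T.obj V} (η : h ⟶ h') :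
    (f ≫ T.ext.obj g) ◁ T.ext.map η =
      (T.klAssoc f g h).hom ≫ f ◁ T.ext.map (g ◁ T.ext.map η) ≫ (T.klAssoc f g h').inv := by
  simp only [klAssoc, Iso.trans_hom, Iso.trans_inv, whiskerLeftIso_hom, whiskerLeftIso_inv,
    Iso.symm_hom, Iso.symm_inv, Category.assoc]
  rw [← whiskerLeft_comp_assoc, mu_inv_natural_right]
  simp

lemma kl_whiskerRight_id {f g : J.obj X ⟶ T.obj Y} (η : f ⟶ g) :
    η ▷ T.ext.obj (T.unit Y) = (T.klRightUnitor f).hom ≫ η ≫ (T.klRightUnitor g).inv := by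
  simp only [klRightUnitor, Iso.trans_hom, Iso.trans_inv, whiskerLeftIso_hom, whiskerLeftIso_inv,
    Category.assoc]
  rw [← rightUnitor_naturality_assoc, Iso.hom_inv_id_assoc, whisker_exchange_assoc]
  simp

lemma kl_whiskerRight_comp {f f' : J.obj X ⟶ T.obj Y} (η : f ⟶ f') (g : J.obj Y ⟶ T.obj Z)
    (h : J.obj Z ⟶ T.obj V) :
    η ▷ T.ext.obj (g ≫ T.ext.obj h) =
      (T.klAssoc f g h).inv ≫ η ▷ T.ext.obj g ▷ T.ext.obj h ≫ (T.klAssoc f' g h).hom := by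
  simp only [klAssoc, Iso.trans_hom, Iso.trans_inv, whiskerLeftIso_hom, whiskerLeftIso_inv,
    Iso.symm_hom, Iso.symm_inv, Category.assoc]
  rw [associator_naturality_left_assoc, Iso.inv_hom_id_assoc, whisker_exchange_assoc]
  simp

lemma kl_whisker_assoc (f : J.obj X ⟶ T.obj Y) {g g' : J.obj Y ⟶ T.obj Z} (η : g ⟶ g')
    (h : J.obj Z ⟶ T.obj V) :
    (f ◁ T.ext.map η) ▷ T.ext.obj h =
      (T.klAssoc f g h).hom ≫ f ◁ T.ext.map (η ▷ T.ext.obj h) ≫ (T.klAssoc f g' h).inv := by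
  simp only [klAssoc, Iso.trans_hom, Iso.trans_inv, whiskerLeftIso_hom, whiskerLeftIso_inv,
    Iso.symm_hom, Iso.symm_inv, Category.assoc]
  rw [← whiskerLeft_comp_assoc, mu_inv_natural_left]
  simp

lemma kl_pentagon (f : J.obj X ⟶ T.obj Y) (g : J.obj Y ⟶ T.obj Z) (h : J.obj Z ⟶ T.obj V)
    (k : J.obj V ⟶ T.obj W) :
    (T.klAssoc f g h).hom ▷ T.ext.obj k ≫ (T.klAssoc f (g ≫ T.ext.obj h) k).hom ≫
        f ◁ T.ext.map (T.klAssoc g h k).hom =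
      (T.klAssoc (f ≫ T.ext.obj g) h k).hom ≫ (T.klAssoc f g (h ≫ T.ext.obj k)).hom := by
  have := T.assoc_inv g h k
  simp only [klAssoc, Iso.trans_hom, whiskerLeftIso_hom, Iso.symm_hom, Category.assoc,
    Functor.map_comp, comp_whiskerRight, whisker_assoc, whiskerLeft_comp]
  simp only [comp_whiskerLeft, Category.assoc, Iso.inv_hom_id_assoc, ← whiskerLeft_comp, ← this]
  simp

lemma kl_triangle (f : J.obj X ⟶ T.obj Y) (g : J.obj Y ⟶ T.obj Z) :
    (T.klAssoc f (T.unit Y) g).hom ≫ f ◁ T.ext.map (T.eta g).symm.hom =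
      (T.klRightUnitor f).hom ▷ T.ext.obj g := by
  have h := T.unit_comp g
  have : (T.theta Y).hom ▷ T.ext.obj g =
      (T.mu (T.unit Y) g).inv ≫ T.ext.map (T.eta g).inv ≫ (λ_ (T.ext.obj g)).inv := by
    rw [← h, ← Functor.map_comp_assoc]
    simp
  simp [klAssoc, klRightUnitor, this]

end

/-- The Kleisli bicategory of a relative pseudomonad: the composite of `f : J X ⟶ T Y` and
`g : J Y ⟶ T Z` is `f ≫ g^*`, and the identity of `X` is the unit `i_X`. -/
instance kleisliBicategory : Bicategory T.Kleisli where
  Hom X Y := T.KlHom X Y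
  id X := T.unit (T.ofKl X)
  comp f g := f ≫ T.ext.obj g
  homCategory X Y := inferInstanceAs (Category (T.KlHom X Y))
  whiskerLeft {X Y Z} (f : T.KlHom X Y) {g h : T.KlHom Y Z} η := f ◁ T.ext.map η
  whiskerRight {X Y Z} {f g : T.KlHom X Y} η (h : T.KlHom Y Z) := η ▷ T.ext.obj h
  associator f g h := T.klAssoc f g h
  leftUnitor f := (T.eta f).symm
  rightUnitor f := T.klRightUnitor f
  whiskerLeft_id f g := by simp
  whiskerLeft_comp f _ _ _ η θ := by simp
  id_whiskerLeft η := T.kl_id_whiskerLeft η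
  comp_whiskerLeft f g _ _ η := T.kl_comp_whiskerLeft f g η
  id_whiskerRight f g := by simp
  comp_whiskerRight η θ i := by simp
  whiskerRight_id η := T.kl_whiskerRight_id η
  whiskerRight_comp η g h := T.kl_whiskerRight_comp η g h
  whisker_assoc f _ _ η h := T.kl_whisker_assoc f η h
  whisker_exchange η θ := whisker_exchange η (T.ext.map θ)
  pentagon f g h k := T.kl_pentagon f g h k
  triangle f g := T.kl_triangle f g

lemma mu_eta {X Y Z : C} (f : J.obj X ⟶ T.obj Y) (g : J.obj Y ⟶ T.obj Z) :
    (T.eta (f ≫ T.ext.obj g)).hom ≫ T.unit X ◁ (T.mu f g).hom =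
      (T.eta f).hom ▷ T.ext.obj g ≫ (α_ _ _ _).hom := by
  have h : (T.eta (f ≫ T.ext.obj g)).hom =
      (T.eta f).hom ▷ T.ext.obj g ≫ (T.klAssoc (T.unit X) f g).hom :=
    leftUnitor_comp_inv (B := T.Kleisli) (a := T.toKl X) (b := T.toKl Y) (c := T.toKl Z) f g
  rw [h]
  simp [klAssoc]

lemma eta_theta (X : C) :
    (T.eta (T.unit X)).hom ≫ T.unit X ◁ (T.theta X).hom = (ρ_ (T.unit X)).inv := by
  have h : (T.eta (T.unit X)).inv = (T.klRightUnitor (T.unit X)).hom :=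
    unitors_equal (B := T.Kleisli) (a := T.toKl X)
  rw [← Iso.eq_inv_comp, h]
  simp [klRightUnitor]

section

variable {X Y Z V : C}

/-- Unit comparison of the free pseudofunctor `free`. -/
def freeId (X : C) : J.map (𝟙 X) ≫ T.unit X ≅ T.unit X :=
  whiskerRightIso (J.mapId X) (T.unit X) ≪≫ λ_ (T.unit X)

/-- Composition comparison of the free pseudofunctor `free`. -/
def freeComp (f : X ⟶ Y) (g : Y ⟶ Z) :
    J.map (f ≫ g) ≫ T.unit Z ≅ (J.map f ≫ T.unit Y) ≫ T.ext.obj (J.map g ≫ T.unit Z) :=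
  whiskerRightIso (J.mapComp f g) (T.unit Z) ≪≫ α_ _ _ _ ≪≫
    whiskerLeftIso (J.map f) (T.eta (J.map g ≫ T.unit Z)) ≪≫ (α_ _ _ _).symm

lemma free_whiskerLeft (f : X ⟶ Y) {g h : Y ⟶ Z} (η : g ⟶ h) :
    J.map₂ (f ◁ η) ▷ T.unit Z = (T.freeComp f g).hom ≫
      (J.map f ≫ T.unit Y) ◁ T.ext.map (J.map₂ η ▷ T.unit Z) ≫ (T.freeComp f h).inv := by
  have := T.eta_inv_natural (J.map₂ η ▷ T.unit Z)
  simp only [freeComp, Iso.trans_hom, Iso.trans_inv, whiskerLeftIso_hom, whiskerLeftIso_inv,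
    Iso.symm_hom, Iso.symm_inv, Category.assoc, comp_whiskerLeft, Iso.inv_hom_id_assoc,
    whiskerRightIso_hom, whiskerRightIso_inv, ← whiskerLeft_comp_assoc, this,
    Iso.hom_inv_id_assoc]
  simp

lemma free_whiskerRight {f g : X ⟶ Y} (η : f ⟶ g) (h : Y ⟶ Z) :
    J.map₂ (η ▷ h) ▷ T.unit Z = (T.freeComp f h).hom ≫
      (J.map₂ η ▷ T.unit Y) ▷ T.ext.obj (J.map h ≫ T.unit Z) ≫ (T.freeComp g h).inv := by
  simp only [freeComp, Iso.trans_hom, Iso.trans_inv, whiskerLeftIso_hom, whiskerLeftIso_inv,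
    Iso.symm_hom, Iso.symm_inv, Category.assoc,
    whiskerRightIso_hom, whiskerRightIso_inv, associator_naturality_left_assoc,
    Iso.inv_hom_id_assoc, whisker_exchange_assoc]
  simp

lemma free_associator (f : X ⟶ Y) (g : Y ⟶ Z) (h : Z ⟶ V) :
    J.map₂ (α_ f g h).hom ▷ T.unit V = (T.freeComp (f ≫ g) h).hom ≫
      (T.freeComp f g).hom ▷ T.ext.obj (J.map h ≫ T.unit V) ≫
      (T.klAssoc (J.map f ≫ T.unit Y) (J.map g ≫ T.unit Z) (J.map h ≫ T.unit V)).hom ≫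
      (J.map f ≫ T.unit Y) ◁ T.ext.map (T.freeComp g h).inv ≫ (T.freeComp f (g ≫ h)).inv := by
  have e : (T.eta (J.map g ≫ T.unit Z)).hom ▷ T.ext.obj (J.map h ≫ T.unit V) ≫
      (α_ _ _ _).hom ≫ T.unit Y ◁ (T.mu (J.map g ≫ T.unit Z) (J.map h ≫ T.unit V)).inv ≫
        T.unit Y ◁ T.ext.map (T.freeComp g h).inv ≫ (T.eta (J.map (g ≫ h) ≫ T.unit V)).inv =
      (T.freeComp g h).inv := by
    rw [← reassoc_of% T.mu_eta (J.map g ≫ T.unit Z) (J.map h ≫ T.unit V), T.eta_inv_natural]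
    simp
  have e' := congrArg (fun x => J.map f ◁ x) e
  simp only [whiskerLeft_comp] at e'
  have : (T.freeComp f g).hom ▷ T.ext.obj (J.map h ≫ T.unit V) ≫
      (T.klAssoc (J.map f ≫ T.unit Y) (J.map g ≫ T.unit Z) (J.map h ≫ T.unit V)).hom ≫
      (J.map f ≫ T.unit Y) ◁ T.ext.map (T.freeComp g h).inv ≫ (T.freeComp f (g ≫ h)).inv =
      (J.mapComp f g).hom ▷ T.unit Z ▷ T.ext.obj (J.map h ≫ T.unit V) ≫
        (α_ _ _ _).hom ▷ _ ≫ (α_ _ _ _).hom ≫ J.map f ◁ (T.freeComp g h).inv ≫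
          (α_ _ _ _).inv ≫ (J.mapComp f (g ≫ h)).inv ▷ T.unit V := by
    rw [← e']
    simp [freeComp, klAssoc]
  rw [this]
  simp only [freeComp, Iso.trans_hom, Iso.trans_inv, whiskerLeftIso_hom, whiskerLeftIso_inv,
    Iso.symm_hom, Iso.symm_inv, Category.assoc,
    whiskerRightIso_hom, whiskerRightIso_inv]
  rw [← associator_inv_naturality_left_assoc, whisker_exchange_assoc]
  simp

lemma free_leftUnitor (f : X ⟶ Y) :
    J.map₂ (λ_ f).hom ▷ T.unit Y = (T.freeComp (𝟙 X) f).hom ≫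
      (T.freeId X).hom ▷ T.ext.obj (J.map f ≫ T.unit Y) ≫
      (T.eta (J.map f ≫ T.unit Y)).symm.hom := by
  simp only [freeComp, freeId, Iso.trans_hom, whiskerLeftIso_hom, Iso.symm_hom, Category.assoc,
    whiskerRightIso_hom, comp_whiskerRight]
  rw [← associator_inv_naturality_left_assoc, whisker_exchange_assoc]
  simp

lemma free_rightUnitor (f : X ⟶ Y) :
    J.map₂ (ρ_ f).hom ▷ T.unit Y = (T.freeComp f (𝟙 Y)).hom ≫
      (J.map f ≫ T.unit Y) ◁ T.ext.map (T.freeId Y).hom ≫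
      (T.klRightUnitor (J.map f ≫ T.unit Y)).hom := by
  have e : (T.eta (J.map (𝟙 Y) ≫ T.unit Y)).hom ≫ T.unit Y ◁ T.ext.map (T.freeId Y).hom ≫
      T.unit Y ◁ (T.theta Y).hom = (T.freeId Y).hom ≫ (ρ_ _).inv := by
    rw [← reassoc_of% T.eta_natural (T.freeId Y).hom, T.eta_theta]
  have e' := congrArg (fun x => J.map f ◁ x) e
  simp only [whiskerLeft_comp] at e'
  simp only [freeComp, klRightUnitor, Iso.trans_hom, whiskerLeftIso_hom, Iso.symm_hom,
    Category.assoc, whiskerRightIso_hom, comp_whiskerLeft, Iso.inv_hom_id_assoc,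
    reassoc_of% e']
  simp [freeId]

end

/-- The pseudofunctor from `C` to the Kleisli bicategory that is the identity on objects and sends
`f : X ⟶ Y` to `J f ≫ i_Y`. -/
def free : C ⥤ᵖ T.Kleisli where
  obj X := T.toKl X
  map {X Y} f := (J.map f ≫ T.unit Y : J.obj X ⟶ T.obj Y)
  map₂ {X Y f g} η := J.map₂ η ▷ T.unit Y
  map₂_id {X Y} f := by
    simp only [PrelaxFunctor.map₂_id, id_whiskerRight]; rfl
  map₂_comp {X Y f g h} η θ := by
    simp only [PrelaxFunctor.map₂_comp, comp_whiskerRight]; rfl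
  mapId X := T.freeId X
  mapComp f g := T.freeComp f g
  map₂_whisker_left f _ _ η := T.free_whiskerLeft f η
  map₂_whisker_right η h := T.free_whiskerRight η h
  map₂_associator f g h := T.free_associator f g h
  map₂_left_unitor f := T.free_leftUnitor f
  map₂_right_unitor f := T.free_rightUnitor f

end RelPseudomonad

section PseudofunctorSquares

variable {B : Type u₁} [Bicategory.{w₁, v₁} B] {B' : Type u₂} [Bicategory.{w₂, v₂} B']

namespace CategoryTheory.Pseudofunctor

variable (F : B ⥤ᵖ B')

@[simps]
def mapSq {a b c d : B} {f : a ⟶ b} {g : b ⟶ d} {h : a ⟶ c} {k : c ⟶ d}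
    (θ : f ≫ g ≅ h ≫ k) : F.map f ≫ F.map g ≅ F.map h ≫ F.map k where
  hom := (F.mapComp f g).inv ≫ F.map₂ θ.hom ≫ (F.mapComp h k).hom
  inv := (F.mapComp h k).inv ≫ F.map₂ θ.inv ≫ (F.mapComp f g).hom
  hom_inv_id := by simp [← PrelaxFunctor.map₂_comp_assoc]
  inv_hom_id := by simp [← PrelaxFunctor.map₂_comp_assoc]

/-- The image of a triangle `f ≫ g ≅ h` under a pseudofunctor. -/
@[simps]
def mapTri {a b c : B} {f : a ⟶ b} {g : b ⟶ c} {h : a ⟶ c} (θ : f ≫ g ≅ h) :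
    F.map f ≫ F.map g ≅ F.map h where
  hom := (F.mapComp f g).inv ≫ F.map₂ θ.hom
  inv := F.map₂ θ.inv ≫ (F.mapComp f g).hom
  hom_inv_id := by simp [← PrelaxFunctor.map₂_comp_assoc]
  inv_hom_id := by simp [← PrelaxFunctor.map₂_comp]

/-- The image of a triangle `f ≫ g ≅ 𝟙` under a pseudofunctor. -/
@[simps]
def mapTriId {a b : B} {f : a ⟶ b} {g : b ⟶ a} (θ : f ≫ g ≅ 𝟙 a) :
    F.map f ≫ F.map g ≅ 𝟙 (F.obj a) where
  hom := (F.mapTri θ).hom ≫ (F.mapId a).hom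
  inv := (F.mapId a).inv ≫ (F.mapTri θ).inv
  hom_inv_id := by rw [Category.assoc, Iso.hom_inv_id_assoc, Iso.hom_inv_id]
  inv_hom_id := by rw [Category.assoc, Iso.inv_hom_id_assoc, Iso.inv_hom_id]

lemma map₂_assoc_inv {a b c d : B} (f : a ⟶ b) (g : b ⟶ c) (h : c ⟶ d) :
    F.map₂ (α_ f g h).inv = (F.mapComp f (g ≫ h)).hom ≫ F.map f ◁ (F.mapComp g h).hom ≫
      (α_ _ _ _).inv ≫ (F.mapComp f g).inv ▷ F.map h ≫ (F.mapComp (f ≫ g) h).inv := by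
  rw [← cancel_epi (F.map₂ (α_ f g h).hom), ← PrelaxFunctor.map₂_comp]
  simp

lemma map₂_runit_inv {a b : B} (f : a ⟶ b) :
    F.map₂ (ρ_ f).inv = (ρ_ _).inv ≫ F.map f ◁ (F.mapId b).inv ≫ (F.mapComp f (𝟙 b)).inv := by
  rw [← cancel_epi (F.map₂ (ρ_ f).hom), ← PrelaxFunctor.map₂_comp]
  simp

lemma mapSq_paste {a₁ a₂ a₃ b₁ b₂ b₃ : B} {f : a₁ ⟶ a₂} {g : a₂ ⟶ a₃} {f' : b₁ ⟶ b₂} {g' : b₂ ⟶ b₃}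
    {x₁ : a₁ ⟶ b₁} {x₂ : a₂ ⟶ b₂} {x₃ : a₃ ⟶ b₃} (θ : f ≫ x₂ ≅ x₁ ≫ f') (ξ : g ≫ x₃ ≅ x₂ ≫ g') :
    (F.mapSq (α_ f g x₃ ≪≫ whiskerLeftIso f ξ ≪≫ (α_ _ _ _).symm ≪≫ whiskerRightIso θ g' ≪≫
      α_ _ _ _)).hom =
    (F.mapComp f g).hom ▷ F.map x₃ ≫ (α_ _ _ _).hom ≫ F.map f ◁ (F.mapSq ξ).hom ≫
      (α_ _ _ _).inv ≫ (F.mapSq θ).hom ▷ F.map g' ≫ (α_ _ _ _).hom ≫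
        F.map x₁ ◁ (F.mapComp f' g').inv := by
  simp [map₂_assoc_inv]

lemma mapSq_pre {a b c d : B} {f f' : a ⟶ b} {g : b ⟶ d} {h : a ⟶ c}
    {k : c ⟶ d} (φ : f' ≅ f) (θ : f ≫ g ≅ h ≫ k) :
    (F.mapSq (whiskerRightIso φ g ≪≫ θ)).hom = F.map₂ φ.hom ▷ F.map g ≫ (F.mapSq θ).hom := by
  simp

lemma mapSq_mapSq {B'' : Type u₃} [Bicategory.{w₃, v₃} B''] (G : B' ⥤ᵖ B'')
    {a b c d : B} {f : a ⟶ b} {g : b ⟶ d} {h : a ⟶ c} {k : c ⟶ d} (θ : f ≫ g ≅ h ≫ k) :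
    (G.map₂ (F.mapComp f g).hom ≫ (G.mapComp (F.map f) (F.map g)).hom) ≫
      (G.mapSq (F.mapSq θ)).hom = G.map₂ (F.map₂ θ.hom) ≫ (G.map₂ (F.mapComp h k).hom ≫
        (G.mapComp (F.map h) (F.map k)).hom) := by
  simp only [mapSq_hom, PrelaxFunctor.map₂_comp, Category.assoc, Iso.hom_inv_id_assoc]
  rw [← PrelaxFunctor.map₂_comp_assoc, Iso.hom_inv_id, PrelaxFunctor.map₂_id, Category.id_comp]

lemma mapSq_cube {p q r s t x y z : B} {f : p ⟶ q} {g : q ⟶ s} {h : p ⟶ r} {k : r ⟶ s}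
    {a : s ⟶ z} {l : r ⟶ t} {a' : t ⟶ z} {n : p ⟶ x} {l' : x ⟶ t} {u : q ⟶ y} {v : y ⟶ z} {w : x ⟶ y}
    (θ₁ : f ≫ g ≅ h ≫ k) (θ₂ : k ≫ a ≅ l ≫ a') (θ₃ : h ≫ l ≅ n ≫ l')
    (θ₄ : g ≫ a ≅ u ≫ v) (θ₅ : f ≫ u ≅ n ≫ w) (θ₆ : w ≫ v ≅ l' ≫ a')
    (H : θ₁.hom ▷ a ⊗≫ h ◁ θ₂.hom ⊗≫ θ₃.hom ▷ a' ≫ (α_ _ _ _).hom =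
      (α_ _ _ _).hom ≫ f ◁ θ₄.hom ⊗≫ θ₅.hom ▷ v ⊗≫ n ◁ θ₆.hom) :
    (F.mapSq θ₁).hom ▷ F.map a ⊗≫ F.map h ◁ (F.mapSq θ₂).hom ⊗≫
      (F.mapSq θ₃).hom ▷ F.map a' ≫ (α_ _ _ _).hom =
      (α_ _ _ _).hom ≫ F.map f ◁ (F.mapSq θ₄).hom ⊗≫ (F.mapSq θ₅).hom ▷ F.map v ⊗≫
        F.map n ◁ (F.mapSq θ₆).hom := by
  have H' := congrArg (fun ξ => (F.mapComp f g).inv ▷ F.map a ≫ (F.mapComp (f ≫ g) a).inv ≫ F.map₂ ξ ≫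
    (F.mapComp n (l' ≫ a')).hom ≫ F.map n ◁ (F.mapComp l' a').hom) H
  simp [bicategoricalComp, Pseudofunctor.map₂_assoc_inv] at H'
  simpa [bicategoricalComp] using H'

lemma mapSq_alg {x y z a b c : B} {P : x ⟶ y} {p : x ⟶ z} {q : z ⟶ y} {k : y ⟶ b} {j : b ⟶ c}
    {k' : z ⟶ a} {r : a ⟶ b} {t : a ⟶ b} {m : x ⟶ y}
    (c₀ : P ≅ p ≫ q) (n : q ≫ k ≅ k' ≫ r) (s : r ≫ j ≅ t ≫ j) (w : m ≫ k ≅ p ≫ k' ≫ t) :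
    (F.mapSq (f := P) (g := k ≫ j) (h := m) (k := k ≫ j) (whiskerRightIso c₀ (k ≫ j) ≪⊗≫ whiskerLeftIso p (whiskerRightIso n j) ≪⊗≫
      whiskerLeftIso (p ≫ k') s ≪⊗≫ whiskerRightIso w.symm j ≪≫ α_ _ _ _)).hom ⊗≫
      F.map m ◁ (F.mapComp k j).hom ⊗≫
      (F.mapSq w).hom ▷ F.map j ⊗≫
      F.map p ◁ (F.mapComp k' t).hom ▷ F.map j ⊗≫
      𝟙 (F.map p ≫ F.map k' ≫ F.map t ≫ F.map j) =
    (F.map₂ c₀.hom ≫ (F.mapComp p q).hom) ▷ F.map (k ≫ j) ⊗≫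
      (F.map p ≫ F.map q) ◁ (F.mapComp k j).hom ⊗≫
      F.map p ◁ (F.mapSq n).hom ▷ F.map j ⊗≫
      (F.map p ≫ F.map k') ◁ (F.mapSq s).hom ⊗≫
      𝟙 (F.map p ≫ F.map k' ≫ F.map t ≫ F.map j) := by
  simp [bicategoricalComp, bicategoricalIsoComp, Pseudofunctor.map₂_assoc_inv]
  rw [← comp_whiskerRight_assoc (F.map₂ w.inv), PrelaxFunctor.map₂_inv_hom,
    ← associator_naturality_right_assoc, ← whisker_exchange_assoc, ← whisker_exchange_assoc]
  simp
lemma mapTriId_alg {x y c : B} {e : x ⟶ y} {k : y ⟶ c} {j : c ⟶ x} {p : x ⟶ c}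
    (u : e ≫ k ≅ p) (θ : p ≫ j ≅ 𝟙 x) :
    (F.mapTriId (f := e) (g := k ≫ j) (θ.symm ≪≫ whiskerRightIso u.symm j ≪≫ α_ _ _ _).symm).inv ⊗≫
      F.map e ◁ (F.mapComp k j).hom ⊗≫ (F.mapTri u).hom ▷ F.map j = (F.mapTriId θ).inv := by
  simp only [bicategoricalComp, mapTriId_inv, mapTri_hom]
  simp
  rw [← comp_whiskerRight (F.map₂ u.inv), PrelaxFunctor.map₂_inv_hom]
  simp

lemma mapTriId_sq {x y z : B} {e : x ⟶ y} {j : y ⟶ x} {m : y ⟶ x} {a : x ⟶ z}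
    (u : e ≫ j ≅ 𝟙 x) (θ : j ≫ a ≅ m ≫ a) (r : e ≫ m ≅ 𝟙 x)
    (H : u.inv ▷ a ⊗≫ e ◁ θ.hom ⊗≫ r.hom ▷ a = 𝟙 (𝟙 x ≫ a)) :
    (F.mapTriId u).inv ▷ F.map a ⊗≫ F.map e ◁ (F.mapSq θ).hom ⊗≫ (F.mapTriId r).hom ▷ F.map a =
      𝟙 (𝟙 (F.obj x) ≫ F.map a) := by
  have H' := congrArg (fun ξ => (F.mapId x).inv ▷ F.map a ≫ (F.mapComp (𝟙 x) a).inv ≫ F.map₂ ξ ≫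
    (F.mapComp (𝟙 x) a).hom ≫ (F.mapId x).hom ▷ F.map a) H
  simp [bicategoricalComp, Pseudofunctor.map₂_assoc_inv] at H'
  simpa [bicategoricalComp] using H'

end CategoryTheory.Pseudofunctor
end PseudofunctorSquares
/-- A pseudofunctor `S` with pseudonatural transformations `m : S S ⟶ S` and `e : 1 ⟶ S`. -/
structure PseudomonadData (B : Type u₁) [Bicategory.{w₁, v₁} B] where
  fn : B ⥤ᵖ B
  mulTrans : Pseudofunctor.StrongTrans (fn.comp fn) fn
  unitTrans : Pseudofunctor.StrongTrans (Pseudofunctor.id B) fn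

namespace PseudomonadData

variable {B : Type u₁} [Bicategory.{w₁, v₁} B] (S : PseudomonadData B)

/-- The object `S X`. -/
abbrev obj (X : B) : B := S.fn.obj X
/-- The morphism `S f`. -/
abbrev map {X Y : B} (f : X ⟶ Y) : S.obj X ⟶ S.obj Y := S.fn.map f
/-- The multiplication at `X`. -/
abbrev m (X : B) : S.obj (S.obj X) ⟶ S.obj X := S.mulTrans.app X
/-- The unit at `X`. -/
abbrev e (X : B) : X ⟶ S.obj X := S.unitTrans.app X
/-- The pseudonaturality 2-cell of the multiplication at `f`. -/
abbrev mNat {X Y : B} (f : X ⟶ Y) : S.map (S.map f) ≫ S.m Y ≅ S.m X ≫ S.map f :=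
  S.mulTrans.naturality f
/-- The pseudonaturality 2-cell of the unit at `f`. -/
abbrev eNat {X Y : B} (f : X ⟶ Y) : f ≫ S.e Y ≅ S.e X ≫ S.map f :=
  S.unitTrans.naturality f

lemma mNat_id (A : B) : (S.mNat (𝟙 A)).hom ≫ S.m A ◁ (S.fn.mapId A).hom =
    S.fn.map₂ (S.fn.mapId A).hom ▷ S.m A ≫ (S.fn.mapId (S.obj A)).hom ▷ S.m A ≫
      (λ_ (S.m A)).hom ≫ (ρ_ (S.m A)).inv := by
  rw [← comp_whiskerRight_assoc]
  exact S.mulTrans.naturality_id A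

lemma eNat_id (A : B) : (S.eNat (𝟙 A)).hom ≫ S.e A ◁ (S.fn.mapId A).hom =
      (λ_ (S.e A)).hom ≫ (ρ_ (S.e A)).inv := by
  refine (S.unitTrans.naturality_id A).trans ?_
  exact (congrArg (· ≫ _) (id_whiskerRight _ _)).trans (Category.id_comp _)

lemma mNat_comp {X Y Z : B} (f : X ⟶ Y) (g : Y ⟶ Z) :
    (S.mNat (f ≫ g)).hom ≫ S.m X ◁ (S.fn.mapComp f g).hom =
      (S.fn.map₂ (S.fn.mapComp f g).hom ≫ (S.fn.mapComp (S.map f) (S.map g)).hom) ▷ S.m Z ≫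
        (α_ _ _ _).hom ≫ S.map (S.map f) ◁ (S.mNat g).hom ≫ (α_ _ _ _).inv ≫
          (S.mNat f).hom ▷ S.map g ≫ (α_ _ _ _).hom :=
  S.mulTrans.naturality_comp f g

lemma eNat_comp {X Y Z : B} (f : X ⟶ Y) (g : Y ⟶ Z) :
    (S.eNat (f ≫ g)).hom ≫ S.e X ◁ (S.fn.mapComp f g).hom =
      (α_ _ _ _).hom ≫ f ◁ (S.eNat g).hom ≫ (α_ _ _ _).inv ≫
        (S.eNat f).hom ▷ S.map g ≫ (α_ _ _ _).hom := by
  refine (S.unitTrans.naturality_comp f g).trans ?_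
  exact (congrArg (· ≫ _) (id_whiskerRight _ _)).trans (Category.id_comp _)

lemma mNat_natural {X Y : B} {f g : X ⟶ Y} (φ : f ⟶ g) :
    S.fn.map₂ (S.fn.map₂ φ) ▷ S.m Y ≫ (S.mNat g).hom = (S.mNat f).hom ≫ S.m X ◁ S.fn.map₂ φ :=
  S.mulTrans.naturality_naturality φ

lemma eNat_natural {X Y : B} {f g : X ⟶ Y} (φ : f ⟶ g) :
    φ ▷ S.e Y ≫ (S.eNat g).hom = (S.eNat f).hom ≫ S.e X ◁ S.fn.map₂ φ :=
  S.unitTrans.naturality_naturality φ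

end PseudomonadData

/-- The components of the associativity and unit modifications of a pseudomonad. -/
structure PseudomonadData.Cells {B : Type u₁} [Bicategory.{w₁, v₁} B] (S : PseudomonadData B) where
  assoc (X : B) : S.map (S.m X) ≫ S.m X ≅ S.m (S.obj X) ≫ S.m X
  left (X : B) : 𝟙 (S.obj X) ≅ S.e (S.obj X) ≫ S.m X
  right (X : B) : S.map (S.e X) ≫ S.m X ≅ 𝟙 (S.obj X)

/-- The axioms of a pseudomonad: `assoc`, `left` and `right` are modifications (the first three fields),
and they satisfy the two coherence axioms. The sign `⊗≫` is composition up to structural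
associativity and unit isomorphisms. -/
structure PseudomonadData.Coherence {B : Type u₁} [Bicategory.{w₁, v₁} B] (S : PseudomonadData B)
    (c : S.Cells) : Prop where
  assoc_natural {X Y : B} (f : X ⟶ Y) :
    (α_ _ _ _).inv ≫ (S.fn.mapSq (S.mNat f)).hom ▷ S.m Y ⊗≫ S.map (S.m X) ◁ (S.mNat f).hom ⊗≫
        (c.assoc X).hom ▷ S.map f ≫ (α_ _ _ _).hom =
      S.map (S.map (S.map f)) ◁ (c.assoc Y).hom ⊗≫ (S.mNat (S.map f)).hom ▷ S.m Y ⊗≫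
        S.m (S.obj X) ◁ (S.mNat f).hom
  left_natural {X Y : B} (f : X ⟶ Y) :
    S.map f ◁ (c.left Y).hom ⊗≫ (S.eNat (S.map f)).hom ▷ S.m Y ⊗≫
        S.e (S.obj X) ◁ (S.mNat f).hom =
      (ρ_ _).hom ≫ (λ_ _).inv ≫ (c.left X).hom ▷ S.map f ≫ (α_ _ _ _).hom
  right_natural {X Y : B} (f : X ⟶ Y) :
    (α_ _ _ _).inv ≫ (S.fn.mapSq (S.eNat f)).hom ▷ S.m Y ⊗≫ S.map (S.e X) ◁ (S.mNat f).hom ⊗≫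
        (c.right X).hom ▷ S.map f ≫ (λ_ _).hom ≫ (ρ_ _).inv =
      S.map f ◁ (c.right Y).hom
  assoc_assoc (X : B) :
    (S.fn.mapSq (c.assoc X)).hom ▷ S.m X ⊗≫ S.map (S.m (S.obj X)) ◁ (c.assoc X).hom ⊗≫
        (c.assoc (S.obj X)).hom ▷ S.m X ≫ (α_ _ _ _).hom =
      (α_ _ _ _).hom ≫ S.map (S.map (S.m X)) ◁ (c.assoc X).hom ⊗≫
        (S.mNat (S.m X)).hom ▷ S.m X ⊗≫ S.m (S.obj (S.obj X)) ◁ (c.assoc X).hom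
  unit_assoc (X : B) :
    (S.fn.mapTriId (c.left X).symm).inv ▷ S.m X ⊗≫ S.map (S.e (S.obj X)) ◁ (c.assoc X).hom ⊗≫
        (c.right (S.obj X)).hom ▷ S.m X =
      𝟙 (𝟙 (S.obj (S.obj X)) ≫ S.m X)

/-- A pseudomonad on a bicategory. -/
structure Pseudomonad (B : Type u₁) [Bicategory.{w₁, v₁} B] extends PseudomonadData B where
  cells : toPseudomonadData.Cells
  coherence : toPseudomonadData.Coherence cells

/-- A 2-monad on a 2-category, that is, a pseudomonad all of whose constraint 2-cells are identities:
a strict 2-functor with strictly 2-natural multiplication and unit that satisfy the monad laws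
strictly. (`eqToIso` is the identity 2-cell between equal morphisms.) -/
structure TwoMonad (B : Type u₁) [Bicategory.{w₁, v₁} B] [Bicategory.Strict B] extends
    Pseudomonad B where
  mapId_eq (X : B) : ∃ h, fn.mapId X = eqToIso h
  mapComp_eq {X Y Z : B} (f : X ⟶ Y) (g : Y ⟶ Z) : ∃ h, fn.mapComp f g = eqToIso h
  mNat_eq {X Y : B} (f : X ⟶ Y) : ∃ h, toPseudomonadData.mNat f = eqToIso h
  eNat_eq {X Y : B} (f : X ⟶ Y) : ∃ h, toPseudomonadData.eNat f = eqToIso h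
  assoc_eq (X : B) : ∃ h, cells.assoc X = eqToIso h
  left_eq (X : B) : ∃ h, cells.left X = eqToIso h
  right_eq (X : B) : ∃ h, cells.right X = eqToIso h

namespace Pseudomonad

variable {B : Type u₁} [Bicategory.{w₁, v₁} B]

/-- An `S`-pseudoalgebra structure on the object `A`. -/
structure Alg (S : Pseudomonad B) (A : B) where
  str : S.obj A ⟶ A
  assoc : S.map str ≫ str ≅ S.m A ≫ str
  unit : 𝟙 A ≅ S.e A ≫ str
  assoc_assoc :
    (S.fn.mapSq assoc).hom ▷ str ⊗≫ S.map (S.m A) ◁ assoc.hom ⊗≫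
        (S.cells.assoc A).hom ▷ str ≫ (α_ _ _ _).hom =
      (α_ _ _ _).hom ≫ S.map (S.map str) ◁ assoc.hom ⊗≫
        (S.mNat str).hom ▷ str ⊗≫ S.m (S.obj A) ◁ assoc.hom
  unit_assoc :
    (S.fn.mapTriId unit.symm).inv ▷ str ⊗≫ S.map (S.e A) ◁ assoc.hom ⊗≫
        (S.cells.right A).hom ▷ str =
      𝟙 (𝟙 (S.obj A) ≫ str)

/-- A pseudoalgebra structure is strict if its constraint 2-cells are identities. -/
structure Alg.IsStrict {S : Pseudomonad B} {A : B} (a : S.Alg A) : Prop where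
  assoc_eq : ∃ h, a.assoc = eqToIso h
  unit_eq : ∃ h, a.unit = eqToIso h

/-- A strict `S`-algebra. -/
structure StrictAlg (S : Pseudomonad B) where
  carrier : B
  alg : S.Alg carrier
  isStrict : alg.IsStrict

variable {S : Pseudomonad B}

/-- A pseudomorphism structure on `f`, for pseudoalgebra structures `a` and `b` on its source and
target: an invertible 2-cell `S f ≫ b ≅ a ≫ f` compatible with associativity and unit. -/
structure MorStr {A A' : B} (a : S.Alg A) (b : S.Alg A') (f : A ⟶ A') where
  cell : S.map f ≫ b.str ≅ a.str ≫ f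
  cell_assoc :
    S.map (S.map f) ◁ b.assoc.hom ⊗≫ (S.mNat f).hom ▷ b.str ⊗≫ S.m A ◁ cell.hom =
      (α_ _ _ _).inv ≫ (S.fn.mapSq cell).hom ▷ b.str ⊗≫ S.map a.str ◁ cell.hom ⊗≫
        a.assoc.hom ▷ f ≫ (α_ _ _ _).hom
  cell_unit :
    f ◁ b.unit.hom ⊗≫ (S.eNat f).hom ▷ b.str ⊗≫ S.e A ◁ cell.hom =
      (ρ_ _).hom ≫ (λ_ _).inv ≫ a.unit.hom ▷ f ≫ (α_ _ _ _).hom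

/-- `φ` is an algebra 2-cell between the pseudomorphisms `(f, F)` and `(g, G)`. -/
def IsAlgCell {A A' : B} {a : S.Alg A} {b : S.Alg A'} {f g : A ⟶ A'} (F : MorStr a b f)
    (G : MorStr a b g) (φ : f ⟶ g) : Prop :=
  S.fn.map₂ φ ▷ b.str ≫ G.cell.hom = F.cell.hom ≫ a.str ◁ φ

/-- The identity pseudomorphism. -/
def MorStr.id {A : B} (a : S.Alg A) : MorStr a a (𝟙 A) where
  cell := whiskerRightIso (S.fn.mapId A) a.str ≪≫ λ_ a.str ≪≫ (ρ_ a.str).symm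
  cell_assoc := by
    have hm := S.mNat_id A
    calc
      _ = S.map (S.map (𝟙 A)) ◁ a.assoc.hom ⊗≫ ((S.mNat (𝟙 A)).hom ≫
            S.m A ◁ (S.fn.mapId A).hom) ▷ a.str ⊗≫ 𝟙 (S.m A ≫ a.str ≫ 𝟙 A) := by
          simp [bicategoricalComp]
      _ = 𝟙 _ ⊗≫ (S.map (S.map (𝟙 A)) ◁ a.assoc.hom ≫ ((S.fn.map₂ (S.fn.mapId A).hom ≫
            (S.fn.mapId (S.obj A)).hom) ▷ (S.m A ≫ a.str))) ⊗≫ 𝟙 (S.m A ≫ a.str ≫ 𝟙 A) := by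
          rw [hm]; bicategory
      _ = 𝟙 _ ⊗≫ (S.fn.map₂ (S.fn.mapId A).hom ≫
            (S.fn.mapId (S.obj A)).hom) ▷ (S.map a.str ≫ a.str) ⊗≫ a.assoc.hom ⊗≫
              𝟙 (S.m A ≫ a.str ≫ 𝟙 A) := by
          rw [whisker_exchange]; bicategory
      _ = _ := by
        simp [bicategoricalComp, Pseudofunctor.map₂_runit_inv]
  cell_unit := by
    have hm := S.eNat_id A
    calc
      _ = 𝟙 A ◁ a.unit.hom ⊗≫ ((S.eNat (𝟙 A)).hom ≫ S.e A ◁ (S.fn.mapId A).hom) ▷ a.str ⊗≫ 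
            𝟙 (S.e A ≫ a.str ≫ 𝟙 A) := by
          simp [bicategoricalComp]
      _ = _ := by
        rw [hm]
        bicategory

/-- Composition of pseudomorphisms. -/
def MorStr.comp {A₁ A₂ A₃ : B} {a₁ : S.Alg A₁} {a₂ : S.Alg A₂} {a₃ : S.Alg A₃} {f : A₁ ⟶ A₂}
    {g : A₂ ⟶ A₃} (F : MorStr a₁ a₂ f) (G : MorStr a₂ a₃ g) : MorStr a₁ a₃ (f ≫ g) where
  cell := whiskerRightIso (S.fn.mapComp f g) a₃.str ≪≫ α_ _ _ _ ≪≫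
    whiskerLeftIso (S.map f) G.cell ≪≫ (α_ _ _ _).symm ≪≫ whiskerRightIso F.cell g ≪≫ α_ _ _ _
  cell_assoc := by
    have hm := S.mNat_comp f g
    calc
      _ = S.map (S.map (f ≫ g)) ◁ a₃.assoc.hom ⊗≫ ((S.mNat (f ≫ g)).hom ≫
            S.m A₁ ◁ (S.fn.mapComp f g).hom) ▷ a₃.str ⊗≫
            (S.m A₁ ≫ S.map f) ◁ G.cell.hom ⊗≫ S.m A₁ ◁ F.cell.hom ▷ g ⊗≫
              𝟙 (S.m A₁ ≫ a₁.str ≫ f ≫ g) := by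
          simp [bicategoricalComp]
      _ = 𝟙 _ ⊗≫ (S.map (S.map (f ≫ g)) ◁ a₃.assoc.hom ≫ (S.fn.map₂ (S.fn.mapComp f g).hom ≫
            (S.fn.mapComp (S.map f) (S.map g)).hom) ▷ (S.m A₃ ≫ a₃.str)) ⊗≫
            S.map (S.map f) ◁ (S.mNat g).hom ▷ a₃.str ⊗≫
            ((S.mNat f).hom ▷ (S.map g ≫ a₃.str) ≫ 
            (S.m A₁ ≫ S.map f) ◁ G.cell.hom) ⊗≫ S.m A₁ ◁ F.cell.hom ▷ g ⊗≫
              𝟙 (S.m A₁ ≫ a₁.str ≫ f ≫ g) := by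
          rw [hm]; bicategory
      _ = 𝟙 _ ⊗≫ (S.fn.map₂ (S.fn.mapComp f g).hom ≫
            (S.fn.mapComp (S.map f) (S.map g)).hom) ▷ (S.map a₃.str ≫ a₃.str) ⊗≫
            S.map (S.map f) ◁ (S.map (S.map g) ◁ a₃.assoc.hom ⊗≫ (S.mNat g).hom ▷ a₃.str ⊗≫
              S.m A₂ ◁ G.cell.hom) ⊗≫
            ((S.mNat f).hom ▷ a₂.str ⊗≫ S.m A₁ ◁ F.cell.hom) ▷ g ⊗≫
              𝟙 (S.m A₁ ≫ a₁.str ≫ f ≫ g) := by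
          rw [whisker_exchange, ← whisker_exchange (S.mNat f).hom G.cell.hom]; bicategory
      _ = 𝟙 _ ⊗≫ (S.fn.map₂ (S.fn.mapComp f g).hom ≫
            (S.fn.mapComp (S.map f) (S.map g)).hom) ▷ (S.map a₃.str ≫ a₃.str) ⊗≫
            S.map (S.map f) ◁ ((S.fn.mapSq G.cell).hom ▷ a₃.str ⊗≫ S.map a₂.str ◁ G.cell.hom) ⊗≫
            (S.map (S.map f) ◁ a₂.assoc.hom ⊗≫ (S.mNat f).hom ▷ a₂.str ⊗≫
              S.m A₁ ◁ F.cell.hom) ▷ g ⊗≫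
              𝟙 (S.m A₁ ≫ a₁.str ≫ f ≫ g) := by
          rw [G.cell_assoc]; bicategory
      _ = 𝟙 _ ⊗≫ (S.fn.map₂ (S.fn.mapComp f g).hom ≫
            (S.fn.mapComp (S.map f) (S.map g)).hom) ▷ (S.map a₃.str ≫ a₃.str) ⊗≫
            S.map (S.map f) ◁ (S.fn.mapSq G.cell).hom ▷ a₃.str ⊗≫
            ((S.map (S.map f) ≫ S.map a₂.str) ◁ G.cell.hom ≫
             (S.fn.mapSq F.cell).hom ▷ (a₂.str ≫ g)) ⊗≫ 
            (S.map a₁.str ◁ F.cell.hom ⊗≫ a₁.assoc.hom ▷ f) ▷ g ⊗≫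
              𝟙 (S.m A₁ ≫ a₁.str ≫ f ≫ g) := by
          rw [F.cell_assoc]; bicategory
      _ = _ := by
          rw [whisker_exchange, Pseudofunctor.mapSq_pre, Pseudofunctor.mapSq_paste]
          simp only [Iso.trans_hom, Iso.symm_hom, whiskerLeftIso_hom, whiskerRightIso_hom]
          simp [bicategoricalComp]
  cell_unit := by
    have hm := S.eNat_comp f g
    calc
      _ = (f ≫ g) ◁ a₃.unit.hom ⊗≫ ((S.eNat (f ≫ g)).hom ≫
            S.e A₁ ◁ (S.fn.mapComp f g).hom) ▷ a₃.str ⊗≫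
            (S.e A₁ ≫ S.map f) ◁ G.cell.hom ⊗≫ S.e A₁ ◁ F.cell.hom ▷ g ⊗≫
              𝟙 (S.e A₁ ≫ a₁.str ≫ f ≫ g) := by
          simp [bicategoricalComp]
      _ = 𝟙 _ ⊗≫ f ◁ (g ◁ a₃.unit.hom ⊗≫ (S.eNat g).hom ▷ a₃.str) ⊗≫
            ((S.eNat f).hom ▷ (S.map g ≫ a₃.str) ≫ 
            (S.e A₁ ≫ S.map f) ◁ G.cell.hom) ⊗≫ S.e A₁ ◁ F.cell.hom ▷ g ⊗≫
              𝟙 (S.e A₁ ≫ a₁.str ≫ f ≫ g) := by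
          rw [hm]; bicategory
      _ = 𝟙 _ ⊗≫ f ◁ (g ◁ a₃.unit.hom ⊗≫ (S.eNat g).hom ▷ a₃.str ⊗≫ S.e A₂ ◁ G.cell.hom) ⊗≫
            ((S.eNat f).hom ▷ a₂.str ⊗≫ S.e A₁ ◁ F.cell.hom) ▷ g ⊗≫
              𝟙 (S.e A₁ ≫ a₁.str ≫ f ≫ g) := by
          rw [← whisker_exchange]; bicategory
      _ = 𝟙 _ ⊗≫ (f ◁ a₂.unit.hom ⊗≫ (S.eNat f).hom ▷ a₂.str ⊗≫ S.e A₁ ◁ F.cell.hom) ▷ g ⊗≫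
              𝟙 (S.e A₁ ≫ a₁.str ≫ f ≫ g) := by
          rw [G.cell_unit]; bicategory
      _ = _ := by
          rw [F.cell_unit]; bicategory

end Pseudomonad

/-- Given pseudomonads `S` on `B` and `S'` on `B'`, and a pseudofunctor `J` from `B` to `B'`, a
pseudonatural transformation with components `S' (J X) ⟶ J (S X)`. -/
structure PseudomonadMorData {B : Type u₁} [Bicategory.{w₁, v₁} B] {B' : Type u₂}
    [Bicategory.{w₂, v₂} B'] (J : B ⥤ᵖ B') (S : Pseudomonad B) (S' : Pseudomonad B') where
  trans : Pseudofunctor.StrongTrans (J.comp S'.fn) (S.fn.comp J)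

namespace PseudomonadMorData

variable {B : Type u₁} [Bicategory.{w₁, v₁} B] {B' : Type u₂}
    [Bicategory.{w₂, v₂} B'] {J : B ⥤ᵖ B'} {S : Pseudomonad B} {S' : Pseudomonad B'}
    (K : PseudomonadMorData J S S')

abbrev app (X : B) : S'.obj (J.obj X) ⟶ J.obj (S.obj X) := K.trans.app X
/-- The pseudonaturality 2-cell at `f`. -/
abbrev nat {X Y : B} (f : X ⟶ Y) :
    S'.map (J.map f) ≫ K.app Y ≅ K.app X ≫ J.map (S.map f) :=
  K.trans.naturality f

lemma nat_id (X : B) : (K.nat (𝟙 X)).hom ≫ K.app X ◁ J.map₂ (S.fn.mapId X).hom ≫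
      K.app X ◁ (J.mapId (S.obj X)).hom =
    S'.fn.map₂ (J.mapId X).hom ▷ K.app X ≫ (S'.fn.mapId (J.obj X)).hom ▷ K.app X ≫
      (λ_ (K.app X)).hom ≫ (ρ_ (K.app X)).inv := by
  rw [← comp_whiskerRight_assoc, ← whiskerLeft_comp]
  exact K.trans.naturality_id X

lemma nat_comp {X Y Z : B} (f : X ⟶ Y) (g : Y ⟶ Z) :
    (K.nat (f ≫ g)).hom ≫ K.app X ◁ (J.map₂ (S.fn.mapComp f g).hom ≫
        (J.mapComp (S.map f) (S.map g)).hom) =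
      (S'.fn.map₂ (J.mapComp f g).hom ≫ (S'.fn.mapComp (J.map f) (J.map g)).hom) ▷ K.app Z ≫
        (α_ _ _ _).hom ≫ S'.map (J.map f) ◁ (K.nat g).hom ≫ (α_ _ _ _).inv ≫
          (K.nat f).hom ▷ J.map (S.map g) ≫ (α_ _ _ _).hom :=
  K.trans.naturality_comp f g

lemma nat_natural {X Y : B} {f g : X ⟶ Y} (φ : f ⟶ g) :
    S'.fn.map₂ (J.map₂ φ) ▷ K.app Y ≫ (K.nat g).hom =
      (K.nat f).hom ≫ K.app X ◁ J.map₂ (S.fn.map₂ φ) :=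
  K.trans.naturality_naturality φ

lemma nat_sq {a b c d : B} {f : a ⟶ b} {g : b ⟶ d} {h : a ⟶ c} {k : c ⟶ d} (θ : f ≫ g ≅ h ≫ k) :
    (S'.fn.mapSq (J.mapSq θ)).hom ▷ K.app d ≫ (α_ _ _ _).hom ≫ S'.map (J.map h) ◁ (K.nat k).hom ≫
        (α_ _ _ _).inv ≫ (K.nat h).hom ▷ J.map (S.map k) ≫ (α_ _ _ _).hom =
      (α_ _ _ _).hom ≫ S'.map (J.map f) ◁ (K.nat g).hom ≫ (α_ _ _ _).inv ≫
        (K.nat f).hom ▷ J.map (S.map g) ≫ (α_ _ _ _).hom ≫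
          K.app a ◁ (J.mapSq (S.fn.mapSq θ)).hom := by
  have aux {x y z : B} (f : x ⟶ y) (g : y ⟶ z) :
      S'.map (J.map f) ◁ (K.nat g).hom ≫ (α_ _ _ _).inv ≫
          (K.nat f).hom ▷ J.map (S.map g) ≫ (α_ _ _ _).hom =
      (α_ _ _ _).inv ≫ ((S'.fn.mapComp (J.map f) (J.map g)).inv ≫
        S'.fn.map₂ (J.mapComp f g).inv) ▷ K.app z ≫
        (K.nat (f ≫ g)).hom ≫ K.app x ◁ (J.map₂ (S.fn.mapComp f g).hom ≫
        (J.mapComp (S.map f) (S.map g)).hom) := by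
    rw [K.nat_comp f g]
    simp only [comp_whiskerRight, Category.assoc]
    rw [← comp_whiskerRight_assoc _ (S'.fn.map₂ (J.mapComp f g).hom),
      PrelaxFunctor.map₂_inv_hom, id_whiskerRight, Category.id_comp,
      ← comp_whiskerRight_assoc, Iso.inv_hom_id, id_whiskerRight, Category.id_comp,
      Iso.inv_hom_id_assoc]
  have e1 : (S'.fn.mapSq (J.mapSq θ)).hom ≫ (S'.fn.mapComp (J.map h) (J.map k)).inv ≫
      S'.fn.map₂ (J.mapComp h k).inv = ((S'.fn.mapComp (J.map f) (J.map g)).inv ≫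
        S'.fn.map₂ (J.mapComp f g).inv) ≫ S'.fn.map₂ (J.map₂ θ.hom) := by
    simp
  have e2 : (J.map₂ (S.fn.mapComp f g).hom ≫ (J.mapComp (S.map f) (S.map g)).hom) ≫
      (J.mapSq (S.fn.mapSq θ)).hom = J.map₂ (S.fn.map₂ θ.hom) ≫ (J.map₂ (S.fn.mapComp h k).hom ≫
        (J.mapComp (S.map h) (S.map k)).hom) := Pseudofunctor.mapSq_mapSq S.fn J θ
  have a1 := aux h k
  have a2 := aux f g
  have h3 := K.nat_natural θ.hom
  calc
    _ = (S'.fn.mapSq (J.mapSq θ)).hom ▷ K.app d ≫ ((S'.fn.mapComp (J.map h) (J.map k)).inv ≫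
        S'.fn.map₂ (J.mapComp h k).inv) ▷ K.app d ≫
        (K.nat (h ≫ k)).hom ≫ K.app a ◁ (J.map₂ (S.fn.mapComp h k).hom ≫
        (J.mapComp (S.map h) (S.map k)).hom) := by
      rw [a1, Iso.hom_inv_id_assoc]
    _ = ((S'.fn.mapComp (J.map f) (J.map g)).inv ≫ S'.fn.map₂ (J.mapComp f g).inv) ▷ K.app d ≫
        (S'.fn.map₂ (J.map₂ θ.hom) ▷ K.app d ≫ (K.nat (h ≫ k)).hom) ≫
        K.app a ◁ (J.map₂ (S.fn.mapComp h k).hom ≫ (J.mapComp (S.map h) (S.map k)).hom) := by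
      rw [← comp_whiskerRight_assoc, e1, comp_whiskerRight_assoc, Category.assoc]
    _ = (α_ _ _ _).hom ≫ (S'.map (J.map f) ◁ (K.nat g).hom ≫ (α_ _ _ _).inv ≫
        (K.nat f).hom ▷ J.map (S.map g) ≫ (α_ _ _ _).hom) ≫
          K.app a ◁ (J.mapSq (S.fn.mapSq θ)).hom := by
      rw [h3, a2, Category.assoc, ← whiskerLeft_comp, ← e2, whiskerLeft_comp]
      simp only [Category.assoc, Iso.hom_inv_id_assoc]
    _ = _ := by simp only [Category.assoc]

lemma nat_tri {a b : B} {f : a ⟶ b} {g : b ⟶ a} (θ : f ≫ g ≅ 𝟙 a) :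
    (S'.fn.mapTriId (J.mapTriId θ)).inv ▷ K.app a ⊗≫ S'.map (J.map f) ◁ (K.nat g).hom ⊗≫
        (K.nat f).hom ▷ J.map (S.map g) ⊗≫ 𝟙 (K.app a ≫ J.map (S.map f) ≫ J.map (S.map g)) =
      (λ_ _).hom ≫ (ρ_ _).inv ≫ K.app a ◁ (J.mapTriId (S.fn.mapTriId θ)).inv := by
  have e1 : (S'.fn.mapTriId (J.mapTriId θ)).inv = (S'.fn.mapId (J.obj a)).inv ≫
      S'.fn.map₂ (J.mapId a).inv ≫ S'.fn.map₂ (J.map₂ θ.inv) ≫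
        S'.fn.map₂ (J.mapComp f g).hom ≫ (S'.fn.mapComp (J.map f) (J.map g)).hom := by
    simp
  have e2 : (J.mapTriId (S.fn.mapTriId θ)).inv = (J.mapId (S.obj a)).inv ≫
      J.map₂ (S.fn.mapId a).inv ≫ J.map₂ (S.fn.map₂ θ.inv) ≫
        J.map₂ (S.fn.mapComp f g).hom ≫ (J.mapComp (S.map f) (S.map g)).hom := by
    simp
  have h1 := K.nat_comp f g
  have h2 := K.nat_natural θ.inv
  have h3 := K.nat_id a
  calc
    _ = (S'.fn.mapId (J.obj a)).inv ▷ K.app a ≫ S'.fn.map₂ (J.mapId a).inv ▷ K.app a ≫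
        S'.fn.map₂ (J.map₂ θ.inv) ▷ K.app a ≫
        ((S'.fn.map₂ (J.mapComp f g).hom ≫ (S'.fn.mapComp (J.map f) (J.map g)).hom) ▷ K.app a ≫
        (α_ _ _ _).hom ≫ S'.map (J.map f) ◁ (K.nat g).hom ≫ (α_ _ _ _).inv ≫
          (K.nat f).hom ▷ J.map (S.map g) ≫ (α_ _ _ _).hom) := by
      rw [e1]
      simp [bicategoricalComp]
    _ = (S'.fn.mapId (J.obj a)).inv ▷ K.app a ≫ S'.fn.map₂ (J.mapId a).inv ▷ K.app a ≫
        (S'.fn.map₂ (J.map₂ θ.inv) ▷ K.app a ≫ (K.nat (f ≫ g)).hom) ≫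
          K.app a ◁ (J.map₂ (S.fn.mapComp f g).hom ≫ (J.mapComp (S.map f) (S.map g)).hom) := by
      rw [← h1, Category.assoc]
    _ = (S'.fn.mapId (J.obj a)).inv ▷ K.app a ≫ S'.fn.map₂ (J.mapId a).inv ▷ K.app a ≫
        ((K.nat (𝟙 a)).hom ≫ K.app a ◁ J.map₂ (S.fn.mapId a).hom ≫
          K.app a ◁ (J.mapId (S.obj a)).hom) ≫ K.app a ◁ (J.mapTriId (S.fn.mapTriId θ)).inv := by
      rw [h2, e2]
      have e3 : J.map₂ (S.fn.mapId a).hom ≫ (J.mapId (S.obj a)).hom ≫ (J.mapId (S.obj a)).inv ≫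
          J.map₂ (S.fn.mapId a).inv = 𝟙 _ := by
        rw [Iso.hom_inv_id_assoc, PrelaxFunctor.map₂_hom_inv]
      simp only [Category.assoc, ← whiskerLeft_comp]
      simp only [reassoc_of% e3]
    _ = (S'.fn.mapId (J.obj a)).inv ▷ K.app a ≫ S'.fn.map₂ (J.mapId a).inv ▷ K.app a ≫
        (S'.fn.map₂ (J.mapId a).hom ▷ K.app a ≫ (S'.fn.mapId (J.obj a)).hom ▷ K.app a ≫
          (λ_ (K.app a)).hom ≫ (ρ_ (K.app a)).inv) ≫
          K.app a ◁ (J.mapTriId (S.fn.mapTriId θ)).inv := by rw [h3]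
    _ = _ := by
      have e4 : (S'.fn.mapId (J.obj a)).inv ≫ S'.fn.map₂ (J.mapId a).inv ≫
          S'.fn.map₂ (J.mapId a).hom ≫ (S'.fn.mapId (J.obj a)).hom = 𝟙 _ := by
        rw [← PrelaxFunctor.map₂_comp_assoc, Iso.inv_hom_id, PrelaxFunctor.map₂_id,
          Category.id_comp, Iso.inv_hom_id]
      have e5 := congrArg (fun ξ => ξ ▷ K.app a) e4
      simp only [comp_whiskerRight, id_whiskerRight] at e5
      simp only [Category.assoc, reassoc_of% e5]

end PseudomonadMorData

/-- Invertible 2-cells that compare units and multiplications. -/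
structure PseudomonadMorData.Cells {B : Type u₁} [Bicategory.{w₁, v₁} B] {B' : Type u₂}
    [Bicategory.{w₂, v₂} B'] {J : B ⥤ᵖ B'} {S : Pseudomonad B} {S' : Pseudomonad B'}
    (K : PseudomonadMorData J S S') where
  unit (X : B) : S'.e (J.obj X) ≫ K.app X ≅ J.map (S.e X)
  mul (X : B) : S'.m (J.obj X) ≫ K.app X ≅
    S'.map (K.app X) ≫ K.app (S.obj X) ≫ J.map (S.m X)

/-- The axioms of a morphism of pseudomonads: the comparison 2-cells are modifications, and they are
compatible with the associativity and unit constraints of the two pseudomonads. -/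
structure PseudomonadMorData.Coherence {B : Type u₁} [Bicategory.{w₁, v₁} B] {B' : Type u₂}
    [Bicategory.{w₂, v₂} B'] {J : B ⥤ᵖ B'} {S : Pseudomonad B} {S' : Pseudomonad B'}
    (K : PseudomonadMorData J S S') (c : K.Cells) : Prop where
  unit_natural {X Y : B} (f : X ⟶ Y) :
    J.map f ◁ (c.unit Y).hom ≫ (J.mapSq (S.eNat f)).hom =
      (α_ _ _ _).inv ≫ (S'.eNat (J.map f)).hom ▷ K.app Y ⊗≫
        S'.e (J.obj X) ◁ (K.nat f).hom ⊗≫ (c.unit X).hom ▷ J.map (S.map f)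
  mul_natural {X Y : B} (f : X ⟶ Y) :
    S'.map (S'.map (J.map f)) ◁ (c.mul Y).hom ⊗≫
        (S'.fn.mapSq (K.nat f)).hom ▷ (K.app (S.obj Y) ≫ J.map (S.m Y)) ⊗≫
        S'.map (K.app X) ◁ (K.nat (S.map f)).hom ▷ J.map (S.m Y) ⊗≫
        (S'.map (K.app X) ≫ K.app (S.obj X)) ◁ (J.mapSq (S.mNat f)).hom =
      (α_ _ _ _).inv ≫ (S'.mNat (J.map f)).hom ▷ K.app Y ⊗≫
        S'.m (J.obj X) ◁ (K.nat f).hom ⊗≫ (c.mul X).hom ▷ J.map (S.map f) ⊗≫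
        𝟙 ((S'.map (K.app X) ≫ K.app (S.obj X)) ≫ J.map (S.m X) ≫ J.map (S.map f))
  mul_assoc (X : B) :
    S'.map (S'.m (J.obj X)) ◁ (c.mul X).hom ⊗≫
        (S'.fn.mapSq (c.mul X)).hom ▷ (K.app (S.obj X) ≫ J.map (S.m X)) ⊗≫
        S'.map (S'.map (K.app X)) ◁ (S'.fn.mapComp (K.app (S.obj X)) (J.map (S.m X))).hom ▷
          (K.app (S.obj X) ≫ J.map (S.m X)) ⊗≫
        (S'.map (S'.map (K.app X)) ≫ S'.map (K.app (S.obj X))) ◁ (K.nat (S.m X)).hom ▷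
          J.map (S.m X) ⊗≫
        ((S'.map (S'.map (K.app X)) ≫ S'.map (K.app (S.obj X))) ≫ K.app (S.obj (S.obj X))) ◁
          (J.mapSq (S.cells.assoc X)).hom =
      (α_ _ _ _).inv ≫ (S'.cells.assoc (J.obj X)).hom ▷ K.app X ⊗≫
        S'.m (S'.obj (J.obj X)) ◁ (c.mul X).hom ⊗≫
        (S'.mNat (K.app X)).inv ▷ (K.app (S.obj X) ≫ J.map (S.m X)) ⊗≫
        S'.map (S'.map (K.app X)) ◁ (c.mul (S.obj X)).hom ▷ J.map (S.m X) ⊗≫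
        𝟙 (((S'.map (S'.map (K.app X)) ≫ S'.map (K.app (S.obj X))) ≫ K.app (S.obj (S.obj X))) ≫
          J.map (S.m (S.obj X)) ≫ J.map (S.m X))
  mul_right (X : B) :
    S'.map (S'.e (J.obj X)) ◁ (c.mul X).hom ⊗≫
        (S'.fn.mapTri (c.unit X)).hom ▷ (K.app (S.obj X) ≫ J.map (S.m X)) ⊗≫
        (K.nat (S.e X)).hom ▷ J.map (S.m X) ⊗≫
        K.app X ◁ (J.mapTriId (S.cells.right X)).hom ≫ (ρ_ _).hom =
      (α_ _ _ _).inv ≫ (S'.cells.right (J.obj X)).hom ▷ K.app X ≫ (λ_ _).hom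
  mul_left (X : B) :
    (S'.cells.left (J.obj X)).hom ▷ K.app X ⊗≫
        S'.e (S'.obj (J.obj X)) ◁ (c.mul X).hom ⊗≫
        (S'.eNat (K.app X)).inv ▷ (K.app (S.obj X) ≫ J.map (S.m X)) ⊗≫
        K.app X ◁ (c.unit (S.obj X)).hom ▷ J.map (S.m X) ⊗≫
        𝟙 (K.app X ≫ J.map (S.e (S.obj X)) ≫ J.map (S.m X)) =
      (λ_ _).hom ≫ (ρ_ _).inv ≫ K.app X ◁ (J.mapTriId (S.cells.left X).symm).inv

lemma alg_assoc_aux {B : Type u₁} [Bicategory.{w₁, v₁} B] {y z y₂ y₃ c d d₂ d' e f : B}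
    {κ : y ⟶ c} {a : c ⟶ z} {m₁ : y₂ ⟶ y} {m₂ Sm : y₃ ⟶ y₂} {Sb : y₂ ⟶ y} {SSb : y₃ ⟶ y₂}
    {Sκ : y₂ ⟶ d} {Sa : d ⟶ y} {SSκ : y₃ ⟶ d₂} {SSa : d₂ ⟶ y₂} {md : d₂ ⟶ d} {κS : d ⟶ e}
    {Jm JSa : e ⟶ c} {SκS : d₂ ⟶ d'} {SJm SJSa : d' ⟶ d} {SKm : d₂ ⟶ d} {κSS : d' ⟶ f}
    {JSm JmS JSSa : f ⟶ e}
    {c₁ : Sb ⟶ Sκ ≫ Sa} {c₂ : SSb ⟶ SSκ ≫ SSa} {na : Sa ≫ κ ⟶ κS ≫ JSa}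
    {Ja : JSa ≫ a ⟶ Jm ≫ a} (w : m₁ ≫ κ ≅ Sκ ≫ κS ≫ Jm) {A : Sb ≫ κ ≫ a ⟶ m₁ ≫ κ ≫ a}
    {SA : SSb ≫ Sb ⟶ Sm ≫ Sb} {Sw : Sm ≫ Sκ ⟶ SSκ ≫ SKm} {d₁ : SKm ⟶ SκS ≫ SJm}
    {Sna : SSa ≫ Sκ ⟶ SκS ≫ SJSa} {SJa : SJSa ≫ Sa ⟶ SJm ≫ Sa}
    {JSJ : JSSa ≫ JSa ⟶ JSm ≫ JSa} {Jas : JSm ≫ Jm ⟶ JmS ≫ Jm} {Jn : JSSa ≫ Jm ⟶ JmS ≫ JSa}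
    (nκ : SSκ ≫ md ≅ m₂ ≫ Sκ) {as : Sm ≫ m₁ ⟶ m₂ ≫ m₁} {nm : SJm ≫ κS ⟶ κSS ≫ JSm}
    (wS : md ≫ κS ≅ SκS ≫ κSS ≫ JmS) {nα : SSa ≫ m₁ ⟶ md ≫ Sa} {nSa : SJSa ≫ κS ⟶ κSS ≫ JSSa}
    {nb : SSb ≫ m₁ ⟶ m₂ ≫ Sb}
    (h1 : A ⊗≫ w.hom ▷ a = c₁ ▷ (κ ≫ a) ⊗≫ Sκ ◁ na ▷ a ⊗≫ (Sκ ≫ κS) ◁ Ja ⊗≫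
      𝟙 ((Sκ ≫ κS ≫ Jm) ≫ a))
    (h2 : SA ⊗≫ Sm ◁ c₁ ⊗≫ Sw ▷ Sa ⊗≫ SSκ ◁ d₁ ▷ Sa ⊗≫ 𝟙 (SSκ ≫ SκS ≫ SJm ≫ Sa) =
      c₂ ▷ Sb ⊗≫ (SSκ ≫ SSa) ◁ c₁ ⊗≫ SSκ ◁ Sna ▷ Sa ⊗≫ (SSκ ≫ SκS) ◁ SJa ⊗≫
        𝟙 (SSκ ≫ SκS ≫ SJm ≫ Sa))
    (h3 : JSJ ▷ a ⊗≫ JSm ◁ Ja ⊗≫ Jas ▷ a ≫ (α_ _ _ _).hom =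
      (α_ _ _ _).hom ≫ JSSa ◁ Ja ⊗≫ Jn ▷ a ⊗≫ JmS ◁ Ja)
    (h4 : Sm ◁ w.hom ⊗≫ Sw ▷ (κS ≫ Jm) ⊗≫ SSκ ◁ d₁ ▷ (κS ≫ Jm) ⊗≫ (SSκ ≫ SκS) ◁ nm ▷ Jm ⊗≫
        ((SSκ ≫ SκS) ≫ κSS) ◁ Jas =
      (α_ _ _ _).inv ≫ as ▷ κ ⊗≫ m₂ ◁ w.hom ⊗≫ nκ.inv ▷ (κS ≫ Jm) ⊗≫ SSκ ◁ wS.hom ▷ Jm ⊗≫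
        𝟙 (((SSκ ≫ SκS) ≫ κSS) ≫ JmS ≫ Jm))
    (h5 : SSa ◁ w.hom ⊗≫ Sna ▷ (κS ≫ Jm) ⊗≫ SκS ◁ nSa ▷ Jm ⊗≫ (SκS ≫ κSS) ◁ Jn =
      (α_ _ _ _).inv ≫ nα ▷ κ ⊗≫ md ◁ na ⊗≫ wS.hom ▷ JSa ⊗≫ 𝟙 ((SκS ≫ κSS) ≫ JmS ≫ JSa))
    (h6 : SJa ▷ κ ≫ (α_ _ _ _).hom ≫ SJm ◁ na ≫ (α_ _ _ _).inv ≫ nm ▷ JSa ≫ (α_ _ _ _).hom =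
      (α_ _ _ _).hom ≫ SJSa ◁ na ≫ (α_ _ _ _).inv ≫ nSa ▷ JSa ≫ (α_ _ _ _).hom ≫ κSS ◁ JSJ)
    (h7 : nb ≫ m₂ ◁ c₁ = c₂ ▷ m₁ ≫ (α_ _ _ _).hom ≫ SSκ ◁ nα ≫ (α_ _ _ _).inv ≫
      nκ.hom ▷ Sa ≫ (α_ _ _ _).hom) :
    SA ▷ (κ ≫ a) ⊗≫ Sm ◁ A ⊗≫ as ▷ (κ ≫ a) ≫ (α_ _ _ _).hom =
      (α_ _ _ _).hom ≫ SSb ◁ A ⊗≫ nb ▷ (κ ≫ a) ⊗≫ m₂ ◁ A := by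
  let E := whiskerLeftIso m₂ (whiskerRightIso w a) ≪⊗≫ whiskerRightIso nκ.symm (κS ≫ Jm ≫ a) ≪⊗≫
    whiskerLeftIso SSκ (whiskerRightIso wS (Jm ≫ a))
  have hE : E.hom = m₂ ◁ w.hom ▷ a ⊗≫ nκ.inv ▷ (κS ≫ Jm ≫ a) ⊗≫ SSκ ◁ wS.hom ▷ (Jm ≫ a) := rfl
  let M : (SSb ≫ Sb) ≫ κ ≫ a ⟶ SSκ ≫ (SκS ≫ κSS ≫ JmS) ≫ Jm ≫ a :=
    𝟙 _ ⊗≫ c₂ ▷ (Sb ≫ κ ≫ a) ⊗≫ (SSκ ≫ SSa) ◁ c₁ ▷ (κ ≫ a) ⊗≫ SSκ ◁ Sna ▷ (Sa ≫ κ ≫ a) ⊗≫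
    (SSκ ≫ SκS ≫ SJSa) ◁ na ▷ a ⊗≫ (SSκ ≫ SκS) ◁ nSa ▷ (JSa ≫ a) ⊗≫
    (SSκ ≫ SκS ≫ κSS) ◁ (JSSa ◁ Ja ⊗≫ Jn ▷ a ⊗≫ JmS ◁ Ja) ⊗≫ 𝟙 _
  have lhs : (SA ▷ (κ ≫ a) ⊗≫ Sm ◁ A ⊗≫ as ▷ (κ ≫ a) ≫ (α_ _ _ _).hom) ⊗≫ E.hom = M := by
    rw [hE]
    calc
      _ = SA ▷ (κ ≫ a) ⊗≫ Sm ◁ A ⊗≫ ((α_ _ _ _).inv ≫ as ▷ κ ⊗≫ m₂ ◁ w.hom ⊗≫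
          nκ.inv ▷ (κS ≫ Jm) ⊗≫ SSκ ◁ wS.hom ▷ Jm ⊗≫
            𝟙 (((SSκ ≫ SκS) ≫ κSS) ≫ JmS ≫ Jm)) ▷ a ⊗≫ 𝟙 _ := by bicategory
      _ = SA ▷ (κ ≫ a) ⊗≫ Sm ◁ (A ⊗≫ w.hom ▷ a) ⊗≫ (Sw ▷ (κS ≫ Jm) ⊗≫ SSκ ◁ d₁ ▷ (κS ≫ Jm) ⊗≫
          (SSκ ≫ SκS) ◁ nm ▷ Jm ⊗≫ ((SSκ ≫ SκS) ≫ κSS) ◁ Jas) ▷ a ⊗≫ 𝟙 _ := by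
        rw [← h4]; bicategory
      _ = SA ▷ (κ ≫ a) ⊗≫ Sm ◁ c₁ ▷ (κ ≫ a) ⊗≫ ((Sm ≫ Sκ) ◁ (na ▷ a ⊗≫ κS ◁ Ja) ≫
          (Sw ⊗≫ SSκ ◁ d₁) ▷ (κS ≫ Jm ≫ a)) ⊗≫ 
          (SSκ ≫ SκS) ◁ (nm ▷ Jm ⊗≫ κSS ◁ Jas) ▷ a ⊗≫ 𝟙 _ := by
        rw [h1]; bicategory
      _ = 𝟙 _ ⊗≫ (SA ⊗≫ Sm ◁ c₁ ⊗≫ Sw ▷ Sa ⊗≫ SSκ ◁ d₁ ▷ Sa ⊗≫ 𝟙 (SSκ ≫ SκS ≫ SJm ≫ Sa)) ▷ (κ ≫ a) ⊗≫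
          (SSκ ≫ SκS) ◁ (SJm ◁ na ▷ a ⊗≫ ((SJm ≫ κS) ◁ Ja ≫ nm ▷ (Jm ≫ a)) ⊗≫ κSS ◁ Jas ▷ a) ⊗≫
          𝟙 _ := by
        rw [whisker_exchange]; bicategory
      _ = 𝟙 _ ⊗≫ (c₂ ▷ Sb ⊗≫ (SSκ ≫ SSa) ◁ c₁ ⊗≫ SSκ ◁ Sna ▷ Sa) ▷ (κ ≫ a) ⊗≫
          (SSκ ≫ SκS) ◁ ((SJa ▷ κ ≫ (α_ _ _ _).hom ≫ SJm ◁ na ≫ (α_ _ _ _).inv ≫ nm ▷ JSa ≫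
            (α_ _ _ _).hom) ▷ a ⊗≫ κSS ◁ (JSm ◁ Ja ⊗≫ Jas ▷ a)) ⊗≫ 𝟙 _ := by
        rw [h2, whisker_exchange]; bicategory
      _ = 𝟙 _ ⊗≫ (c₂ ▷ Sb ⊗≫ (SSκ ≫ SSa) ◁ c₁ ⊗≫ SSκ ◁ Sna ▷ Sa) ▷ (κ ≫ a) ⊗≫
          (SSκ ≫ SκS) ◁ ((SJSa ◁ na ⊗≫ nSa ▷ JSa) ▷ a ⊗≫ κSS ◁ (JSJ ▷ a ⊗≫ JSm ◁ Ja ⊗≫ Jas ▷ a ≫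
            (α_ _ _ _).hom)) ⊗≫ 𝟙 _ := by
        rw [h6]; bicategory
      _ = M := by
        rw [h3]; bicategory
  have rhs : ((α_ _ _ _).hom ≫ SSb ◁ A ⊗≫ nb ▷ (κ ≫ a) ⊗≫ m₂ ◁ A) ⊗≫ E.hom = M := by
    rw [hE]
    calc
      _ = 𝟙 _ ⊗≫ SSb ◁ A ⊗≫ nb ▷ (κ ≫ a) ⊗≫ m₂ ◁ (A ⊗≫ w.hom ▷ a) ⊗≫
          nκ.inv ▷ (κS ≫ Jm ≫ a) ⊗≫ SSκ ◁ wS.hom ▷ (Jm ≫ a) := by bicategory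
      _ = 𝟙 _ ⊗≫ SSb ◁ A ⊗≫ (nb ≫ m₂ ◁ c₁) ▷ (κ ≫ a) ⊗≫ ((m₂ ≫ Sκ) ◁ (na ▷ a ⊗≫ κS ◁ Ja) ≫
          nκ.inv ▷ (κS ≫ Jm ≫ a)) ⊗≫ SSκ ◁ wS.hom ▷ (Jm ≫ a) := by rw [h1]; bicategory
      _ = 𝟙 _ ⊗≫ SSb ◁ A ⊗≫ (c₂ ▷ m₁ ⊗≫ SSκ ◁ nα) ▷ (κ ≫ a) ⊗≫
          (nκ.hom ≫ nκ.inv) ▷ (Sa ≫ κ ≫ a) ⊗≫ (SSκ ≫ md) ◁ (na ▷ a ⊗≫ κS ◁ Ja) ⊗≫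
          SSκ ◁ wS.hom ▷ (Jm ≫ a) := by rw [h7, whisker_exchange]; bicategory
      _ = 𝟙 _ ⊗≫ (SSb ◁ A ≫ c₂ ▷ (m₁ ≫ κ ≫ a)) ⊗≫ SSκ ◁ (nα ▷ (κ ≫ a) ⊗≫
          md ◁ na ▷ a ⊗≫ ((md ≫ κS) ◁ Ja ≫ wS.hom ▷ (Jm ≫ a))) := by
        rw [nκ.hom_inv_id]; bicategory
      _ = 𝟙 _ ⊗≫ c₂ ▷ (Sb ≫ κ ≫ a) ⊗≫ (SSκ ≫ SSa) ◁ A ⊗≫ SSκ ◁ ((α_ _ _ _).inv ≫ nα ▷ κ ⊗≫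
          md ◁ na ⊗≫ wS.hom ▷ JSa ⊗≫ 𝟙 ((SκS ≫ κSS) ≫ JmS ≫ JSa)) ▷ a ⊗≫
          (SSκ ≫ SκS ≫ κSS ≫ JmS) ◁ Ja ⊗≫ 𝟙 _ := by
        rw [whisker_exchange, whisker_exchange wS.hom]; bicategory
      _ = 𝟙 _ ⊗≫ c₂ ▷ (Sb ≫ κ ≫ a) ⊗≫ (SSκ ≫ SSa) ◁ (A ⊗≫ w.hom ▷ a) ⊗≫ 
          SSκ ◁ (Sna ▷ (κS ≫ Jm) ⊗≫ SκS ◁ nSa ▷ Jm ⊗≫ (SκS ≫ κSS) ◁ Jn) ▷ a ⊗≫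
          (SSκ ≫ SκS ≫ κSS ≫ JmS) ◁ Ja ⊗≫ 𝟙 _ := by
        rw [← h5]; bicategory
      _ = 𝟙 _ ⊗≫ c₂ ▷ (Sb ≫ κ ≫ a) ⊗≫ (SSκ ≫ SSa) ◁ c₁ ▷ (κ ≫ a) ⊗≫
          SSκ ◁ (((SSa ≫ Sκ) ◁ (na ▷ a ⊗≫ κS ◁ Ja)) ≫ Sna ▷ (κS ≫ Jm ≫ a)) ⊗≫ 
          SSκ ◁ (SκS ◁ nSa ▷ Jm ⊗≫ (SκS ≫ κSS) ◁ Jn) ▷ a ⊗≫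
          (SSκ ≫ SκS ≫ κSS ≫ JmS) ◁ Ja ⊗≫ 𝟙 _ := by
        rw [h1]; bicategory
      _ = 𝟙 _ ⊗≫ c₂ ▷ (Sb ≫ κ ≫ a) ⊗≫ (SSκ ≫ SSa) ◁ c₁ ▷ (κ ≫ a) ⊗≫
          SSκ ◁ Sna ▷ (Sa ≫ κ ≫ a) ⊗≫ (SSκ ≫ SκS ≫ SJSa) ◁ na ▷ a ⊗≫
          (SSκ ≫ SκS) ◁ ((SJSa ≫ κS) ◁ Ja ≫ nSa ▷ (Jm ≫ a)) ⊗≫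
          (SSκ ≫ SκS ≫ κSS) ◁ Jn ▷ a ⊗≫ (SSκ ≫ SκS ≫ κSS ≫ JmS) ◁ Ja ⊗≫ 𝟙 _ := by
        rw [whisker_exchange]; bicategory
      _ = M := by
        rw [whisker_exchange]; bicategory
  have := lhs.trans rhs.symm
  rw [← cancel_mono (m₂ ◁ (α_ m₁ κ a).inv ≫ E.hom)]
  simpa [bicategoricalComp] using this

lemma alg_unit_aux {B : Type u₁} [Bicategory.{w₁, v₁} B] {y z y₂ c d e : B}
    {κ : y ⟶ c} {a : c ⟶ z} {m₁ : y₂ ⟶ y} {Sb : y₂ ⟶ y} {Sκ : y₂ ⟶ d} {Sa : d ⟶ y} {κS : d ⟶ e}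
    {Jm JSa : e ⟶ c} {Se : y ⟶ y₂} {SJe : y ⟶ d} {JSe : c ⟶ e}
    {c₁ : Sb ⟶ Sκ ≫ Sa} {na : Sa ≫ κ ⟶ κS ≫ JSa}
    {Ja : JSa ≫ a ⟶ Jm ≫ a} (w : m₁ ≫ κ ≅ Sκ ≫ κS ≫ Jm) {A : Sb ≫ κ ≫ a ⟶ m₁ ≫ κ ≫ a}
    {su : Se ≫ Sκ ⟶ SJe} {u : 𝟙 y ⟶ Se ≫ Sb} {Jr : JSe ≫ Jm ⟶ 𝟙 c} {SJu : 𝟙 y ⟶ SJe ≫ Sa}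
    {JSu : 𝟙 c ⟶ JSe ≫ JSa} {r : Se ≫ m₁ ⟶ 𝟙 y} {ne : SJe ≫ κS ⟶ κ ≫ JSe}
    (h1 : A ⊗≫ w.hom ▷ a = c₁ ▷ (κ ≫ a) ⊗≫ Sκ ◁ na ▷ a ⊗≫ (Sκ ≫ κS) ◁ Ja ⊗≫
      𝟙 ((Sκ ≫ κS ≫ Jm) ≫ a))
    (k1 : u ⊗≫ Se ◁ c₁ ⊗≫ su ▷ Sa = SJu)
    (k2 : Se ◁ w.hom ⊗≫ su ▷ (κS ≫ Jm) ⊗≫ ne ▷ Jm ⊗≫ κ ◁ Jr ≫ (ρ_ κ).hom =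
      (α_ _ _ _).inv ≫ r ▷ κ ≫ (λ_ _).hom)
    (k3 : SJu ▷ κ ⊗≫ SJe ◁ na ⊗≫ ne ▷ JSa ⊗≫ 𝟙 (κ ≫ JSe ≫ JSa) =
      (λ_ _).hom ≫ (ρ_ _).inv ≫ κ ◁ JSu)
    (k4 : JSu ▷ a ⊗≫ JSe ◁ Ja ⊗≫ Jr ▷ a = 𝟙 (𝟙 c ≫ a)) :
    u ▷ (κ ≫ a) ⊗≫ Se ◁ A ⊗≫ r ▷ (κ ≫ a) = 𝟙 (𝟙 y ≫ κ ≫ a) := by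
  calc
    _ = u ▷ (κ ≫ a) ⊗≫ Se ◁ A ⊗≫ ((α_ _ _ _).inv ≫ r ▷ κ ≫ (λ_ _).hom) ▷ a ⊗≫ 𝟙 _ := by
      bicategory
    _ = u ▷ (κ ≫ a) ⊗≫ Se ◁ (A ⊗≫ w.hom ▷ a) ⊗≫ (su ▷ (κS ≫ Jm) ⊗≫ ne ▷ Jm ⊗≫ κ ◁ Jr) ▷ a ⊗≫
        𝟙 _ := by
      rw [← k2]; bicategory
    _ = (u ⊗≫ Se ◁ c₁) ▷ (κ ≫ a) ⊗≫ ((Se ≫ Sκ) ◁ (na ▷ a ⊗≫ κS ◁ Ja) ≫ su ▷ (κS ≫ Jm ≫ a)) ⊗≫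
        (ne ▷ Jm ⊗≫ κ ◁ Jr) ▷ a ⊗≫ 𝟙 _ := by
      rw [h1]; bicategory
    _ = (u ⊗≫ Se ◁ c₁ ⊗≫ su ▷ Sa) ▷ (κ ≫ a) ⊗≫ SJe ◁ na ▷ a ⊗≫
        ((SJe ≫ κS) ◁ Ja ≫ ne ▷ (Jm ≫ a)) ⊗≫ κ ◁ Jr ▷ a ⊗≫ 𝟙 _ := by
      rw [whisker_exchange]; bicategory
    _ = 𝟙 _ ⊗≫ (SJu ▷ κ ⊗≫ SJe ◁ na ⊗≫ ne ▷ JSa ⊗≫ 𝟙 (κ ≫ JSe ≫ JSa)) ▷ a ⊗≫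
        κ ◁ (JSe ◁ Ja ⊗≫ Jr ▷ a) ⊗≫ 𝟙 _ := by
      rw [k1, whisker_exchange]; bicategory
    _ = 𝟙 _ ⊗≫ κ ◁ (JSu ▷ a ⊗≫ JSe ◁ Ja ⊗≫ Jr ▷ a) ⊗≫ 𝟙 _ := by
      rw [k3]; bicategory
    _ = _ := by
      rw [k4]; bicategory

/-- A morphism of pseudomonads from `(B, S)` to `(B', S')` with underlying pseudofunctor `J`. -/
structure PseudomonadMor {B : Type u₁} [Bicategory.{w₁, v₁} B] {B' : Type u₂}
    [Bicategory.{w₂, v₂} B'] (J : B ⥤ᵖ B') (S : Pseudomonad B) (S' : Pseudomonad B') extends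
    PseudomonadMorData J S S' where
  cells : toPseudomonadMorData.Cells
  coherence : toPseudomonadMorData.Coherence cells

namespace PseudomonadMor

variable {B : Type u₁} [Bicategory.{w₁, v₁} B] {B' : Type u₂} [Bicategory.{w₂, v₂} B']
  {J : B ⥤ᵖ B'} {S : Pseudomonad B} {S' : Pseudomonad B'} (K : PseudomonadMor J S S')

def algAssoc {A : B} (a : S.Alg A) :
    S'.map (K.app A ≫ J.map a.str) ≫ K.app A ≫ J.map a.str ≅
      S'.m (J.obj A) ≫ K.app A ≫ J.map a.str :=
  whiskerRightIso (S'.fn.mapComp (K.app A) (J.map a.str)) (K.app A ≫ J.map a.str) ≪⊗≫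
    whiskerLeftIso (S'.map (K.app A)) (whiskerRightIso (K.nat a.str) (J.map a.str)) ≪⊗≫
    whiskerLeftIso (S'.map (K.app A) ≫ K.app (S.obj A)) (J.mapSq a.assoc) ≪⊗≫
    whiskerRightIso (K.cells.mul A).symm (J.map a.str) ≪≫ α_ _ _ _

/-- The unit constraint of the image of an algebra. -/
def algUnit {A : B} (a : S.Alg A) : 𝟙 (J.obj A) ≅ S'.e (J.obj A) ≫ K.app A ≫ J.map a.str :=
  (J.mapTriId a.unit.symm).symm ≪≫ whiskerRightIso (K.cells.unit A).symm (J.map a.str) ≪≫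
    α_ _ _ _

lemma algAssoc_mul {A : B} (a : S.Alg A) :
    (K.algAssoc a).hom ⊗≫ (K.cells.mul A).hom ▷ J.map a.str =
      (S'.fn.mapComp (K.app A) (J.map a.str)).hom ▷ (K.app A ≫ J.map a.str) ⊗≫
      S'.map (K.app A) ◁ (K.nat a.str).hom ▷ J.map a.str ⊗≫
      (S'.map (K.app A) ≫ K.app (S.obj A)) ◁ (J.mapSq a.assoc).hom ⊗≫
      𝟙 ((S'.map (K.app A) ≫ K.app (S.obj A) ≫ J.map (S.m A)) ≫ J.map a.str) := by
  simp [algAssoc, bicategoricalComp, bicategoricalIsoComp]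

lemma map_algAssoc {A : B} (a : S.Alg A) :
    (S'.fn.mapSq (K.algAssoc a)).hom ⊗≫
      S'.map (S'.m (J.obj A)) ◁ (S'.fn.mapComp (K.app A) (J.map a.str)).hom ⊗≫
      (S'.fn.mapSq (K.cells.mul A)).hom ▷ S'.map (J.map a.str) ⊗≫
      S'.map (S'.map (K.app A)) ◁ (S'.fn.mapComp (K.app (S.obj A)) (J.map (S.m A))).hom ▷
          S'.map (J.map a.str) ⊗≫
      𝟙 (S'.map (S'.map (K.app A)) ≫ S'.map (K.app (S.obj A)) ≫ S'.map (J.map (S.m A)) ≫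
        S'.map (J.map a.str)) =
    (S'.fn.map₂ (S'.fn.mapComp (K.app A) (J.map a.str)).hom ≫
        (S'.fn.mapComp (S'.map (K.app A)) (S'.map (J.map a.str))).hom) ▷
          S'.map (K.app A ≫ J.map a.str) ⊗≫
      (S'.map (S'.map (K.app A)) ≫ S'.map (S'.map (J.map a.str))) ◁
        (S'.fn.mapComp (K.app A) (J.map a.str)).hom ⊗≫
      S'.map (S'.map (K.app A)) ◁ (S'.fn.mapSq (K.nat a.str)).hom ▷ S'.map (J.map a.str) ⊗≫
      (S'.map (S'.map (K.app A)) ≫ S'.map (K.app (S.obj A))) ◁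
        (S'.fn.mapSq (J.mapSq a.assoc)).hom ⊗≫
      𝟙 (S'.map (S'.map (K.app A)) ≫ S'.map (K.app (S.obj A)) ≫ S'.map (J.map (S.m A)) ≫
        S'.map (J.map a.str)) := by
  exact Pseudofunctor.mapSq_alg S'.fn (S'.fn.mapComp (K.app A) (J.map a.str)) (K.nat a.str)
    (J.mapSq a.assoc) (K.cells.mul A)

lemma map_alg {A : B} (a : S.Alg A) :
    (J.mapSq (S.fn.mapSq a.assoc)).hom ▷ J.map a.str ⊗≫
        J.map (S.map (S.m A)) ◁ (J.mapSq a.assoc).hom ⊗≫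
        (J.mapSq (S.cells.assoc A)).hom ▷ J.map a.str ≫ (α_ _ _ _).hom =
      (α_ _ _ _).hom ≫ J.map (S.map (S.map a.str)) ◁ (J.mapSq a.assoc).hom ⊗≫
        (J.mapSq (S.mNat a.str)).hom ▷ J.map a.str ⊗≫
          J.map (S.m (S.obj A)) ◁ (J.mapSq a.assoc).hom := by
  exact Pseudofunctor.mapSq_cube J _ _ _ _ _ _ a.assoc_assoc

/-- The image `S' (J A) ⟶ J (S A) ⟶ J A` of an `S`-pseudoalgebra `A` under a morphism of
pseudomonads; it is a pseudoalgebra for `S'`. -/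
def mapAlg {A : B} (a : S.Alg A) : S'.Alg (J.obj A) where
  str := K.app A ≫ J.map a.str
  assoc := K.algAssoc a
  unit := K.algUnit a
  assoc_assoc := alg_assoc_aux (K.cells.mul A) (S'.mNat (K.app A)) (K.cells.mul (S.obj A))
    (K.algAssoc_mul a) (K.map_algAssoc a) (map_alg (J := J) a) (K.coherence.mul_assoc A)
    (K.coherence.mul_natural a.str) (K.nat_sq a.assoc) (S'.mNat_comp (K.app A) (J.map a.str))
  unit_assoc := alg_unit_aux (K.cells.mul A) (K.algAssoc_mul a)
    (Pseudofunctor.mapTriId_alg S'.fn (K.cells.unit A) (J.mapTriId a.unit.symm))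
    (K.coherence.mul_right A) (K.nat_tri a.unit.symm)
    (Pseudofunctor.mapTriId_sq J _ a.assoc (S.cells.right A) a.unit_assoc)

end PseudomonadMor

section Lifting

variable {C : Type u₁} [Bicategory.{w₁, v₁} C] [Bicategory.Strict C] {D : Type u₂}
  [Bicategory.{w₂, v₂} D] [Bicategory.Strict D] {J : C ⥤ᵖ D}

/-- The 2-monad `S` on `D` restricts along `J`: there is a 2-monad on `C`, also written `S`, together
with equivalences `S (J X) ≌ J (S X)` compatible with the multiplications and units, i.e. forming a
morphism of pseudomonads over `J`. Identity equivalences give the case `S J = J S`. -/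
structure RestrictsAlong (J : C ⥤ᵖ D) (S : TwoMonad D) where
  monad : TwoMonad C
  mor : PseudomonadMor J monad.toPseudomonad S.toPseudomonad
  equiv (X : C) : ∃ e : Bicategory.Equivalence (S.obj (J.obj X)) (J.obj (monad.obj X)),
    e.hom = mor.app X

open Pseudomonad in
/-- A lifting of `T` to `S`-pseudoalgebras: for every strict algebra `A` in `C` a pseudoalgebra
structure on `T A` and a pseudomorphism structure on `i_A : J A ⟶ T A`, and for every pseudomorphism
`f : J A ⟶ T B` a pseudomorphism structure on `f^*`, such that extension sends algebra 2-cells to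
algebra 2-cells and `μ`, `η`, `θ` are algebra 2-cells. -/
structure PseudoLifting (T : RelPseudomonad J) {S : TwoMonad D} (R : RestrictsAlong J S) where
  alg (A : StrictAlg R.monad.toPseudomonad) : S.toPseudomonad.Alg (T.obj A.carrier)
  extStr {A B : StrictAlg R.monad.toPseudomonad} {f : J.obj A.carrier ⟶ T.obj B.carrier}
    (F : MorStr (R.mor.mapAlg A.alg) (alg B) f) : MorStr (alg A) (alg B) (T.ext.obj f)
  unitStr (A : StrictAlg R.monad.toPseudomonad) :
    MorStr (R.mor.mapAlg A.alg) (alg A) (T.unit A.carrier)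
  ext_cell {A B : StrictAlg R.monad.toPseudomonad} {f f' : J.obj A.carrier ⟶ T.obj B.carrier}
    (F : MorStr (R.mor.mapAlg A.alg) (alg B) f) (F' : MorStr (R.mor.mapAlg A.alg) (alg B) f')
    (φ : f ⟶ f') (hφ : IsAlgCell F F' φ) : IsAlgCell (extStr F) (extStr F') (T.ext.map φ)
  mu_cell {A B E : StrictAlg R.monad.toPseudomonad} {f : J.obj A.carrier ⟶ T.obj B.carrier}
    {g : J.obj B.carrier ⟶ T.obj E.carrier} (F : MorStr (R.mor.mapAlg A.alg) (alg B) f)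
    (G : MorStr (R.mor.mapAlg B.alg) (alg E) g) :
    IsAlgCell (extStr (F.comp (extStr G))) ((extStr F).comp (extStr G)) (T.mu f g).hom
  eta_cell {A B : StrictAlg R.monad.toPseudomonad} {f : J.obj A.carrier ⟶ T.obj B.carrier}
    (F : MorStr (R.mor.mapAlg A.alg) (alg B) f) :
    IsAlgCell F ((unitStr A).comp (extStr F)) (T.eta f).hom
  theta_cell (A : StrictAlg R.monad.toPseudomonad) :
    IsAlgCell (extStr (unitStr A)) (MorStr.id (alg A)) (T.theta A.carrier).hom

/-- A lifting of `T` to strict `S`-algebras: as above, with a strict algebra structure on every `T A`. -/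
structure StrictLifting (T : RelPseudomonad J) {S : TwoMonad D} (R : RestrictsAlong J S) extends
    PseudoLifting T R where
  isStrict (A : Pseudomonad.StrictAlg R.monad.toPseudomonad) : (alg A).IsStrict

/-- The pseudomonad `St` on the Kleisli bicategory of `T` extends `S`: it agrees with the restriction
of `S` to `C` on objects, and the identity morphisms of the objects `S X` are the components of a
morphism of pseudomonads over the canonical pseudofunctor from `C` to the Kleisli bicategory, so
that the two pseudofunctors, their multiplications and their units correspond coherently. -/
structure Extension (T : RelPseudomonad J) {S : TwoMonad D} (R : RestrictsAlong J S)
    (St : Pseudomonad T.Kleisli) where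
  mor : PseudomonadMor T.free R.monad.toPseudomonad St
  obj_eq (X : C) : St.obj (T.toKl X) = T.toKl (R.monad.obj X)
  app_eq (X : C) : HEq (mor.app X) (𝟙 (T.toKl (R.monad.obj X)))

end Lifting

/-! A lifting turns strict algebras into a bicategory lying over the Kleisli bicategory. Its objects
are the strict `S`-algebras of `C`, its morphisms from `A` to `B` are the pseudomorphisms from `JA`
to `TB`, and its 2-cells are the algebra 2-cells. Identities and composites come from the lifted
unit and extension, and the conditions on `μ`, `η`, `θ` put the Kleisli associator and unitors among
the algebra 2-cells. The extension of `S` is the pseudomonad of a biadjunction: the forgetful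
pseudofunctor from this bicategory to the Kleisli bicategory has a left biadjoint, which sends `X`
to the free algebra `SX`.

The reason for the biadjoint is that a Kleisli morphism out of `SX` is a morphism from `JSX` to `TA`
in `D`. The equivalence from `SJX` to `JSX` underlies a pseudomorphism out of the free pseudoalgebra
on `JX`, so `JSX` is again free on `JX`, up to equivalence, with unit `J(e_X)`. Restriction along
`J(e_X)` is therefore fully faithful from pseudomorphisms `JSX → TA` with algebra 2-cells to
morphisms `JX → TA`, and essentially surjective. In the Kleisli bicategory, composition with the
image of `e_X` is precomposition with `J(e_X)` up to `η`, so that image is a universal arrow. This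
is carried by `TwoMonad.free_hom_ext` and `TwoMonad.exists_free_lift` (the free case), by
`MorStr.exists_of_comp_isEquivalence` and `IsAlgCell.of_whiskerLeft` (descent along an equivalence),
and by `PseudoLifting.freeObjects` (the transfer to the Kleisli bicategory).

The rest is formal. With universal arrows at hand, every structural 2-cell is defined as a lift, and
an equation of structured 2-cells out of a free object may be tested after whiskering with the
universal arrow (`FreeObjects.hom_ext`). The multiplication is the canonical action of free objects
on structured ones, and its naturality on squares, `FreeObjects.actN_sq`, gives both associativity
laws at once. The free object on `X` has carrier `SX` itself, so the identities of the objects `SX`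
can serve as components of the comparison with the 2-monad on `C`; its laws are deduced from the
same universal property in `AlgComparison`.

Strictness of the 2-monads enters in two ways: the free algebra on `X` in `C` is strict, so that the
lifting applies to it, and two identities between unit constraints become trivial. A lifting to
strict algebras is a special lifting to pseudoalgebras, so it needs no argument of its own. -/

/-! ### Displayed bicategories and their free objects -/

/-- Structure on the morphisms of a bicategory `K` between the objects `u A`, together with a
property of the 2-cells between structured morphisms, closed under all bicategory operations:
a locally faithful displayed bicategory over `K`. -/
structure StructuredBicat {K : Type u₁} [Bicategory.{w₁, v₁} K] {O : Type u₂} (u : O → K) where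
  Str {A B : O} (f : u A ⟶ u B) : Type w₂
  IsCell {A B : O} {f g : u A ⟶ u B} (F : Str f) (G : Str g) (φ : f ⟶ g) : Prop
  id (A : O) : Str (𝟙 (u A))
  comp {A B E : O} {f : u A ⟶ u B} {g : u B ⟶ u E} (F : Str f) (G : Str g) : Str (f ≫ g)
  isCell_id {A B : O} {f : u A ⟶ u B} (F : Str f) : IsCell F F (𝟙 f)
  isCell_comp {A B : O} {f g h : u A ⟶ u B} {F : Str f} {G : Str g} {H : Str h} {φ : f ⟶ g}
    {ψ : g ⟶ h} : IsCell F G φ → IsCell G H ψ → IsCell F H (φ ≫ ψ)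
  isCell_inv {A B : O} {f g : u A ⟶ u B} {F : Str f} {G : Str g} {φ : f ≅ g} :
    IsCell F G φ.hom → IsCell G F φ.inv
  isCell_whiskerLeft {A B E : O} {f : u A ⟶ u B} (F : Str f) {g h : u B ⟶ u E} {G : Str g}
    {H : Str h} {φ : g ⟶ h} : IsCell G H φ → IsCell (comp F G) (comp F H) (f ◁ φ)
  isCell_whiskerRight {A B E : O} {f g : u A ⟶ u B} {F : Str f} {G : Str g} {φ : f ⟶ g}
    {h : u B ⟶ u E} (H : Str h) : IsCell F G φ → IsCell (comp F H) (comp G H) (φ ▷ h)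
  isCell_associator {A B E V : O} {f : u A ⟶ u B} {g : u B ⟶ u E} {h : u E ⟶ u V}
    (F : Str f) (G : Str g) (H : Str h) :
    IsCell (comp (comp F G) H) (comp F (comp G H)) (α_ f g h).hom
  isCell_leftUnitor {A B : O} {f : u A ⟶ u B} (F : Str f) :
    IsCell (comp (id A) F) F (λ_ f).hom
  isCell_rightUnitor {A B : O} {f : u A ⟶ u B} (F : Str f) :
    IsCell (comp F (id B)) F (ρ_ f).hom

namespace StructuredBicat

variable {K : Type u₁} [Bicategory.{w₁, v₁} K] {O : Type u₂} {u : O → K}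
  (𝔸 : StructuredBicat.{w₁, w₂} u)

lemma isCell_associator_inv {A B E V : O} {f : u A ⟶ u B} {g : u B ⟶ u E} {h : u E ⟶ u V}
    (F : 𝔸.Str f) (G : 𝔸.Str g) (H : 𝔸.Str h) :
    𝔸.IsCell (𝔸.comp F (𝔸.comp G H)) (𝔸.comp (𝔸.comp F G) H) (α_ f g h).inv :=
  𝔸.isCell_inv (𝔸.isCell_associator F G H)

lemma isCell_rightUnitor_inv {A B : O} {f : u A ⟶ u B} (F : 𝔸.Str f) :
    𝔸.IsCell F (𝔸.comp F (𝔸.id B)) (ρ_ f).inv :=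
  𝔸.isCell_inv (𝔸.isCell_rightUnitor F)

end StructuredBicat

/-- Free objects for a displayed bicategory `𝔸` over `K`: a left biadjoint of the forgetful
pseudofunctor, given by universal arrows `e X : X ⟶ u (free X)`. -/
structure FreeObjects {K : Type u₁} [Bicategory.{w₁, v₁} K] {O : Type u₂} {u : O → K}
    (𝔸 : StructuredBicat.{w₁, w₂} u) where
  free : K → O
  e (X : K) : X ⟶ u (free X)
  ext {X : K} {A : O} (f : X ⟶ u A) : u (free X) ⟶ u A
  extStr {X : K} {A : O} (f : X ⟶ u A) : 𝔸.Str (ext f)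
  eta {X : K} {A : O} (f : X ⟶ u A) : f ≅ e X ≫ ext f
  -- This and the next three fields make restriction along the universal arrow fully faithful on
  -- structured morphisms. They replace the unit, counit and triangle data of a biadjunction.
  lift {X : K} {A : O} {h h' : u (free X) ⟶ u A} (H : 𝔸.Str h) (H' : 𝔸.Str h')
    (σ : e X ≫ h ⟶ e X ≫ h') : h ⟶ h'
  isCell_lift {X : K} {A : O} {h h' : u (free X) ⟶ u A} (H : 𝔸.Str h) (H' : 𝔸.Str h')
    (σ : e X ≫ h ⟶ e X ≫ h') : 𝔸.IsCell H H' (lift H H' σ)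
  e_lift {X : K} {A : O} {h h' : u (free X) ⟶ u A} (H : 𝔸.Str h) (H' : 𝔸.Str h')
    (σ : e X ≫ h ⟶ e X ≫ h') : e X ◁ lift H H' σ = σ
  hom_ext {X : K} {A : O} {h h' : u (free X) ⟶ u A} {H : 𝔸.Str h} {H' : 𝔸.Str h'} {φ ψ : h ⟶ h'} :
    𝔸.IsCell H H' φ → 𝔸.IsCell H H' ψ → e X ◁ φ = e X ◁ ψ → φ = ψ

/-! ### The pseudofunctor of free objects -/

namespace FreeObjects

open StructuredBicat

variable {K : Type u₁} [Bicategory.{w₁, v₁} K] {O : Type u₂} {u : O → K}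
  {𝔸 : StructuredBicat.{w₁, w₂} u} (𝔽 : FreeObjects 𝔸)

/-- The lift of an invertible 2-cell along the universal arrow. -/
@[simps]
def liftIso {X : K} {A : O} {h h' : u (𝔽.free X) ⟶ u A} (H : 𝔸.Str h) (H' : 𝔸.Str h')
    (σ : 𝔽.e X ≫ h ≅ 𝔽.e X ≫ h') : h ≅ h' where
  hom := 𝔽.lift H H' σ.hom
  inv := 𝔽.lift H' H σ.inv
  hom_inv_id := 𝔽.hom_ext (𝔸.isCell_comp (𝔽.isCell_lift _ _ _) (𝔽.isCell_lift _ _ _))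
    (𝔸.isCell_id H) (by simp [𝔽.e_lift])
  inv_hom_id := 𝔽.hom_ext (𝔸.isCell_comp (𝔽.isCell_lift _ _ _) (𝔽.isCell_lift _ _ _))
    (𝔸.isCell_id H') (by simp [𝔽.e_lift])

/-- The underlying object of the free object. -/
abbrev S (X : K) : K := u (𝔽.free X)

variable {X Y Z V : K}

/-- Functoriality of free objects on morphisms. -/
def map (f : X ⟶ Y) : 𝔽.S X ⟶ 𝔽.S Y := 𝔽.ext (f ≫ 𝔽.e Y)

def mapStr (f : X ⟶ Y) : 𝔸.Str (𝔽.map f) := 𝔽.extStr (f ≫ 𝔽.e Y)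

/-- Pseudonaturality of the universal arrows. -/
def eN (f : X ⟶ Y) : f ≫ 𝔽.e Y ≅ 𝔽.e X ≫ 𝔽.map f := 𝔽.eta (f ≫ 𝔽.e Y)

/-- Functoriality of free objects on 2-cells. -/
def map₂ {f g : X ⟶ Y} (φ : f ⟶ g) : 𝔽.map f ⟶ 𝔽.map g :=
  𝔽.lift (𝔽.mapStr f) (𝔽.mapStr g) ((𝔽.eN f).inv ≫ φ ▷ 𝔽.e Y ≫ (𝔽.eN g).hom)

def mapId (X : K) : 𝔽.map (𝟙 X) ≅ 𝟙 (𝔽.S X) :=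
  𝔽.liftIso (𝔽.mapStr (𝟙 X)) (𝔸.id _) ((𝔽.eN (𝟙 X)).symm ≪≫ λ_ _ ≪≫ (ρ_ _).symm)

def mapComp (f : X ⟶ Y) (g : Y ⟶ Z) : 𝔽.map (f ≫ g) ≅ 𝔽.map f ≫ 𝔽.map g :=
  𝔽.liftIso (𝔽.mapStr (f ≫ g)) (𝔸.comp (𝔽.mapStr f) (𝔽.mapStr g))
    ((𝔽.eN (f ≫ g)).symm ≪≫ α_ _ _ _ ≪≫ whiskerLeftIso f (𝔽.eN g) ≪≫ (α_ _ _ _).symm ≪≫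
      whiskerRightIso (𝔽.eN f) (𝔽.map g) ≪≫ α_ _ _ _)

lemma isCell_map₂ {f g : X ⟶ Y} (φ : f ⟶ g) :
    𝔸.IsCell (𝔽.mapStr f) (𝔽.mapStr g) (𝔽.map₂ φ) := 𝔽.isCell_lift _ _ _

lemma isCell_mapId : 𝔸.IsCell (𝔽.mapStr (𝟙 X)) (𝔸.id _) (𝔽.mapId X).hom := 𝔽.isCell_lift _ _ _

lemma isCell_mapComp (f : X ⟶ Y) (g : Y ⟶ Z) :
    𝔸.IsCell (𝔽.mapStr (f ≫ g)) (𝔸.comp (𝔽.mapStr f) (𝔽.mapStr g)) (𝔽.mapComp f g).hom :=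
  𝔽.isCell_lift _ _ _

/-- Each structural cell of the free pseudofunctor is a lift, and its defining equation, cleared of
inverses, is a law for `eN`. This law and the next two serve to check the pseudofunctor axioms, and
later make the unit pseudonatural. -/
lemma eN_natural {f g : X ⟶ Y} (φ : f ⟶ g) :
    φ ▷ 𝔽.e Y ≫ (𝔽.eN g).hom = (𝔽.eN f).hom ≫ 𝔽.e X ◁ 𝔽.map₂ φ := by
  simp [map₂, 𝔽.e_lift]

lemma eN_id : (𝔽.eN (𝟙 X)).hom ≫ 𝔽.e X ◁ (𝔽.mapId X).hom = (λ_ _).hom ≫ (ρ_ _).inv := by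
  simp [mapId, 𝔽.e_lift]

lemma eN_comp (f : X ⟶ Y) (g : Y ⟶ Z) :
    (𝔽.eN (f ≫ g)).hom ≫ 𝔽.e X ◁ (𝔽.mapComp f g).hom =
      (α_ _ _ _).hom ≫ f ◁ (𝔽.eN g).hom ≫ (α_ _ _ _).inv ≫
        (𝔽.eN f).hom ▷ 𝔽.map g ≫ (α_ _ _ _).hom := by
  simp [mapComp, 𝔽.e_lift]

lemma map₂_id (f : X ⟶ Y) : 𝔽.map₂ (𝟙 f) = 𝟙 (𝔽.map f) :=
  𝔽.hom_ext (𝔽.isCell_map₂ _) (𝔸.isCell_id _) (by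
    rw [← cancel_epi (𝔽.eN f).hom, ← 𝔽.eN_natural]; simp)

lemma map₂_comp {f g h : X ⟶ Y} (φ : f ⟶ g) (ψ : g ⟶ h) :
    𝔽.map₂ (φ ≫ ψ) = 𝔽.map₂ φ ≫ 𝔽.map₂ ψ :=
  𝔽.hom_ext (𝔽.isCell_map₂ _) (𝔸.isCell_comp (𝔽.isCell_map₂ _) (𝔽.isCell_map₂ _)) (by
    rw [← cancel_epi (𝔽.eN f).hom, ← 𝔽.eN_natural, whiskerLeft_comp,
      ← reassoc_of% 𝔽.eN_natural, ← 𝔽.eN_natural]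
    simp)

/-- Both sides are structured cells out of a free object, so they may be compared after whiskering
with `e X`. Cancelling the invertible `eN` leaves an equation about `eN` alone, settled by its laws
and interchange. The other pseudofunctor axioms follow the same pattern. -/
lemma map₂_whiskerLeft (f : X ⟶ Y) {g h : Y ⟶ Z} (φ : g ⟶ h) :
    𝔽.map₂ (f ◁ φ) ≫ (𝔽.mapComp f h).hom = (𝔽.mapComp f g).hom ≫ 𝔽.map f ◁ 𝔽.map₂ φ := by
  refine 𝔽.hom_ext (𝔸.isCell_comp (𝔽.isCell_map₂ _) (𝔽.isCell_mapComp _ _))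
    (𝔸.isCell_comp (𝔽.isCell_mapComp _ _) (𝔸.isCell_whiskerLeft _ (𝔽.isCell_map₂ _))) ?_
  rw [← cancel_epi (𝔽.eN (f ≫ g)).hom, whiskerLeft_comp, whiskerLeft_comp,
    ← reassoc_of% 𝔽.eN_natural, 𝔽.eN_comp, reassoc_of% 𝔽.eN_comp]
  calc
    _ = (α_ _ _ _).hom ≫ f ◁ (φ ▷ 𝔽.e Z ≫ (𝔽.eN h).hom) ≫ (α_ _ _ _).inv ≫
        (𝔽.eN f).hom ▷ 𝔽.map h ≫ (α_ _ _ _).hom := by bicategory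
    _ = (α_ _ _ _).hom ≫ f ◁ (𝔽.eN g).hom ≫ (α_ _ _ _).inv ≫ ((f ≫ 𝔽.e Y) ◁ 𝔽.map₂ φ ≫
        (𝔽.eN f).hom ▷ 𝔽.map h) ≫ (α_ _ _ _).hom := by rw [𝔽.eN_natural]; bicategory
    _ = _ := by rw [whisker_exchange]; bicategory

lemma map₂_whiskerRight {f g : X ⟶ Y} (φ : f ⟶ g) (h : Y ⟶ Z) :
    𝔽.map₂ (φ ▷ h) ≫ (𝔽.mapComp g h).hom = (𝔽.mapComp f h).hom ≫ 𝔽.map₂ φ ▷ 𝔽.map h := by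
  refine 𝔽.hom_ext (𝔸.isCell_comp (𝔽.isCell_map₂ _) (𝔽.isCell_mapComp _ _))
    (𝔸.isCell_comp (𝔽.isCell_mapComp _ _) (𝔸.isCell_whiskerRight _ (𝔽.isCell_map₂ _))) ?_
  rw [← cancel_epi (𝔽.eN (f ≫ h)).hom, whiskerLeft_comp, whiskerLeft_comp,
    ← reassoc_of% 𝔽.eN_natural, 𝔽.eN_comp, reassoc_of% 𝔽.eN_comp]
  calc
    _ = (α_ _ _ _).hom ≫ (φ ▷ (h ≫ 𝔽.e Z) ≫ g ◁ (𝔽.eN h).hom) ≫ (α_ _ _ _).inv ≫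
        (𝔽.eN g).hom ▷ 𝔽.map h ≫ (α_ _ _ _).hom := by bicategory
    _ = (α_ _ _ _).hom ≫ f ◁ (𝔽.eN h).hom ≫ (α_ _ _ _).inv ≫ (φ ▷ 𝔽.e Y ≫ (𝔽.eN g).hom) ▷ 𝔽.map h ≫
        (α_ _ _ _).hom := by rw [← whisker_exchange]; bicategory
    _ = _ := by rw [𝔽.eN_natural]; bicategory

lemma map₂_associator (f : X ⟶ Y) (g : Y ⟶ Z) (h : Z ⟶ V) :
    𝔽.map₂ (α_ f g h).hom ≫ (𝔽.mapComp f (g ≫ h)).hom ≫ 𝔽.map f ◁ (𝔽.mapComp g h).hom =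
      (𝔽.mapComp (f ≫ g) h).hom ≫ (𝔽.mapComp f g).hom ▷ 𝔽.map h ≫ (α_ _ _ _).hom := by
  refine 𝔽.hom_ext (𝔸.isCell_comp (𝔽.isCell_map₂ _) (𝔸.isCell_comp (𝔽.isCell_mapComp _ _)
      (𝔸.isCell_whiskerLeft _ (𝔽.isCell_mapComp _ _))))
    (𝔸.isCell_comp (𝔽.isCell_mapComp _ _) (𝔸.isCell_comp
      (𝔸.isCell_whiskerRight _ (𝔽.isCell_mapComp _ _)) (𝔸.isCell_associator _ _ _))) ?_
  rw [← cancel_epi (𝔽.eN ((f ≫ g) ≫ h)).hom]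
  simp only [whiskerLeft_comp]
  rw [← reassoc_of% 𝔽.eN_natural, reassoc_of% 𝔽.eN_comp, reassoc_of% 𝔽.eN_comp]
  calc
    _ = 𝟙 _ ⊗≫ f ◁ (𝔽.eN (g ≫ h)).hom ⊗≫ ((𝔽.eN f).hom ▷ 𝔽.map (g ≫ h) ≫
        (𝔽.e X ≫ 𝔽.map f) ◁ (𝔽.mapComp g h).hom) ⊗≫ 𝟙 _ := by bicategory
    _ = 𝟙 _ ⊗≫ f ◁ ((𝔽.eN (g ≫ h)).hom ≫ 𝔽.e Y ◁ (𝔽.mapComp g h).hom) ⊗≫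
        (𝔽.eN f).hom ▷ (𝔽.map g ≫ 𝔽.map h) ⊗≫ 𝟙 _ := by rw [← whisker_exchange]; bicategory
    _ = (α_ _ _ _).hom ≫ (f ≫ g) ◁ (𝔽.eN h).hom ≫ (α_ _ _ _).inv ≫ ((α_ _ _ _).hom ≫
        f ◁ (𝔽.eN g).hom ≫ (α_ _ _ _).inv ≫ (𝔽.eN f).hom ▷ 𝔽.map g ≫ (α_ _ _ _).hom) ▷ 𝔽.map h ⊗≫
          𝟙 _ := by rw [𝔽.eN_comp]; bicategory
    _ = _ := by rw [← 𝔽.eN_comp]; bicategory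

lemma map₂_leftUnitor (f : X ⟶ Y) :
    𝔽.map₂ (λ_ f).hom =
      (𝔽.mapComp (𝟙 X) f).hom ≫ (𝔽.mapId X).hom ▷ 𝔽.map f ≫ (λ_ (𝔽.map f)).hom := by
  refine 𝔽.hom_ext (𝔽.isCell_map₂ _) (𝔸.isCell_comp (𝔽.isCell_mapComp _ _) (𝔸.isCell_comp
      (𝔸.isCell_whiskerRight _ 𝔽.isCell_mapId) (𝔸.isCell_leftUnitor _))) ?_
  rw [← cancel_epi (𝔽.eN (𝟙 X ≫ f)).hom, ← 𝔽.eN_natural]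
  simp only [whiskerLeft_comp]
  rw [reassoc_of% 𝔽.eN_comp]
  symm
  calc
    _ = (α_ _ _ _).hom ≫ (𝟙 X ◁ (𝔽.eN f).hom) ≫ (α_ _ _ _).inv ≫
        ((𝔽.eN (𝟙 X)).hom ≫ 𝔽.e X ◁ (𝔽.mapId X).hom) ▷ 𝔽.map f ⊗≫ 𝟙 _ := by bicategory
    _ = _ := by rw [𝔽.eN_id]; bicategory

lemma map₂_rightUnitor (f : X ⟶ Y) :
    𝔽.map₂ (ρ_ f).hom =
      (𝔽.mapComp f (𝟙 Y)).hom ≫ 𝔽.map f ◁ (𝔽.mapId Y).hom ≫ (ρ_ (𝔽.map f)).hom := by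
  refine 𝔽.hom_ext (𝔽.isCell_map₂ _) (𝔸.isCell_comp (𝔽.isCell_mapComp _ _) (𝔸.isCell_comp
      (𝔸.isCell_whiskerLeft _ 𝔽.isCell_mapId) (𝔸.isCell_rightUnitor _))) ?_
  rw [← cancel_epi (𝔽.eN (f ≫ 𝟙 Y)).hom, ← 𝔽.eN_natural]
  simp only [whiskerLeft_comp]
  rw [reassoc_of% 𝔽.eN_comp]
  symm
  calc
    _ = (α_ _ _ _).hom ≫ f ◁ (𝔽.eN (𝟙 Y)).hom ⊗≫
        ((𝔽.eN f).hom ▷ 𝔽.map (𝟙 Y) ≫ (𝔽.e X ≫ 𝔽.map f) ◁ (𝔽.mapId Y).hom) ⊗≫ 𝟙 _ := by bicategory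
    _ = (α_ _ _ _).hom ≫ f ◁ ((𝔽.eN (𝟙 Y)).hom ≫ 𝔽.e Y ◁ (𝔽.mapId Y).hom) ⊗≫
        (𝔽.eN f).hom ▷ (𝟙 _) ⊗≫ 𝟙 _ := by rw [← whisker_exchange]; bicategory
    _ = _ := by rw [𝔽.eN_id]; bicategory

/-- The pseudofunctor underlying the pseudomonad of free objects. -/
def fn : K ⥤ᵖ K where
  obj X := 𝔽.S X
  map f := 𝔽.map f
  map₂ φ := 𝔽.map₂ φ
  map₂_id := 𝔽.map₂_id
  map₂_comp := 𝔽.map₂_comp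
  mapId := 𝔽.mapId
  mapComp := 𝔽.mapComp
  map₂_whisker_left f _ _ φ := by
    rw [← reassoc_of% 𝔽.map₂_whiskerLeft]; simp
  map₂_whisker_right φ h := by
    rw [← reassoc_of% 𝔽.map₂_whiskerRight]; simp
  map₂_associator f g h := by
    rw [← reassoc_of% 𝔽.map₂_associator]; simp
  map₂_left_unitor := 𝔽.map₂_leftUnitor
  map₂_right_unitor := 𝔽.map₂_rightUnitor

end FreeObjects

/-! ### Coherence equations with explicit and with implicit associators -/

section

variable {B : Type u₁} [Bicategory.{w₁, v₁} B]

/-- The pseudomonad axioms are phrased with `⊗≫`, whereas the equations for free objects carry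
explicit associators so that they can be rewritten. This lemma and the next four pass between the
two forms. -/
lemma bicategoricalComp_square₁ {a b c d x y z : B} {f : a ⟶ b} {g : b ⟶ c} {m : c ⟶ d}
    {p : a ⟶ x} {p' : x ⟶ c} {q : x ⟶ y} {q' : y ⟶ d} {w : B} {n' : w ⟶ y} {r : b ⟶ z}
    {r' : z ⟶ d} {t : a ⟶ w} {t' : w ⟶ z} {σ : f ≫ g ⟶ p ≫ p'} {n₁ : p' ≫ m ⟶ q ≫ q'}
    {n₂ : p ≫ q ⟶ t ≫ n'} {n₃ : g ≫ m ⟶ r ≫ r'} {n₄ : f ≫ r ⟶ t ≫ t'} {n₅ : t' ≫ r' ⟶ n' ≫ q'}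
    (h : σ ▷ m ≫ (α_ _ _ _).hom ≫ p ◁ n₁ ≫ (α_ _ _ _).inv ≫ n₂ ▷ q' ≫ (α_ _ _ _).hom =
      (α_ _ _ _).hom ≫ f ◁ n₃ ≫ (α_ _ _ _).inv ≫ n₄ ▷ r' ≫ (α_ _ _ _).hom ≫ t ◁ n₅) :
    (α_ _ _ _).inv ≫ σ ▷ m ⊗≫ p ◁ n₁ ⊗≫ n₂ ▷ q' ≫ (α_ _ _ _).hom =
      f ◁ n₃ ⊗≫ n₄ ▷ r' ⊗≫ t ◁ n₅ := by
  rw [← cancel_epi (α_ _ _ _).hom]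
  simpa [bicategoricalComp] using h

lemma bicategoricalComp_square₂ {a b c d x y z w : B} {f : a ⟶ b} {g : b ⟶ c} {m : c ⟶ d}
    {p : a ⟶ x} {p' : x ⟶ c} {q : x ⟶ y} {q' : y ⟶ d} {n' : w ⟶ y} {r : b ⟶ z}
    {r' : z ⟶ d} {t : a ⟶ w} {t' : w ⟶ z} {σ : f ≫ g ⟶ p ≫ p'} {n₁ : p' ≫ m ⟶ q ≫ q'}
    {n₂ : p ≫ q ⟶ t ≫ n'} {n₃ : g ≫ m ⟶ r ≫ r'} {n₄ : f ≫ r ⟶ t ≫ t'} {n₅ : t' ≫ r' ⟶ n' ≫ q'}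
    (h : σ ▷ m ≫ (α_ _ _ _).hom ≫ p ◁ n₁ ≫ (α_ _ _ _).inv ≫ n₂ ▷ q' ≫ (α_ _ _ _).hom =
      (α_ _ _ _).hom ≫ f ◁ n₃ ≫ (α_ _ _ _).inv ≫ n₄ ▷ r' ≫ (α_ _ _ _).hom ≫ t ◁ n₅) :
    σ ▷ m ⊗≫ p ◁ n₁ ⊗≫ n₂ ▷ q' ≫ (α_ _ _ _).hom =
      (α_ _ _ _).hom ≫ f ◁ n₃ ⊗≫ n₄ ▷ r' ⊗≫ t ◁ n₅ := by
  simpa [bicategoricalComp] using h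

lemma bicategoricalComp_left {a b c d : B} {f : a ⟶ b} {e : b ⟶ c} {m : c ⟶ b} {e' : a ⟶ d}
    {g : d ⟶ c} {m' : d ⟶ a} {l : 𝟙 b ⟶ e ≫ m} {n : f ≫ e ⟶ e' ≫ g} {n' : g ≫ m ⟶ m' ≫ f}
    {l' : 𝟙 a ⟶ e' ≫ m'}
    (h : f ◁ l ≫ (α_ _ _ _).inv ≫ n ▷ m ≫ (α_ _ _ _).hom ≫ e' ◁ n' =
      (ρ_ _).hom ≫ (λ_ _).inv ≫ l' ▷ f ≫ (α_ _ _ _).hom) :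
    f ◁ l ⊗≫ n ▷ m ⊗≫ e' ◁ n' = (ρ_ _).hom ≫ (λ_ _).inv ≫ l' ▷ f ≫ (α_ _ _ _).hom := by
  simpa [bicategoricalComp] using h

lemma bicategoricalComp_right {a b c d : B} {f : a ⟶ b} {e : b ⟶ c} {m : c ⟶ b} {e' : a ⟶ d}
    {g : d ⟶ c} {m' : d ⟶ a} {σ : f ≫ e ⟶ e' ≫ g} {n : g ≫ m ⟶ m' ≫ f}
    {r : e ≫ m ⟶ 𝟙 b} {r' : e' ≫ m' ⟶ 𝟙 a}
    (h : f ◁ r = (α_ _ _ _).inv ≫ σ ▷ m ≫ (α_ _ _ _).hom ≫ e' ◁ n ≫ (α_ _ _ _).inv ≫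
      r' ▷ f ≫ (λ_ _).hom ≫ (ρ_ _).inv) :
    (α_ _ _ _).inv ≫ σ ▷ m ⊗≫ e' ◁ n ⊗≫ r' ▷ f ≫ (λ_ _).hom ≫ (ρ_ _).inv = f ◁ r := by
  rw [h]
  simp [bicategoricalComp]

lemma bicategoricalComp_unit {a b c : B} {e : a ⟶ b} {m : b ⟶ a} {m₁ : a ⟶ c} {m₂ : b ⟶ a}
    {σ : 𝟙 a ⟶ e ≫ m} {n : m ≫ m₁ ⟶ m₂ ≫ m₁} {r : e ≫ m₂ ⟶ 𝟙 a}
    (h : σ ▷ m₁ ≫ (α_ _ _ _).hom ≫ e ◁ n ≫ (α_ _ _ _).inv ≫ r ▷ m₁ = 𝟙 _) :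
    σ ▷ m₁ ⊗≫ e ◁ n ⊗≫ r ▷ m₁ = 𝟙 (𝟙 a ≫ m₁) := by
  simpa [bicategoricalComp] using h

end

/-! ### The action of free objects and the resulting pseudomonad -/

namespace FreeObjects

open StructuredBicat

variable {K : Type u₁} [Bicategory.{w₁, v₁} K] {O : Type u₂} {u : O → K}
  {𝔸 : StructuredBicat.{w₁, w₂} u} (𝔽 : FreeObjects 𝔸)

section

variable {X Y Z : K} {A B E : O}

/-- The canonical action of free objects on structured objects. -/
def act (A : O) : 𝔽.S (u A) ⟶ u A := 𝔽.ext (𝟙 (u A))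

def actStr (A : O) : 𝔸.Str (𝔽.act A) := 𝔽.extStr (𝟙 (u A))

def actUnit (A : O) : 𝟙 (u A) ≅ 𝔽.e (u A) ≫ 𝔽.act A := 𝔽.eta (𝟙 (u A))

/-- A morphism to a structured object factors through the action. -/
def eAct (f : X ⟶ u A) : f ≅ 𝔽.e X ≫ 𝔽.map f ≫ 𝔽.act A :=
  (ρ_ f).symm ≪≫ whiskerLeftIso f (𝔽.actUnit A) ≪≫ (α_ _ _ _).symm ≪≫
    whiskerRightIso (𝔽.eN f) (𝔽.act A) ≪≫ α_ _ _ _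

lemma eAct_natural {f g : X ⟶ u A} (φ : f ⟶ g) :
    φ ≫ (𝔽.eAct g).hom = (𝔽.eAct f).hom ≫ 𝔽.e X ◁ 𝔽.map₂ φ ▷ 𝔽.act A := by
  symm
  calc
    _ = (ρ_ f).inv ≫ f ◁ (𝔽.actUnit A).hom ⊗≫ ((𝔽.eN f).hom ≫ 𝔽.e X ◁ 𝔽.map₂ φ) ▷ 𝔽.act A ≫
        (α_ _ _ _).hom := by simp [eAct, bicategoricalComp]
    _ = (ρ_ f).inv ≫ (f ◁ (𝔽.actUnit A).hom ≫ φ ▷ _) ⊗≫ (𝔽.eN g).hom ▷ 𝔽.act A ≫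
        (α_ _ _ _).hom := by rw [← 𝔽.eN_natural]; bicategory
    _ = _ := by rw [whisker_exchange]; simp [eAct, bicategoricalComp]

lemma eAct_comp (f : X ⟶ Y) (g : Y ⟶ u A) :
    (𝔽.eAct (f ≫ g)).hom ≫ 𝔽.e X ◁ (𝔽.mapComp f g).hom ▷ 𝔽.act A =
      f ◁ (𝔽.eAct g).hom ⊗≫ (𝔽.eN f).hom ▷ (𝔽.map g ≫ 𝔽.act A) ⊗≫ 𝟙 _ := by
  calc
    _ = (ρ_ _).inv ≫ (f ≫ g) ◁ (𝔽.actUnit A).hom ⊗≫ ((𝔽.eN (f ≫ g)).hom ≫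
        𝔽.e X ◁ (𝔽.mapComp f g).hom) ▷ 𝔽.act A ≫ (α_ _ _ _).hom := by
      simp [eAct, bicategoricalComp]
    _ = _ := by
      rw [𝔽.eN_comp]
      simp [eAct, bicategoricalComp]

/-- The pseudonaturality of the action with respect to structured morphisms. -/
def actN {h : u A ⟶ u B} (H : 𝔸.Str h) : 𝔽.map h ≫ 𝔽.act B ≅ 𝔽.act A ≫ h :=
  𝔽.liftIso (𝔸.comp (𝔽.mapStr h) (𝔽.actStr B)) (𝔸.comp (𝔽.actStr A) H)
    ((𝔽.eAct h).symm ≪≫ (λ_ h).symm ≪≫ whiskerRightIso (𝔽.actUnit A) h ≪≫ α_ _ _ _)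

lemma isCell_actN {h : u A ⟶ u B} (H : 𝔸.Str h) :
    𝔸.IsCell (𝔸.comp (𝔽.mapStr h) (𝔽.actStr B)) (𝔸.comp (𝔽.actStr A) H) (𝔽.actN H).hom :=
  𝔽.isCell_lift _ _ _

/-- The defining equation of `actN` as a lift. With `eAct` unfolded it is also the left unit law,
which is how `left_natural` is obtained. -/
lemma eAct_actN {h : u A ⟶ u B} (H : 𝔸.Str h) :
    (𝔽.eAct h).hom ≫ 𝔽.e (u A) ◁ (𝔽.actN H).hom =
      (λ_ h).inv ≫ (𝔽.actUnit A).hom ▷ h ≫ (α_ _ _ _).hom := by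
  simp [actN, 𝔽.e_lift]

/-- By uniqueness of lifts: restricted along the universal arrow, both sides are `φ` pasted with the
unit of the action. Both sides must be structured cells for this, hence the hypothesis on `φ`. -/
lemma actN_natural {h h' : u A ⟶ u B} {H : 𝔸.Str h} {H' : 𝔸.Str h'} {φ : h ⟶ h'}
    (hφ : 𝔸.IsCell H H' φ) :
    𝔽.map₂ φ ▷ 𝔽.act B ≫ (𝔽.actN H').hom = (𝔽.actN H).hom ≫ 𝔽.act A ◁ φ := by
  refine 𝔽.hom_ext (𝔸.isCell_comp (𝔸.isCell_whiskerRight _ (𝔽.isCell_map₂ _)) (𝔽.isCell_actN _))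
    (𝔸.isCell_comp (𝔽.isCell_actN _) (𝔸.isCell_whiskerLeft _ hφ)) ?_
  rw [← cancel_epi (𝔽.eAct h).hom]
  simp only [whiskerLeft_comp]
  rw [← reassoc_of% 𝔽.eAct_natural, 𝔽.eAct_actN, reassoc_of% 𝔽.eAct_actN]
  calc
    _ = (λ_ _).inv ≫ (𝟙 (u A) ◁ φ ≫ (𝔽.actUnit A).hom ▷ h') ≫ (α_ _ _ _).hom := by bicategory
    _ = _ := by rw [whisker_exchange]; bicategory

/-- By uniqueness of lifts. On the right the defining equation for `G` is used first; it produces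
the unit of the action on the middle object, which combines with `eN h` into the factorisation of
`h`, and the defining equation for `H` then applies. -/
lemma actN_comp {h : u A ⟶ u B} {g : u B ⟶ u E} (H : 𝔸.Str h) (G : 𝔸.Str g) :
    (𝔽.actN (𝔸.comp H G)).hom = (𝔽.mapComp h g).hom ▷ 𝔽.act E ≫ (α_ _ _ _).hom ≫
      𝔽.map h ◁ (𝔽.actN G).hom ≫ (α_ _ _ _).inv ≫ (𝔽.actN H).hom ▷ g ≫ (α_ _ _ _).hom := by
  refine 𝔽.hom_ext (𝔽.isCell_actN _) (𝔸.isCell_comp (𝔸.isCell_whiskerRight _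
    (𝔽.isCell_mapComp _ _)) (𝔸.isCell_comp (𝔸.isCell_associator _ _ _) (𝔸.isCell_comp
    (𝔸.isCell_whiskerLeft _ (𝔽.isCell_actN _)) (𝔸.isCell_comp (𝔸.isCell_associator_inv _ _ _)
    (𝔸.isCell_comp (𝔸.isCell_whiskerRight _ (𝔽.isCell_actN _)) (𝔸.isCell_associator _ _ _)))))) ?_
  rw [← cancel_epi (𝔽.eAct (h ≫ g)).hom, 𝔽.eAct_actN]
  simp only [whiskerLeft_comp]
  rw [reassoc_of% 𝔽.eAct_comp]
  symm
  calc
    _ = h ◁ (𝔽.eAct g).hom ⊗≫ ((𝔽.eN h).hom ▷ (𝔽.map g ≫ 𝔽.act E) ≫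
        (𝔽.e (u A) ≫ 𝔽.map h) ◁ (𝔽.actN G).hom) ⊗≫ 𝔽.e (u A) ◁ (𝔽.actN H).hom ▷ g ⊗≫ 𝟙 _ := by
      bicategory
    _ = h ◁ ((𝔽.eAct g).hom ≫ 𝔽.e (u B) ◁ (𝔽.actN G).hom) ⊗≫ (𝔽.eN h).hom ▷ (𝔽.act B ≫ g) ⊗≫
        𝔽.e (u A) ◁ (𝔽.actN H).hom ▷ g ⊗≫ 𝟙 _ := by
      rw [← whisker_exchange]; bicategory
    _ = 𝟙 _ ⊗≫ ((𝔽.eAct h).hom ≫ 𝔽.e (u A) ◁ (𝔽.actN H).hom) ▷ g ⊗≫ 𝟙 _ := by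
      rw [𝔽.eAct_actN]; simp [eAct, bicategoricalComp]
    _ = _ := by rw [𝔽.eAct_actN]; bicategory

lemma actN_id (A : O) : (𝔽.actN (𝔸.id A)).hom =
    (𝔽.mapId (u A)).hom ▷ 𝔽.act A ≫ (λ_ _).hom ≫ (ρ_ _).inv := by
  refine 𝔽.hom_ext (𝔽.isCell_actN _) (𝔸.isCell_comp (𝔸.isCell_whiskerRight _ 𝔽.isCell_mapId)
    (𝔸.isCell_comp (𝔸.isCell_leftUnitor _) (𝔸.isCell_rightUnitor_inv _))) ?_
  rw [← cancel_epi (𝔽.eAct (𝟙 (u A))).hom, 𝔽.eAct_actN]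
  symm
  calc
    _ = (ρ_ _).inv ≫ (𝟙 (u A) ◁ (𝔽.actUnit A).hom) ⊗≫ ((𝔽.eN (𝟙 (u A))).hom ≫
        𝔽.e (u A) ◁ (𝔽.mapId (u A)).hom) ▷ 𝔽.act A ⊗≫ 𝟙 _ := by simp [eAct, bicategoricalComp]
    _ = _ := by rw [𝔽.eN_id]; bicategory

/-- The right unit constraint. -/
def right (X : K) : 𝔽.map (𝔽.e X) ≫ 𝔽.act (𝔽.free X) ≅ 𝟙 (𝔽.S X) :=
  𝔽.liftIso (𝔸.comp (𝔽.mapStr (𝔽.e X)) (𝔽.actStr _)) (𝔸.id _)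
    ((𝔽.eAct (A := 𝔽.free X) (𝔽.e X)).symm ≪≫ (ρ_ _).symm)

lemma isCell_right (X : K) : 𝔸.IsCell (𝔸.comp (𝔽.mapStr (𝔽.e X)) (𝔽.actStr _)) (𝔸.id _)
    (𝔽.right X).hom := 𝔽.isCell_lift _ _ _

lemma eAct_right (X : K) :
    (𝔽.eAct (A := 𝔽.free X) (𝔽.e X)).hom ≫ 𝔽.e X ◁ (𝔽.right X).hom = (ρ_ _).inv := by
  simp [right, 𝔽.e_lift]

/-- After whiskering with the universal arrow both sides become `eN f` up to unitors: `h₁` computes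
the left one from the defining equation of `right Y`, and `h₂` shows that everything following `eN
f` on the right cancels. -/
lemma right_natural (f : X ⟶ Y) :
    𝔽.map f ◁ (𝔽.right Y).hom =
      (α_ _ _ _).inv ≫ ((𝔽.mapComp f (𝔽.e Y)).inv ≫ 𝔽.map₂ (𝔽.eN f).hom ≫
        (𝔽.mapComp (𝔽.e X) (𝔽.map f)).hom) ▷ 𝔽.act (𝔽.free Y) ≫ (α_ _ _ _).hom ≫
        𝔽.map (𝔽.e X) ◁ (𝔽.actN (𝔽.mapStr f)).hom ≫ (α_ _ _ _).inv ≫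
        (𝔽.right X).hom ▷ 𝔽.map f ≫ (λ_ _).hom ≫ (ρ_ _).inv := by
  -- Precomposing with `mapComp` gives a source `map (f ≫ e Y) ≫ act`, the form to which `eAct`
  -- applies, and removes the inverse constraint on the right.
  rw [← cancel_epi (α_ _ _ _).hom, Iso.hom_inv_id_assoc,
    ← cancel_epi ((𝔽.mapComp f (𝔽.e Y)).hom ▷ 𝔽.act (𝔽.free Y)), ← comp_whiskerRight_assoc,
    Iso.hom_inv_id_assoc]
  refine 𝔽.hom_ext (H := 𝔸.comp (𝔽.mapStr (f ≫ 𝔽.e Y)) (𝔽.actStr _))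
    (H' := 𝔸.comp (𝔽.mapStr f) (𝔸.id _))
    (𝔸.isCell_comp (𝔸.isCell_whiskerRight _ (𝔽.isCell_mapComp _ _)) (𝔸.isCell_comp
      (𝔸.isCell_associator _ _ _) (𝔸.isCell_whiskerLeft _ (𝔽.isCell_right _))))
    (𝔸.isCell_comp (𝔸.isCell_whiskerRight _ (𝔸.isCell_comp (𝔽.isCell_map₂ _)
      (𝔽.isCell_mapComp _ _))) (𝔸.isCell_comp (𝔸.isCell_associator _ _ _) (𝔸.isCell_comp
      (𝔸.isCell_whiskerLeft _ (𝔽.isCell_actN _)) (𝔸.isCell_comp (𝔸.isCell_associator_inv _ _ _)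
      (𝔸.isCell_comp (𝔸.isCell_whiskerRight _ (𝔽.isCell_right _)) (𝔸.isCell_comp
      (𝔸.isCell_leftUnitor _) (𝔸.isCell_rightUnitor_inv _))))))) ?_
  rw [← cancel_epi (𝔽.eAct (A := 𝔽.free Y) (f ≫ 𝔽.e Y)).hom]
  simp only [whiskerLeft_comp, comp_whiskerRight, Category.assoc]
  rw [← reassoc_of% 𝔽.eAct_natural, reassoc_of% 𝔽.eAct_comp, reassoc_of% 𝔽.eAct_comp]
  have h₁ : f ◁ (𝔽.eAct (A := 𝔽.free Y) (𝔽.e Y)).hom ⊗≫ (𝔽.eN f).hom ▷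
      (𝔽.map (𝔽.e Y) ≫ 𝔽.act (𝔽.free Y)) ⊗≫ 𝔽.e X ◁ 𝔽.map f ◁ (𝔽.right Y).hom =
      (𝔽.eN f).hom ⊗≫ 𝟙 _ := by
    calc
      _ = f ◁ (𝔽.eAct (A := 𝔽.free Y) (𝔽.e Y)).hom ⊗≫ ((𝔽.eN f).hom ▷
          (𝔽.map (𝔽.e Y) ≫ 𝔽.act (𝔽.free Y)) ≫ (𝔽.e X ≫ 𝔽.map f) ◁ (𝔽.right Y).hom) ⊗≫ 𝟙 _ := by
        bicategory
      _ = f ◁ ((𝔽.eAct (A := 𝔽.free Y) (𝔽.e Y)).hom ≫ 𝔽.e Y ◁ (𝔽.right Y).hom) ⊗≫ (𝔽.eN f).hom ▷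
          𝟙 _ ⊗≫ 𝟙 _ := by
        rw [← whisker_exchange]; bicategory
      _ = _ := by rw [𝔽.eAct_right]; bicategory
  have h₂ : 𝔽.e X ◁ (𝔽.eAct (A := 𝔽.free Y) (𝔽.map f)).hom ⊗≫ (𝔽.eN (𝔽.e X)).hom ▷
      (𝔽.map (𝔽.map f) ≫ 𝔽.act (𝔽.free Y)) ⊗≫ 𝔽.e X ◁ 𝔽.map (𝔽.e X) ◁
        (𝔽.actN (𝔽.mapStr f)).hom ⊗≫ 𝔽.e X ◁ (𝔽.right X).hom ▷ 𝔽.map f = 𝟙 _ ⊗≫ 𝟙 _ := by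
    calc
      _ = 𝔽.e X ◁ (𝔽.eAct (A := 𝔽.free Y) (𝔽.map f)).hom ⊗≫ ((𝔽.eN (𝔽.e X)).hom ▷
          (𝔽.map (𝔽.map f) ≫ 𝔽.act (𝔽.free Y)) ≫ (𝔽.e X ≫ 𝔽.map (𝔽.e X)) ◁
          (𝔽.actN (𝔽.mapStr f)).hom) ⊗≫ 𝔽.e X ◁ (𝔽.right X).hom ▷ 𝔽.map f ⊗≫ 𝟙 _ := by
        bicategory
      _ = 𝔽.e X ◁ ((𝔽.eAct (A := 𝔽.free Y) (𝔽.map f)).hom ≫ 𝔽.e _ ◁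
          (𝔽.actN (𝔽.mapStr f)).hom) ⊗≫ (𝔽.eN (𝔽.e X)).hom ▷
          (𝔽.act (𝔽.free X) ≫ 𝔽.map f) ⊗≫ 𝔽.e X ◁ (𝔽.right X).hom ▷ 𝔽.map f ⊗≫ 𝟙 _ := by
        rw [← whisker_exchange]; bicategory
      _ = 𝟙 _ ⊗≫ ((𝔽.eAct (A := 𝔽.free X) (𝔽.e X)).hom ≫ 𝔽.e X ◁ (𝔽.right X).hom) ▷ 𝔽.map f ⊗≫
          𝟙 _ := by
        rw [𝔽.eAct_actN]; simp [eAct, bicategoricalComp]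
      _ = _ := by rw [𝔽.eAct_right]; bicategory
  calc
    _ = (f ◁ (𝔽.eAct (A := 𝔽.free Y) (𝔽.e Y)).hom ⊗≫ (𝔽.eN f).hom ▷
      (𝔽.map (𝔽.e Y) ≫ 𝔽.act (𝔽.free Y)) ⊗≫ 𝔽.e X ◁ 𝔽.map f ◁ (𝔽.right Y).hom) ⊗≫ 𝟙 _ := by
      bicategory
    _ = (𝔽.eN f).hom ⊗≫ (𝔽.e X ◁ (𝔽.eAct (A := 𝔽.free Y) (𝔽.map f)).hom ⊗≫ (𝔽.eN (𝔽.e X)).hom ▷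
      (𝔽.map (𝔽.map f) ≫ 𝔽.act (𝔽.free Y)) ⊗≫ 𝔽.e X ◁ 𝔽.map (𝔽.e X) ◁
        (𝔽.actN (𝔽.mapStr f)).hom ⊗≫ 𝔽.e X ◁ (𝔽.right X).hom ▷ 𝔽.map f) ⊗≫ 𝟙 _ := by
      rw [h₁, h₂]; bicategory
    _ = _ := by bicategory

/-- With `mapId` moved across, both sides restrict to the unit of the action along the universal
arrow: one by the defining equations of `actN` and `right`, the other by `eN_id`. -/
lemma unit_assoc (X : K) :
    ((𝔽.mapId (𝔽.S X)).inv ≫ 𝔽.map₂ (𝔽.actUnit (𝔽.free X)).hom ≫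
        (𝔽.mapComp (𝔽.e (𝔽.S X)) (𝔽.act (𝔽.free X))).hom) ▷ 𝔽.act (𝔽.free X) ≫
        (α_ _ _ _).hom ≫ 𝔽.map (𝔽.e (𝔽.S X)) ◁ (𝔽.actN (𝔽.actStr (𝔽.free X))).hom ≫
        (α_ _ _ _).inv ≫ (𝔽.right (𝔽.S X)).hom ▷ 𝔽.act (𝔽.free X) =
      𝟙 (𝟙 (𝔽.S (𝔽.S X)) ≫ 𝔽.act (𝔽.free X)) := by
  rw [← cancel_epi ((𝔽.mapId (𝔽.S X)).hom ▷ 𝔽.act (𝔽.free X)), ← comp_whiskerRight_assoc,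
    Iso.hom_inv_id_assoc, Category.comp_id, comp_whiskerRight, Category.assoc]
  refine 𝔽.hom_ext (H := 𝔸.comp (𝔽.mapStr (𝟙 (𝔽.S X))) (𝔽.actStr _))
    (H' := 𝔸.comp (𝔸.id _) (𝔽.actStr _))
    (𝔸.isCell_comp (𝔸.isCell_whiskerRight _ (𝔽.isCell_map₂ _)) (𝔸.isCell_comp
      (𝔸.isCell_whiskerRight _ (𝔽.isCell_mapComp _ _)) (𝔸.isCell_comp
      (𝔸.isCell_associator _ _ _) (𝔸.isCell_comp
      (𝔸.isCell_whiskerLeft _ (𝔽.isCell_actN _)) (𝔸.isCell_comp (𝔸.isCell_associator_inv _ _ _)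
      (𝔸.isCell_whiskerRight _ (𝔽.isCell_right _)))))))
    (𝔸.isCell_whiskerRight _ 𝔽.isCell_mapId) ?_
  rw [← cancel_epi (𝔽.eAct (A := 𝔽.free X) (𝟙 (𝔽.S X))).hom]
  simp only [whiskerLeft_comp]
  rw [← reassoc_of% 𝔽.eAct_natural, reassoc_of% 𝔽.eAct_comp]
  have h : (𝔽.eAct (A := 𝔽.free X) (𝟙 (𝔽.S X))).hom ≫
      𝔽.e (𝔽.S X) ◁ (𝔽.mapId (𝔽.S X)).hom ▷ 𝔽.act (𝔽.free X) =
      (𝔽.actUnit (𝔽.free X)).hom ⊗≫ 𝟙 _ := by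
    calc
      _ = (ρ_ _).inv ≫ (𝟙 _ ◁ (𝔽.actUnit (𝔽.free X)).hom) ⊗≫ ((𝔽.eN (𝟙 _)).hom ≫
        𝔽.e _ ◁ (𝔽.mapId (𝔽.S X)).hom) ▷ 𝔽.act (𝔽.free X) ⊗≫ 𝟙 _ := by
        simp [eAct, bicategoricalComp]
      _ = _ := by rw [𝔽.eN_id]; bicategory
  rw [h]
  calc
    _ = (𝔽.actUnit (𝔽.free X)).hom ≫ 𝔽.e (𝔽.S X) ◁ (𝔽.eAct (A := 𝔽.free X) (𝔽.act _)).hom ⊗≫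
        ((𝔽.eN (𝔽.e (𝔽.S X))).hom ▷ (𝔽.map (𝔽.act _) ≫ 𝔽.act _) ≫
        (𝔽.e (𝔽.S X) ≫ 𝔽.map (𝔽.e (𝔽.S X))) ◁ (𝔽.actN (𝔽.actStr (𝔽.free X))).hom) ⊗≫
        𝔽.e (𝔽.S X) ◁ (𝔽.right (𝔽.S X)).hom ▷ 𝔽.act (𝔽.free X) := by
      bicategory
    _ = (𝔽.actUnit (𝔽.free X)).hom ≫ 𝔽.e (𝔽.S X) ◁ ((𝔽.eAct (A := 𝔽.free X) (𝔽.act _)).hom ≫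
        𝔽.e _ ◁ (𝔽.actN (𝔽.actStr (𝔽.free X))).hom) ⊗≫ (𝔽.eN (𝔽.e (𝔽.S X))).hom ▷
        (𝔽.act (𝔽.free (𝔽.S X)) ≫ 𝔽.act (𝔽.free X)) ⊗≫
        𝔽.e (𝔽.S X) ◁ (𝔽.right (𝔽.S X)).hom ▷ 𝔽.act (𝔽.free X) := by
      rw [← whisker_exchange]; bicategory
    _ = (𝔽.actUnit (𝔽.free X)).hom ⊗≫ ((𝔽.eAct (A := 𝔽.free (𝔽.S X)) (𝔽.e _)).hom ≫
        𝔽.e _ ◁ (𝔽.right _).hom) ▷ 𝔽.act (𝔽.free X) ⊗≫ 𝟙 _ := by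
      rw [𝔽.eAct_actN]; simp [eAct, bicategoricalComp]
    _ = _ := by rw [𝔽.eAct_right]; bicategory

/-- The action is compatible with structured squares. -/
lemma actN_sq {A B E V : O} {h : u A ⟶ u B} {g : u B ⟶ u V} {h' : u A ⟶ u E} {g' : u E ⟶ u V}
    {H : 𝔸.Str h} {G : 𝔸.Str g} {H' : 𝔸.Str h'} {G' : 𝔸.Str g'} (θ : h ≫ g ⟶ h' ≫ g')
    (hθ : 𝔸.IsCell (𝔸.comp H G) (𝔸.comp H' G') θ) :
    ((𝔽.mapComp h g).inv ≫ 𝔽.map₂ θ ≫ (𝔽.mapComp h' g').hom) ▷ 𝔽.act V ≫ (α_ _ _ _).hom ≫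
        𝔽.map h' ◁ (𝔽.actN G').hom ≫ (α_ _ _ _).inv ≫ (𝔽.actN H').hom ▷ g' ≫ (α_ _ _ _).hom =
      (α_ _ _ _).hom ≫ 𝔽.map h ◁ (𝔽.actN G).hom ≫ (α_ _ _ _).inv ≫
        (𝔽.actN H).hom ▷ g ≫ (α_ _ _ _).hom ≫ 𝔽.act A ◁ θ := by
  -- Naturality of the action at `θ`, with the cells of both composites split by `actN_comp`, is
  -- already the claim up to the invertible `mapComp`.
  have h := 𝔽.actN_natural hθ
  rw [𝔽.actN_comp, 𝔽.actN_comp] at h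
  rw [← cancel_epi ((𝔽.mapComp _ _).hom ▷ 𝔽.act V)]
  simpa using h

lemma left_natural (f : X ⟶ Y) :
    𝔽.map f ◁ (𝔽.actUnit (𝔽.free Y)).hom ≫ (α_ _ _ _).inv ≫
        (𝔽.eN (𝔽.map f)).hom ▷ 𝔽.act (𝔽.free Y) ≫ (α_ _ _ _).hom ≫
        𝔽.e (𝔽.S X) ◁ (𝔽.actN (𝔽.mapStr f)).hom =
      (ρ_ _).hom ≫ (λ_ _).inv ≫ (𝔽.actUnit (𝔽.free X)).hom ▷ 𝔽.map f ≫ (α_ _ _ _).hom := by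
  rw [← 𝔽.eAct_actN (𝔽.mapStr f)]
  simp [eAct]

end

/-- The data of the pseudomonad of free objects. -/
def pseudomonadData : PseudomonadData K where
  fn := 𝔽.fn
  mulTrans :=
    { app := fun X => 𝔽.act (𝔽.free X)
      naturality := fun f => 𝔽.actN (𝔽.mapStr f)
      naturality_naturality := fun φ => 𝔽.actN_natural (𝔽.isCell_map₂ φ)
      -- The identity and composition laws are naturality of the action at the structured cells
      -- `mapId` and `mapComp`.
      naturality_id := fun X => by
        have h := 𝔽.actN_natural (𝔽.isCell_mapId (X := X))
        rw [actN_id, ← comp_whiskerRight_assoc] at h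
        exact h.symm
      naturality_comp := fun f g => by
        have h := 𝔽.actN_natural (𝔽.isCell_mapComp f g)
        rw [actN_comp, ← comp_whiskerRight_assoc] at h
        exact h.symm }
  unitTrans :=
    { app := fun X => 𝔽.e X
      naturality := fun f => 𝔽.eN f
      naturality_naturality := fun φ => 𝔽.eN_natural φ
      naturality_id := fun X => by
        refine 𝔽.eN_id.trans ?_
        exact (Category.id_comp _).symm.trans
          (congrArg (· ≫ (λ_ (𝔽.e X)).hom ≫ (ρ_ (𝔽.e X)).inv) (id_whiskerRight (𝟙 X) (𝔽.e X)).symm)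
      naturality_comp := fun f g => by
        refine (𝔽.eN_comp f g).trans ?_
        exact (Category.id_comp _).symm.trans
          (congrArg (· ≫ _) (id_whiskerRight (f ≫ g) (𝔽.e _)).symm) }

/-- The constraint cells of the pseudomonad of free objects. -/
def cells : 𝔽.pseudomonadData.Cells where
  assoc X := 𝔽.actN (𝔽.actStr (𝔽.free X))
  left X := 𝔽.actUnit (𝔽.free X)
  right X := 𝔽.right X

/-- The naturality of the associativity constraint and its own coherence law are the same fact,
`actN_sq`, applied to the square `actN` at `map f` and at the action on a free object. -/
lemma coherence : 𝔽.pseudomonadData.Coherence 𝔽.cells where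
  assoc_natural f := bicategoricalComp_square₁ (𝔽.actN_sq _ (𝔽.isCell_actN (𝔽.mapStr f)))
  left_natural f := bicategoricalComp_left (𝔽.left_natural f)
  right_natural f := bicategoricalComp_right (𝔽.right_natural f)
  assoc_assoc X := bicategoricalComp_square₂ (𝔽.actN_sq _ (𝔽.isCell_actN (𝔽.actStr (𝔽.free X))))
  unit_assoc X := bicategoricalComp_unit (𝔽.unit_assoc X)

/-- The pseudomonad of free objects. -/
def pseudomonad : Pseudomonad K where
  toPseudomonadData := 𝔽.pseudomonadData
  cells := 𝔽.cells
  coherence := 𝔽.coherence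

end FreeObjects

/-! ### Pseudoalgebras: the redundant unit axiom and the calculus of algebra 2-cells -/

lemma CategoryTheory.Pseudofunctor.map₂_lunit_inv {B : Type u₁} [Bicategory.{w₁, v₁} B]
    {B' : Type u₂}
    [Bicategory.{w₂, v₂} B'] (F : B ⥤ᵖ B') {a b : B} (f : a ⟶ b) :
    F.map₂ (λ_ f).inv = (λ_ _).inv ≫ (F.mapId a).inv ▷ F.map f ≫ (F.mapComp (𝟙 a) f).inv := by
  rw [← cancel_epi (F.map₂ (λ_ f).hom), ← PrelaxFunctor.map₂_comp]
  simp

namespace Pseudomonad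

variable {B : Type u₁} [Bicategory.{w₁, v₁} B] {S : Pseudomonad B}

/-- The isomorphism of `f` with `S.e X ≫ S.map f ≫ a.str` is natural in `f`, so a 2-cell can be
recovered from its image under `S` whiskered with `a.str`. -/
lemma Alg.whiskerRight_str_injective {X A : B} (a : S.Alg A) {f g : X ⟶ A} {φ ψ : f ⟶ g}
    (h : S.fn.map₂ φ ▷ a.str = S.fn.map₂ ψ ▷ a.str) : φ = ψ := by
  have key (χ : f ⟶ g) : χ ≫ (ρ_ g).inv ≫ g ◁ a.unit.hom ⊗≫ (S.eNat g).hom ▷ a.str ≫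
      (α_ _ _ _).hom =
      (ρ_ f).inv ≫ f ◁ a.unit.hom ⊗≫ (S.eNat f).hom ▷ a.str ≫ (α_ _ _ _).hom ≫
        S.e X ◁ (S.fn.map₂ χ ▷ a.str) := by
    symm
    calc
      _ = (ρ_ f).inv ≫ f ◁ a.unit.hom ⊗≫ ((S.eNat f).hom ≫ S.e X ◁ S.fn.map₂ χ) ▷ a.str ≫
          (α_ _ _ _).hom := by bicategory
      _ = (ρ_ f).inv ≫ (f ◁ a.unit.hom ≫ χ ▷ _) ⊗≫ (S.eNat g).hom ▷ a.str ≫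
          (α_ _ _ _).hom := by rw [← S.eNat_natural]; bicategory
      _ = _ := by rw [whisker_exchange]; bicategory
  have h' := (key φ).trans ((congrArg _ (by rw [h])).trans (key ψ).symm)
  rw [← cancel_mono ((ρ_ g).inv ≫ g ◁ a.unit.hom ≫ (α_ _ _ _).inv ≫ (S.eNat g).hom ▷ a.str ≫
    (α_ _ _ _).hom)]
  simpa [bicategoricalComp] using h'

/-- This is the second unit axiom after applying `S` and whiskering with `a.str`. The argument is
the one by which redundant unit laws are derived in a monoidal category: an invertible pasting of
associativity and right unit constraints is composed onto both sides. The associativity axiom,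
naturality of the right unit and the unit axioms of `a` and of `S` then reduce both sides to
`a.assoc`. -/
lemma Alg.map_unit_str {A : B} (a : S.Alg A) :
    (ρ_ _).inv ▷ a.str ≫ (S.map a.str ◁ (S.fn.mapTriId a.unit.symm).inv) ▷ a.str ⊗≫
      (S.fn.mapSq (S.eNat a.str)).hom ▷ (S.map a.str ≫ a.str) ⊗≫
      S.map (S.e (S.obj A)) ◁ (S.fn.mapSq a.assoc).hom ▷ a.str ⊗≫
      𝟙 ((S.map (S.e (S.obj A)) ≫ S.map (S.m A)) ≫ S.map a.str ≫ a.str) =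
    (λ_ _).inv ≫ (S.fn.mapTriId (S.cells.left A).symm).inv ▷ (S.map a.str ≫ a.str) := by
  have h₁ := S.coherence.unit_assoc A
  have h₂ := a.assoc_assoc
  have h₃ := S.coherence.right_natural a.str
  have h₄ := a.unit_assoc
  rw [← cancel_mono ((α_ _ _ _).hom ≫ S.map (S.e (S.obj A)) ◁ (S.map (S.m A) ◁ a.assoc.hom ≫
    (α_ _ _ _).inv ≫ (S.cells.assoc A).hom ▷ a.str ≫ (α_ _ _ _).hom) ≫ (α_ _ _ _).inv ≫
    (S.cells.right (S.obj A)).hom ▷ (S.m A ≫ a.str))]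
  calc
    _ = 𝟙 _ ⊗≫ S.map a.str ◁ (S.fn.mapTriId a.unit.symm).inv ▷ a.str ⊗≫
        (S.fn.mapSq (S.eNat a.str)).hom ▷ (S.map a.str ≫ a.str) ⊗≫
        S.map (S.e (S.obj A)) ◁ ((S.fn.mapSq a.assoc).hom ▷ a.str ⊗≫
          S.map (S.m A) ◁ a.assoc.hom ⊗≫ (S.cells.assoc A).hom ▷ a.str ≫ (α_ _ _ _).hom) ⊗≫
        (S.cells.right (S.obj A)).hom ▷ (S.m A ≫ a.str) := by bicategory
    _ = 𝟙 _ ⊗≫ S.map a.str ◁ (S.fn.mapTriId a.unit.symm).inv ▷ a.str ⊗≫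
        ((S.fn.mapSq (S.eNat a.str)).hom ▷ (S.map a.str ≫ a.str) ≫
        (S.map (S.e (S.obj A)) ≫ S.map (S.map a.str)) ◁ a.assoc.hom) ⊗≫
        S.map (S.e (S.obj A)) ◁ (S.mNat a.str).hom ▷ a.str ⊗≫
        ((S.map (S.e (S.obj A)) ≫ S.m (S.obj A)) ◁ a.assoc.hom ≫
        (S.cells.right (S.obj A)).hom ▷ (S.m A ≫ a.str)) := by rw [h₂]; bicategory
    _ = 𝟙 _ ⊗≫ S.map a.str ◁ ((S.fn.mapTriId a.unit.symm).inv ▷ a.str ⊗≫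
        S.map (S.e A) ◁ a.assoc.hom) ⊗≫ ((α_ _ _ _).inv ≫ (S.fn.mapSq (S.eNat a.str)).hom ▷ S.m A ⊗≫
        S.map (S.e (S.obj A)) ◁ (S.mNat a.str).hom ⊗≫
        (S.cells.right (S.obj A)).hom ▷ S.map a.str ≫ (λ_ _).hom ≫ (ρ_ _).inv) ▷ a.str ⊗≫
        a.assoc.hom ⊗≫ 𝟙 _ := by
      rw [← whisker_exchange, whisker_exchange (S.cells.right (S.obj A)).hom a.assoc.hom]
      bicategory
    _ = 𝟙 _ ⊗≫ S.map a.str ◁ ((S.fn.mapTriId a.unit.symm).inv ▷ a.str ⊗≫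
        S.map (S.e A) ◁ a.assoc.hom ⊗≫ (S.cells.right A).hom ▷ a.str) ⊗≫
        a.assoc.hom ⊗≫ 𝟙 _ := by rw [h₃]; bicategory
    _ = 𝟙 _ ⊗≫ 𝟙 _ ◁ a.assoc.hom ⊗≫ 𝟙 _ := by rw [h₄]; bicategory
    _ = 𝟙 _ ⊗≫ 𝟙 _ ◁ a.assoc.hom ⊗≫ ((S.fn.mapTriId (S.cells.left A).symm).inv ▷ S.m A ⊗≫
        S.map (S.e (S.obj A)) ◁ (S.cells.assoc A).hom ⊗≫
        (S.cells.right (S.obj A)).hom ▷ S.m A) ▷ a.str ⊗≫ 𝟙 _ := by rw [h₁]; bicategory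
    _ = 𝟙 _ ⊗≫ (𝟙 _ ◁ a.assoc.hom ≫ (S.fn.mapTriId (S.cells.left A).symm).inv ▷ (S.m A ≫ a.str)) ⊗≫
        S.map (S.e (S.obj A)) ◁ (S.cells.assoc A).hom ▷ a.str ⊗≫
        (S.cells.right (S.obj A)).hom ▷ (S.m A ≫ a.str) ⊗≫ 𝟙 _ := by bicategory
    _ = _ := by rw [whisker_exchange]; bicategory

/-- The second unit axiom of a pseudoalgebra, which follows from the other axioms. -/
lemma Alg.str_unit {A : B} (a : S.Alg A) :
    a.str ◁ a.unit.hom ⊗≫ (S.eNat a.str).hom ▷ a.str ⊗≫ S.e (S.obj A) ◁ a.assoc.hom =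
      (ρ_ _).hom ≫ (λ_ _).inv ≫ (S.cells.left A).hom ▷ a.str ≫ (α_ _ _ _).hom := by
  have h := a.map_unit_str
  -- It suffices to compare images under `S` whiskered with `a.str`; `h` is that comparison once the
  -- constraints of the pseudofunctor are gathered.
  apply a.whiskerRight_str_injective
  have h' := congrArg (fun ξ => S.fn.map₂ (ρ_ a.str).hom ▷ a.str ≫ ξ ≫ (α_ _ _ _).inv ≫
    ((α_ _ _ _).hom ≫ S.map (S.e (S.obj A)) ◁ (S.fn.mapComp (S.m A) a.str).inv ≫
      (S.fn.mapComp _ _).inv) ▷ a.str) h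
  simp [bicategoricalComp] at h'
  simpa [bicategoricalComp, Pseudofunctor.map₂_assoc_inv, Pseudofunctor.map₂_lunit_inv] using h'

variable (S) in
/-- The free pseudoalgebra on `X`. -/
def freeAlg (X : B) : S.Alg (S.obj X) where
  str := S.m X
  assoc := S.cells.assoc X
  unit := S.cells.left X
  assoc_assoc := S.coherence.assoc_assoc X
  unit_assoc := S.coherence.unit_assoc X

variable (S) in
/-- The pseudomorphism of free pseudoalgebras given by `S f`. -/
def freeMor {X Y : B} (f : X ⟶ Y) : MorStr (S.freeAlg X) (S.freeAlg Y) (S.map f) where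
  cell := S.mNat f
  cell_assoc := (S.coherence.assoc_natural f).symm
  cell_unit := S.coherence.left_natural f

/-- The structure map of a pseudoalgebra is a pseudomorphism from the free pseudoalgebra. -/
def Alg.strMor {A : B} (a : S.Alg A) : MorStr (S.freeAlg A) a a.str where
  cell := a.assoc
  cell_assoc := by
    have h := a.assoc_assoc
    rw [← cancel_epi (α_ _ _ _).hom]
    exact h.symm.trans (Iso.hom_inv_id_assoc _ _).symm
  cell_unit := a.str_unit

section AlgCell

variable {A A' A'' A''' : B} {a : S.Alg A} {a' : S.Alg A'} {a'' : S.Alg A''} {a''' : S.Alg A'''}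

lemma isAlgCell_id {f : A ⟶ A'} (F : MorStr a a' f) : IsAlgCell F F (𝟙 f) := by
  simp [IsAlgCell]

lemma IsAlgCell.comp {f g h : A ⟶ A'} {F : MorStr a a' f} {G : MorStr a a' g}
    {H : MorStr a a' h} {φ : f ⟶ g} {ψ : g ⟶ h} (hφ : IsAlgCell F G φ) (hψ : IsAlgCell G H ψ) :
    IsAlgCell F H (φ ≫ ψ) := by
  unfold IsAlgCell at *
  rw [PrelaxFunctor.map₂_comp, comp_whiskerRight_assoc, hψ, reassoc_of% hφ, whiskerLeft_comp]

lemma IsAlgCell.inv {f g : A ⟶ A'} {F : MorStr a a' f} {G : MorStr a a' g} {φ : f ≅ g}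
    (hφ : IsAlgCell F G φ.hom) : IsAlgCell G F φ.inv := by
  unfold IsAlgCell at *
  rw [← cancel_epi (S.fn.map₂ φ.hom ▷ a'.str), reassoc_of% hφ, ← comp_whiskerRight_assoc,
    PrelaxFunctor.map₂_hom_inv, ← whiskerLeft_comp]
  simp

lemma IsAlgCell.whiskerLeft {f : A ⟶ A'} (F : MorStr a a' f) {g h : A' ⟶ A''}
    {G : MorStr a' a'' g} {H : MorStr a' a'' h} {φ : g ⟶ h} (hφ : IsAlgCell G H φ) :
    IsAlgCell (F.comp G) (F.comp H) (f ◁ φ) := by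
  unfold IsAlgCell at *
  calc
    _ = (S.fn.mapComp f g).hom ▷ a''.str ⊗≫ S.map f ◁ (S.fn.map₂ φ ▷ a''.str ≫ H.cell.hom) ⊗≫
        F.cell.hom ▷ h ⊗≫ 𝟙 _ := by simp [MorStr.comp, bicategoricalComp]
    _ = (S.fn.mapComp f g).hom ▷ a''.str ⊗≫ S.map f ◁ G.cell.hom ⊗≫
        ((S.map f ≫ a'.str) ◁ φ ≫ F.cell.hom ▷ h) ⊗≫ 𝟙 _ := by rw [hφ]; bicategory
    _ = _ := by rw [whisker_exchange]; simp [MorStr.comp, bicategoricalComp]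

lemma IsAlgCell.whiskerRight {f g : A ⟶ A'} {F : MorStr a a' f} {G : MorStr a a' g} {φ : f ⟶ g}
    {h : A' ⟶ A''} (H : MorStr a' a'' h) (hφ : IsAlgCell F G φ) :
    IsAlgCell (F.comp H) (G.comp H) (φ ▷ h) := by
  unfold IsAlgCell at *
  calc
    _ = (S.fn.mapComp f h).hom ▷ a''.str ⊗≫ (S.fn.map₂ φ ▷ (S.map h ≫ a''.str) ≫
        S.map g ◁ H.cell.hom) ⊗≫ G.cell.hom ▷ h ⊗≫ 𝟙 _ := by simp [MorStr.comp, bicategoricalComp]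
    _ = (S.fn.mapComp f h).hom ▷ a''.str ⊗≫ S.map f ◁ H.cell.hom ⊗≫
        (S.fn.map₂ φ ▷ a'.str ≫ G.cell.hom) ▷ h ⊗≫ 𝟙 _ := by rw [← whisker_exchange]; bicategory
    _ = _ := by rw [hφ]; simp [MorStr.comp, bicategoricalComp]

lemma isAlgCell_associator {f : A ⟶ A'} {g : A' ⟶ A''} {h : A'' ⟶ A'''} (F : MorStr a a' f)
    (G : MorStr a' a'' g) (H : MorStr a'' a''' h) :
    IsAlgCell ((F.comp G).comp H) (F.comp (G.comp H)) (α_ f g h).hom := by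
  unfold IsAlgCell
  symm
  calc
    _ = (S.fn.mapComp (f ≫ g) h).hom ▷ a'''.str ⊗≫ ((S.map (f ≫ g) ◁ H.cell.hom) ≫
        (S.fn.mapComp f g).hom ▷ (a''.str ≫ h)) ⊗≫ S.map f ◁ G.cell.hom ▷ h ⊗≫
        F.cell.hom ▷ g ▷ h ⊗≫ 𝟙 _ := by simp [MorStr.comp, bicategoricalComp]
    _ = _ := by rw [whisker_exchange]; simp [MorStr.comp, bicategoricalComp]

lemma isAlgCell_leftUnitor {f : A ⟶ A'} (F : MorStr a a' f) :
    IsAlgCell ((MorStr.id a).comp F) F (λ_ f).hom := by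
  unfold IsAlgCell
  symm
  calc
    _ = (S.fn.mapComp (𝟙 A) f).hom ▷ a'.str ⊗≫ ((S.map (𝟙 A) ◁ F.cell.hom) ≫
        (S.fn.mapId A).hom ▷ (a.str ≫ f)) ⊗≫ 𝟙 _ := by
      simp [MorStr.comp, MorStr.id, bicategoricalComp]
    _ = _ := by rw [whisker_exchange]; simp [bicategoricalComp]

lemma isAlgCell_rightUnitor {f : A ⟶ A'} (F : MorStr a a' f) :
    IsAlgCell (F.comp (MorStr.id a')) F (ρ_ f).hom := by
  unfold IsAlgCell
  simp [MorStr.comp, MorStr.id]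

/-- The associativity axiom of a pseudomorphism, read as a condition on a 2-cell between composites
of pseudomorphisms. In this form the structure cell can be fed to the closure rules above. -/
lemma isAlgCell_cell {f : A ⟶ A'} (F : MorStr a a' f) :
    IsAlgCell ((S.freeMor f).comp a'.strMor) (a.strMor.comp F) F.cell.hom := by
  have h := F.cell_assoc
  unfold IsAlgCell
  rw [← cancel_epi ((S.fn.mapComp _ _).inv ▷ a'.str), ← cancel_epi (α_ _ _ _).inv]
  simp [bicategoricalComp] at h
  simp [MorStr.comp, freeMor, Alg.strMor]
  exact h.symm

end AlgCell

/-- Between free pseudoalgebras, the condition on an algebra 2-cell is a pseudonaturality law of the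
multiplication: at 2-cells here, at composites and identities in the next two lemmas. -/
lemma isAlgCell_map₂ {X Y : B} {f g : X ⟶ Y} (φ : f ⟶ g) :
    IsAlgCell (S.freeMor f) (S.freeMor g) (S.fn.map₂ φ) := S.mNat_natural φ

lemma isAlgCell_mapComp {X Y Z : B} (f : X ⟶ Y) (g : Y ⟶ Z) :
    IsAlgCell (S.freeMor (f ≫ g)) ((S.freeMor f).comp (S.freeMor g)) (S.fn.mapComp f g).hom := by
  refine Eq.trans ?_ (S.mNat_comp f g).symm
  simp [MorStr.comp, freeMor, freeAlg]

lemma isAlgCell_mapId (X : B) :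
    IsAlgCell (S.freeMor (𝟙 X)) (MorStr.id (S.freeAlg X)) (S.fn.mapId X).hom := by
  refine Eq.trans ?_ (S.mNat_id X).symm
  simp [MorStr.id, freeAlg]

end Pseudomonad

/-! ### Unit constraints of a 2-monad -/

namespace TwoMonad

open Pseudomonad

variable {B : Type u₁} [Bicategory.{w₁, v₁} B] [Bicategory.Strict B] (S : TwoMonad B)

/-- For a 2-monad all the cells involved are identities, so both sides are composites of `eqToHom`.
Together with `e_right` this is what the freeness of `S X` takes from strictness. -/
lemma isAlgCell_right (X : B) :
    IsAlgCell ((S.freeMor (S.e X)).comp (S.freeAlg X).strMor) (MorStr.id (S.freeAlg X))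
      (S.cells.right X).hom := by
  obtain ⟨_, h₁⟩ := S.right_eq X
  obtain ⟨_, h₂⟩ := S.assoc_eq X
  obtain ⟨_, h₃⟩ := S.mNat_eq (S.e X)
  obtain ⟨_, h₄⟩ := S.mapId_eq (S.obj X)
  obtain ⟨_, h₅⟩ := S.mapComp_eq (S.map (S.e X)) (S.m X)
  simp [IsAlgCell, MorStr.comp, MorStr.id, freeMor, freeAlg, Alg.strMor, h₁, h₂, h₃, h₄, h₅,
    Strict.associator_eqToIso, Strict.leftUnitor_eqToIso, Strict.rightUnitor_eqToIso,
    PrelaxFunctor.map₂_eqToHom]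

lemma e_right (X : B) :
    S.e X ◁ (S.cells.left X).hom ≫ (α_ _ _ _).inv ≫ (S.eNat (S.e X)).hom ▷ S.m X ≫
      (α_ _ _ _).hom ≫ S.e X ◁ (S.cells.right X).hom = 𝟙 _ := by
  obtain ⟨_, h₁⟩ := S.right_eq X
  obtain ⟨_, h₂⟩ := S.left_eq X
  obtain ⟨_, h₃⟩ := S.eNat_eq (S.e X)
  simp [h₁, h₂, h₃, Strict.associator_eqToIso]

end TwoMonad

/-! ### Cancelling equivalences from 2-cells -/

section Equivalence

variable {B : Type u₁} [Bicategory.{w₁, v₁} B] {a b c : B}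

namespace CategoryTheory.Bicategory

/-- Precomposition with an equivalence is an equivalence of hom-categories. -/
lemma Equivalence.isEquivalence_precomp (e : Equivalence a b) (c : B) :
    (precomp c e.hom).IsEquivalence :=
  (CategoryTheory.Equivalence.mk (precomp c e.hom) (precomp c e.inv)
    (NatIso.ofComponents (fun f => (λ_ f).symm ≪≫ whiskerRightIso e.counit.symm f ≪≫ α_ _ _ _)
      (fun φ => by
        have h := whisker_exchange e.counit.inv φ
        simp [precomp]
        rw [← associator_naturality_right, ← reassoc_of% h]
        simp))
    (NatIso.ofComponents (fun f => (α_ _ _ _).symm ≪≫ whiskerRightIso e.unit.symm f ≪≫ λ_ f)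
      (fun φ => by
        have h := whisker_exchange e.unit.inv φ
        simp [precomp]
        rw [associator_inv_naturality_right_assoc, reassoc_of% h]
        simp))).isEquivalence_functor

/-- A morphism that underlies an equivalence. -/
def IsEquivalence (f : a ⟶ b) : Prop := ∃ e : Bicategory.Equivalence a b, e.hom = f

namespace IsEquivalence

lemma whiskerLeft_injective {e : a ⟶ b} (he : IsEquivalence e) {f g : b ⟶ c} {φ ψ : f ⟶ g}
    (h : e ◁ φ = e ◁ ψ) : φ = ψ := by
  obtain ⟨e, rfl⟩ := he
  have := e.isEquivalence_precomp c
  exact (precomp c e.hom).map_injective h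

lemma exists_whiskerLeftIso {e : a ⟶ b} (he : IsEquivalence e) {f g : b ⟶ c} (φ : e ≫ f ≅ e ≫ g) :
    ∃ ψ : f ≅ g, whiskerLeftIso e ψ = φ := by
  obtain ⟨e, rfl⟩ := he
  have := e.isEquivalence_precomp c
  exact ⟨(precomp c e.hom).preimageIso φ, Iso.ext ((precomp c e.hom).map_preimage φ.hom)⟩

lemma exists_whiskerLeft {e : a ⟶ b} (he : IsEquivalence e) {f g : b ⟶ c} (φ : e ≫ f ⟶ e ≫ g) :
    ∃ ψ : f ⟶ g, e ◁ ψ = φ := by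
  obtain ⟨e, rfl⟩ := he
  have := e.isEquivalence_precomp c
  exact ⟨(precomp c e.hom).preimage φ, (precomp c e.hom).map_preimage φ⟩

lemma exists_iso {e : a ⟶ b} (he : IsEquivalence e) (f : a ⟶ c) :
    ∃ g : b ⟶ c, Nonempty (f ≅ e ≫ g) := by
  obtain ⟨e, rfl⟩ := he
  exact ⟨e.inv ≫ f, ⟨(λ_ f).symm ≪≫ whiskerRightIso e.unit f ≪≫ α_ _ _ _⟩⟩

/-- Pseudofunctors preserve equivalences. -/
lemma map {B' : Type u₂} [Bicategory.{w₂, v₂} B'] (F : B ⥤ᵖ B') {e : a ⟶ b}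
    (he : IsEquivalence e) : IsEquivalence (F.map e) := by
  obtain ⟨e, rfl⟩ := he
  -- Only invertible unit and counit cells are transported. The counit is then corrected to satisfy
  -- the triangle identity, so that identity need not be checked for the image.
  exact ⟨Equivalence.mkOfAdjointifyCounit ((F.mapTriId e.unit.symm).symm)
      (F.mapTriId e.counit), rfl⟩

end IsEquivalence

end CategoryTheory.Bicategory

end Equivalence

/-! ### Transport and descent of pseudomorphism structures -/

namespace Pseudomonad

variable {B : Type u₁} [Bicategory.{w₁, v₁} B] {S : Pseudomonad B} {A A' A'' : B}
  {a : S.Alg A} {a' : S.Alg A'} {a'' : S.Alg A''}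

/-- Transport of a pseudomorphism structure along an invertible 2-cell. -/
def MorStr.ofIso {f g : A ⟶ A'} (F : MorStr a a' f) (φ : f ≅ g) : MorStr a a' g where
  cell := whiskerRightIso (S.fn.map₂Iso φ.symm) a'.str ≪≫ F.cell ≪≫ whiskerLeftIso a.str φ
  cell_assoc := by
    have h₀ : (S.fn.mapSq (whiskerRightIso (S.fn.map₂Iso φ.symm) a'.str ≪≫ F.cell ≪≫
        whiskerLeftIso a.str φ)).hom = S.fn.map₂ (S.fn.map₂ φ.inv) ▷ S.map a'.str ≫
          (S.fn.mapSq F.cell).hom ≫ S.map a.str ◁ S.fn.map₂ φ.hom := by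
      simp only [Pseudofunctor.mapSq_hom, Iso.trans_hom, whiskerRightIso_hom, whiskerLeftIso_hom,
        Functor.mapIso_hom, PrelaxFunctor.mapFunctor_map, Iso.symm_hom]
      simp
    have h₁ : S.fn.map₂ (S.fn.map₂ φ.hom) ≫ S.fn.map₂ (S.fn.map₂ φ.inv) = 𝟙 _ := by
      simp [← PrelaxFunctor.map₂_comp]
    have h₂ : S.fn.map₂ φ.hom ≫ S.fn.map₂ φ.inv = 𝟙 _ := by simp [← PrelaxFunctor.map₂_comp]
    -- Precomposing with the invertible `S (S φ)` moves the source from `g` back to `f`, where the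
    -- axiom of `F` applies; each image of `φ` then meets its inverse.
    rw [← cancel_epi (S.fn.map₂ (S.fn.map₂ φ.hom) ▷ (S.map a'.str ≫ a'.str)), h₀]
    simp only [Iso.trans_hom, whiskerRightIso_hom, whiskerLeftIso_hom, Functor.mapIso_hom,
      PrelaxFunctor.mapFunctor_map, Iso.symm_hom]
    calc
      _ = (S.fn.map₂ (S.fn.map₂ φ.hom) ▷ (S.map a'.str ≫ a'.str) ≫
          S.map (S.map g) ◁ a'.assoc.hom) ⊗≫
          (S.mNat g).hom ▷ a'.str ⊗≫ S.m A ◁ S.fn.map₂ φ.inv ▷ a'.str ⊗≫ S.m A ◁ F.cell.hom ⊗≫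
          S.m A ◁ a.str ◁ φ.hom := by bicategory
      _ = S.map (S.map f) ◁ a'.assoc.hom ⊗≫ (S.fn.map₂ (S.fn.map₂ φ.hom) ▷ S.m A' ≫
          (S.mNat g).hom) ▷ a'.str ⊗≫ S.m A ◁ S.fn.map₂ φ.inv ▷ a'.str ⊗≫ S.m A ◁ F.cell.hom ⊗≫
          S.m A ◁ a.str ◁ φ.hom := by rw [← whisker_exchange]; bicategory
      _ = S.map (S.map f) ◁ a'.assoc.hom ⊗≫ (S.mNat f).hom ▷ a'.str ⊗≫
          S.m A ◁ (S.fn.map₂ φ.hom ≫ S.fn.map₂ φ.inv) ▷ a'.str ⊗≫ S.m A ◁ F.cell.hom ⊗≫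
          S.m A ◁ a.str ◁ φ.hom := by rw [S.mNat_natural]; bicategory
      _ = (S.map (S.map f) ◁ a'.assoc.hom ⊗≫ (S.mNat f).hom ▷ a'.str ⊗≫ S.m A ◁ F.cell.hom) ⊗≫
          S.m A ◁ a.str ◁ φ.hom := by rw [h₂]; bicategory
      _ = (α_ _ _ _).inv ≫ (S.fn.mapSq F.cell).hom ▷ a'.str ⊗≫ S.map a.str ◁ F.cell.hom ⊗≫
          (a.assoc.hom ▷ f ≫ (S.m A ≫ a.str) ◁ φ.hom) ⊗≫ 𝟙 _ := by rw [F.cell_assoc]; bicategory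
      _ = (α_ _ _ _).inv ≫
          (𝟙 (S.map (S.map f) ≫ S.map a'.str) ≫ (S.fn.mapSq F.cell).hom) ▷ a'.str ⊗≫
          S.map a.str ◁ (𝟙 (S.map f) ▷ a'.str ≫ F.cell.hom ≫ a.str ◁ φ.hom) ⊗≫ a.assoc.hom ▷ g ⊗≫
          𝟙 _ := by rw [← whisker_exchange]; bicategory
      _ = (α_ _ _ _).inv ≫ ((S.fn.map₂ (S.fn.map₂ φ.hom) ≫ S.fn.map₂ (S.fn.map₂ φ.inv)) ▷
          S.map a'.str ≫ (S.fn.mapSq F.cell).hom) ▷ a'.str ⊗≫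
          S.map a.str ◁ ((S.fn.map₂ φ.hom ≫ S.fn.map₂ φ.inv) ▷ a'.str ≫ F.cell.hom ≫
            a.str ◁ φ.hom) ⊗≫ a.assoc.hom ▷ g ⊗≫ 𝟙 _ := by rw [h₁, h₂]; bicategory
      _ = _ := by bicategory
  cell_unit := by
    have h₂ : S.fn.map₂ φ.hom ≫ S.fn.map₂ φ.inv = 𝟙 _ := by simp [← PrelaxFunctor.map₂_comp]
    rw [← cancel_epi (φ.hom ▷ 𝟙 A')]
    simp only [Iso.trans_hom, whiskerRightIso_hom, whiskerLeftIso_hom, Functor.mapIso_hom,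
      PrelaxFunctor.mapFunctor_map, Iso.symm_hom]
    calc
      _ = (φ.hom ▷ 𝟙 A' ≫ g ◁ a'.unit.hom) ⊗≫ (S.eNat g).hom ▷ a'.str ⊗≫
          S.e A ◁ S.fn.map₂ φ.inv ▷ a'.str ⊗≫ S.e A ◁ F.cell.hom ⊗≫ S.e A ◁ a.str ◁ φ.hom := by
        bicategory
      _ = f ◁ a'.unit.hom ⊗≫ (φ.hom ▷ S.e A' ≫ (S.eNat g).hom) ▷ a'.str ⊗≫
          S.e A ◁ S.fn.map₂ φ.inv ▷ a'.str ⊗≫ S.e A ◁ F.cell.hom ⊗≫ S.e A ◁ a.str ◁ φ.hom := by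
        rw [← whisker_exchange]; bicategory
      _ = f ◁ a'.unit.hom ⊗≫ (S.eNat f).hom ▷ a'.str ⊗≫
          S.e A ◁ (S.fn.map₂ φ.hom ≫ S.fn.map₂ φ.inv) ▷ a'.str ⊗≫ S.e A ◁ F.cell.hom ⊗≫
          S.e A ◁ a.str ◁ φ.hom := by rw [S.eNat_natural]; bicategory
      _ = (f ◁ a'.unit.hom ⊗≫ (S.eNat f).hom ▷ a'.str ⊗≫ S.e A ◁ F.cell.hom) ⊗≫
          S.e A ◁ a.str ◁ φ.hom := by rw [h₂]; bicategory
      _ = (ρ_ _).hom ≫ (λ_ _).inv ≫ (a.unit.hom ▷ f ≫ (S.e A ≫ a.str) ◁ φ.hom) ≫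
          (α_ _ _ _).hom := by
        rw [F.cell_unit]; bicategory
      _ = _ := by rw [← whisker_exchange]; bicategory

/-- The 2-cell of a composite of pseudomorphisms, where only the first one is required to satisfy
the axioms. -/
def MorStr.compCell {f : A ⟶ A'} (F : MorStr a a' f) {g : A' ⟶ A''}
    (c : S.map g ≫ a''.str ≅ a'.str ≫ g) : S.map (f ≫ g) ≫ a''.str ≅ a.str ≫ f ≫ g :=
  whiskerRightIso (S.fn.mapComp f g) a''.str ≪≫ α_ _ _ _ ≪≫
    whiskerLeftIso (S.map f) c ≪≫ (α_ _ _ _).symm ≪≫ whiskerRightIso F.cell g ≪≫ α_ _ _ _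

section

variable {f : A ⟶ A'} (F : MorStr a a' f) {g : A' ⟶ A''} (c : S.map g ≫ a''.str ≅ a'.str ≫ g)

/-- With the next lemma, this puts the two sides of the associativity axiom for `f ≫ g` into one
frame: the matching side for `c`, whiskered with `S (S f)`, between the same invertible cells. The
axiom for the composite is thus the whiskered axiom for `c`. Only the second lemma uses the axiom of
`F`. -/
lemma MorStr.compCell_assoc_left :
    S.map (S.map (f ≫ g)) ◁ a''.assoc.hom ⊗≫ (S.mNat (f ≫ g)).hom ▷ a''.str ⊗≫
        S.m A ◁ (F.compCell c).hom =
      𝟙 _ ⊗≫ (S.fn.map₂ (S.fn.mapComp f g).hom ≫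
        (S.fn.mapComp (S.map f) (S.map g)).hom) ▷ (S.map a''.str ≫ a''.str) ⊗≫
        S.map (S.map f) ◁ (S.map (S.map g) ◁ a''.assoc.hom ⊗≫ (S.mNat g).hom ▷ a''.str ⊗≫
          S.m A' ◁ c.hom) ⊗≫
        ((S.mNat f).hom ▷ a'.str ⊗≫ S.m A ◁ F.cell.hom) ▷ g ⊗≫
          𝟙 (S.m A ≫ a.str ≫ f ≫ g) := by
  have hm := S.mNat_comp f g
  calc
    _ = S.map (S.map (f ≫ g)) ◁ a''.assoc.hom ⊗≫ ((S.mNat (f ≫ g)).hom ≫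
          S.m A ◁ (S.fn.mapComp f g).hom) ▷ a''.str ⊗≫
          (S.m A ≫ S.map f) ◁ c.hom ⊗≫ S.m A ◁ F.cell.hom ▷ g ⊗≫
            𝟙 (S.m A ≫ a.str ≫ f ≫ g) := by
        simp [compCell, bicategoricalComp]
    _ = 𝟙 _ ⊗≫ (S.map (S.map (f ≫ g)) ◁ a''.assoc.hom ≫ (S.fn.map₂ (S.fn.mapComp f g).hom ≫
          (S.fn.mapComp (S.map f) (S.map g)).hom) ▷ (S.m A'' ≫ a''.str)) ⊗≫
          S.map (S.map f) ◁ (S.mNat g).hom ▷ a''.str ⊗≫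
          ((S.mNat f).hom ▷ (S.map g ≫ a''.str) ≫
          (S.m A ≫ S.map f) ◁ c.hom) ⊗≫ S.m A ◁ F.cell.hom ▷ g ⊗≫
            𝟙 (S.m A ≫ a.str ≫ f ≫ g) := by
        rw [hm]; bicategory
    _ = _ := by
        rw [whisker_exchange, ← whisker_exchange (S.mNat f).hom c.hom]; bicategory

lemma MorStr.compCell_assoc_right :
    (α_ _ _ _).inv ≫ (S.fn.mapSq (F.compCell c)).hom ▷ a''.str ⊗≫
        S.map a.str ◁ (F.compCell c).hom ⊗≫ a.assoc.hom ▷ (f ≫ g) ≫ (α_ _ _ _).hom =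
      𝟙 _ ⊗≫ (S.fn.map₂ (S.fn.mapComp f g).hom ≫
        (S.fn.mapComp (S.map f) (S.map g)).hom) ▷ (S.map a''.str ≫ a''.str) ⊗≫
        S.map (S.map f) ◁ ((α_ _ _ _).inv ≫ (S.fn.mapSq c).hom ▷ a''.str ⊗≫ S.map a'.str ◁ c.hom ⊗≫
          a'.assoc.hom ▷ g ≫ (α_ _ _ _).hom) ⊗≫
        ((S.mNat f).hom ▷ a'.str ⊗≫ S.m A ◁ F.cell.hom) ▷ g ⊗≫
          𝟙 (S.m A ≫ a.str ≫ f ≫ g) := by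
  symm
  calc
    _ = 𝟙 _ ⊗≫ (S.fn.map₂ (S.fn.mapComp f g).hom ≫
          (S.fn.mapComp (S.map f) (S.map g)).hom) ▷ (S.map a''.str ≫ a''.str) ⊗≫
          S.map (S.map f) ◁ ((S.fn.mapSq c).hom ▷ a''.str ⊗≫ S.map a'.str ◁ c.hom) ⊗≫
          (S.map (S.map f) ◁ a'.assoc.hom ⊗≫ (S.mNat f).hom ▷ a'.str ⊗≫
            S.m A ◁ F.cell.hom) ▷ g ⊗≫
            𝟙 (S.m A ≫ a.str ≫ f ≫ g) := by bicategory
    _ = 𝟙 _ ⊗≫ (S.fn.map₂ (S.fn.mapComp f g).hom ≫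
          (S.fn.mapComp (S.map f) (S.map g)).hom) ▷ (S.map a''.str ≫ a''.str) ⊗≫
          S.map (S.map f) ◁ (S.fn.mapSq c).hom ▷ a''.str ⊗≫
          ((S.map (S.map f) ≫ S.map a'.str) ◁ c.hom ≫
           (S.fn.mapSq F.cell).hom ▷ (a'.str ≫ g)) ⊗≫
          (S.map a.str ◁ F.cell.hom ⊗≫ a.assoc.hom ▷ f) ▷ g ⊗≫
            𝟙 (S.m A ≫ a.str ≫ f ≫ g) := by
        rw [F.cell_assoc]; bicategory
    _ = _ := by
        rw [whisker_exchange, compCell, Pseudofunctor.mapSq_pre, Pseudofunctor.mapSq_paste]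
        simp only [Iso.trans_hom, Iso.symm_hom, whiskerLeftIso_hom, whiskerRightIso_hom]
        simp [bicategoricalComp]

/-- The same framing for the unit axiom, in which `f` takes the place of `S (S f)`. -/
lemma MorStr.compCell_unit_left :
    (f ≫ g) ◁ a''.unit.hom ⊗≫ (S.eNat (f ≫ g)).hom ▷ a''.str ⊗≫ S.e A ◁ (F.compCell c).hom =
      𝟙 _ ⊗≫ f ◁ (g ◁ a''.unit.hom ⊗≫ (S.eNat g).hom ▷ a''.str ⊗≫ S.e A' ◁ c.hom) ⊗≫
        ((S.eNat f).hom ▷ a'.str ⊗≫ S.e A ◁ F.cell.hom) ▷ g ⊗≫ 𝟙 (S.e A ≫ a.str ≫ f ≫ g) := by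
  have hm := S.eNat_comp f g
  calc
    _ = (f ≫ g) ◁ a''.unit.hom ⊗≫ ((S.eNat (f ≫ g)).hom ≫
          S.e A ◁ (S.fn.mapComp f g).hom) ▷ a''.str ⊗≫
          (S.e A ≫ S.map f) ◁ c.hom ⊗≫ S.e A ◁ F.cell.hom ▷ g ⊗≫
            𝟙 (S.e A ≫ a.str ≫ f ≫ g) := by
        simp [compCell, bicategoricalComp]
    _ = 𝟙 _ ⊗≫ f ◁ (g ◁ a''.unit.hom ⊗≫ (S.eNat g).hom ▷ a''.str) ⊗≫
          ((S.eNat f).hom ▷ (S.map g ≫ a''.str) ≫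
          (S.e A ≫ S.map f) ◁ c.hom) ⊗≫ S.e A ◁ F.cell.hom ▷ g ⊗≫
            𝟙 (S.e A ≫ a.str ≫ f ≫ g) := by
        rw [hm]; bicategory
    _ = _ := by rw [← whisker_exchange]; bicategory

lemma MorStr.compCell_unit_right :
    (ρ_ _).hom ≫ (λ_ _).inv ≫ a.unit.hom ▷ (f ≫ g) ≫ (α_ _ _ _).hom =
      𝟙 _ ⊗≫ f ◁ ((ρ_ _).hom ≫ (λ_ _).inv ≫ a'.unit.hom ▷ g ≫ (α_ _ _ _).hom) ⊗≫
        ((S.eNat f).hom ▷ a'.str ⊗≫ S.e A ◁ F.cell.hom) ▷ g ⊗≫ 𝟙 (S.e A ≫ a.str ≫ f ≫ g) := by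
  symm
  calc
    _ = 𝟙 _ ⊗≫ (f ◁ a'.unit.hom ⊗≫ (S.eNat f).hom ▷ a'.str ⊗≫ S.e A ◁ F.cell.hom) ▷ g ⊗≫
            𝟙 (S.e A ≫ a.str ≫ f ≫ g) := by bicategory
    _ = _ := by rw [F.cell_unit]; bicategory

end

/-- A pseudomorphism structure on a composite with an equivalence descends. -/
lemma MorStr.exists_of_comp_isEquivalence {u : A ⟶ A'} (hu : IsEquivalence u) (U : MorStr a a' u)
    {h : A' ⟶ A''} (G : MorStr a a'' (u ≫ h)) :
    ∃ H : MorStr a' a'' h, IsAlgCell G (U.comp H) (𝟙 _) := by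
  have hSu : IsEquivalence (S.map u) := hu.map S.fn
  have hSSu : IsEquivalence (S.map (S.map u)) := hSu.map S.fn
  -- Requiring `G` to be the composite of `U` with the structure sought determines `S.map u ◁ c`,
  -- and the equivalence `S.map u` can be cancelled.
  obtain ⟨c, hc⟩ := hSu.exists_whiskerLeftIso ((α_ (S.map u) (S.map h) a''.str).symm ≪≫
    whiskerRightIso (S.fn.mapComp u h).symm a''.str ≪≫ G.cell ≪≫
      (α_ _ _ _).symm ≪≫ whiskerRightIso U.cell.symm h ≪≫ α_ _ _ _)
  have hG : G.cell = U.compCell c := by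
    rw [MorStr.compCell, hc]
    ext
    simp
  have h₁ := G.cell_assoc
  rw [hG, U.compCell_assoc_left, U.compCell_assoc_right] at h₁
  have h₂ : 𝟙 ((u ≫ h) ≫ 𝟙 A'') ⊗≫
      u ◁ (h ◁ a''.unit.hom ⊗≫ (S.eNat h).hom ▷ a''.str ⊗≫ S.e A' ◁ c.hom) ⊗≫
        ((S.eNat u).hom ▷ a'.str ⊗≫ S.e A ◁ U.cell.hom) ▷ h ⊗≫ 𝟙 (S.e A ≫ a.str ≫ u ≫ h) =
      𝟙 ((u ≫ h) ≫ 𝟙 A'') ⊗≫ u ◁ ((ρ_ _).hom ≫ (λ_ _).inv ≫ a'.unit.hom ▷ h ≫ (α_ _ _ _).hom) ⊗≫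
        ((S.eNat u).hom ▷ a'.str ⊗≫ S.e A ◁ U.cell.hom) ▷ h ⊗≫ 𝟙 (S.e A ≫ a.str ≫ u ≫ h) := by
    rw [← U.compCell_unit_left, ← U.compCell_unit_right, ← hG]
    refine Eq.trans ?_ G.cell_unit
    simp [bicategoricalComp]
  -- The frames are invertible. Once they cancel, the axioms for `c` remain, whiskered with the
  -- equivalences `S.map (S.map u)` and `u`.
  simp only [bicategoricalComp, cancel_epi, cancel_mono] at h₁ h₂
  refine ⟨⟨c, hSSu.whiskerLeft_injective h₁, hu.whiskerLeft_injective h₂⟩, ?_⟩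
  simp only [IsAlgCell, hG]
  simp [MorStr.comp, MorStr.compCell]

end Pseudomonad

/-! ### The universal property of the free pseudoalgebra -/

namespace Pseudomonad

variable {B : Type u₁} [Bicategory.{w₁, v₁} B] {S : Pseudomonad B} {X A : B}

/-- The universal property of the free pseudoalgebra: a morphism to a pseudoalgebra factors through
the unit. -/
def Alg.eStr (a : S.Alg A) (f : X ⟶ A) : f ≅ S.e X ≫ S.map f ≫ a.str :=
  (ρ_ f).symm ≪≫ whiskerLeftIso f a.unit ≪≫ (α_ _ _ _).symm ≪≫
    whiskerRightIso (S.eNat f) a.str ≪≫ α_ _ _ _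

lemma Alg.eStr_natural (a : S.Alg A) {f g : X ⟶ A} (φ : f ⟶ g) :
    φ ≫ (a.eStr g).hom = (a.eStr f).hom ≫ S.e X ◁ S.fn.map₂ φ ▷ a.str := by
  symm
  calc
    _ = (ρ_ f).inv ≫ f ◁ a.unit.hom ⊗≫ ((S.eNat f).hom ≫ S.e X ◁ S.fn.map₂ φ) ▷ a.str ≫
        (α_ _ _ _).hom := by simp [eStr, bicategoricalComp]
    _ = (ρ_ f).inv ≫ (f ◁ a.unit.hom ≫ φ ▷ _) ⊗≫ (S.eNat g).hom ▷ a.str ≫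
        (α_ _ _ _).hom := by rw [← S.eNat_natural]; bicategory
    _ = _ := by rw [whisker_exchange]; simp [eStr, bicategoricalComp]

/-- The 2-cell of a pseudomorphism from a free pseudoalgebra. -/
def MorStr.freeCell {a : S.Alg A} {p : S.obj X ⟶ A} (P : MorStr (S.freeAlg X) a p) :
    S.map p ≫ a.str ≅ S.m X ≫ p := P.cell

lemma MorStr.freeCell_unit {a : S.Alg A} {p : S.obj X ⟶ A} (P : MorStr (S.freeAlg X) a p) :
    p ◁ a.unit.hom ⊗≫ (S.eNat p).hom ▷ a.str ⊗≫ S.e (S.obj X) ◁ P.freeCell.hom =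
      (ρ_ _).hom ≫ (λ_ _).inv ≫ (S.cells.left X).hom ▷ p ≫ (α_ _ _ _).hom :=
  P.cell_unit

lemma IsAlgCell.freeCell_inv {a : S.Alg A} {p q : S.obj X ⟶ A} {P : MorStr (S.freeAlg X) a p}
    {Q : MorStr (S.freeAlg X) a q} {φ : p ⟶ q} (hφ : IsAlgCell P Q φ) :
    S.m X ◁ φ ≫ Q.freeCell.inv = P.freeCell.inv ≫ S.fn.map₂ φ ▷ a.str := by
  rw [Iso.eq_inv_comp, ← Category.assoc, Iso.comp_inv_eq]
  exact Eq.symm hφ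

/-- A pseudomorphism from a free pseudoalgebra is determined by its restriction along the unit. -/
def MorStr.freeIso {a : S.Alg A} {p : S.obj X ⟶ A} (P : MorStr (S.freeAlg X) a p) :
    p ≅ S.map (S.e X ≫ p) ≫ a.str :=
  (λ_ p).symm ≪≫ whiskerRightIso (S.cells.right X).symm p ≪≫ α_ _ _ _ ≪≫
    whiskerLeftIso (S.map (S.e X)) P.freeCell.symm ≪≫ (α_ _ _ _).symm ≪≫
    whiskerRightIso (S.fn.mapComp (S.e X) p).symm a.str

/-- The condition on `φ` is what moves it past `freeCell`. Consequently an algebra 2-cell out of a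
free algebra is a function of its restriction along the unit. -/
lemma MorStr.freeIso_natural {a : S.Alg A} {p q : S.obj X ⟶ A} {P : MorStr (S.freeAlg X) a p}
    {Q : MorStr (S.freeAlg X) a q} {φ : p ⟶ q} (hφ : IsAlgCell P Q φ) :
    φ ≫ Q.freeIso.hom = P.freeIso.hom ≫ S.fn.map₂ (S.e X ◁ φ) ▷ a.str := by
  have h := hφ.freeCell_inv
  symm
  calc
    _ = (λ_ p).inv ≫ (S.cells.right X).inv ▷ p ≫ (α_ _ _ _).hom ≫
        S.map (S.e X) ◁ (P.freeCell.inv ≫ S.fn.map₂ φ ▷ a.str) ≫ (α_ _ _ _).inv ≫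
        (S.fn.mapComp (S.e X) q).inv ▷ a.str := by
      simp [freeIso]
    _ = (λ_ p).inv ≫ ((S.cells.right X).inv ▷ p ≫ (S.map (S.e X) ≫ S.m X) ◁ φ) ≫ (α_ _ _ _).hom ≫
        S.map (S.e X) ◁ Q.freeCell.inv ≫ (α_ _ _ _).inv ≫
        (S.fn.mapComp (S.e X) q).inv ▷ a.str := by
      rw [← h]
      simp
    _ = _ := by
      rw [← whisker_exchange]
      simp [freeIso]

end Pseudomonad

namespace TwoMonad

open Pseudomonad

variable {B : Type u₁} [Bicategory.{w₁, v₁} B] [Bicategory.Strict B] {S : TwoMonad B}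
  {X A : B} {a : S.Alg A}

/-- Every factor of this isomorphism is an algebra 2-cell in its own right: `freeCell` by the
associativity axiom of `P`, the unit constraint by `isAlgCell_right`. -/
lemma isAlgCell_freeIso {p : S.obj X ⟶ A} (P : MorStr (S.freeAlg X) a p) :
    IsAlgCell P ((S.freeMor (S.e X ≫ p)).comp a.strMor) P.freeIso.hom := by
  have h₁ := (isAlgCell_leftUnitor P).inv
  have h₂ := ((S.isAlgCell_right X).inv.whiskerRight P)
  have h₃ := isAlgCell_associator (S.freeMor (S.e X)) (S.freeAlg X).strMor P
  have h₄ := (isAlgCell_cell P).inv.whiskerLeft (S.freeMor (S.e X))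
  have h₅ := (isAlgCell_associator (S.freeMor (S.e X)) (S.freeMor p) a.strMor)
  have h₆ := (isAlgCell_mapComp (S := S.toPseudomonad) (S.e X) p).inv.whiskerRight a.strMor
  exact h₁.comp (h₂.comp (h₃.comp (h₄.comp (h₅.inv.comp h₆))))

/-- The unit axiom of `P` collapses the middle of the composite and leaves the identity `e_right`.
This is why the lift of a 2-cell restricts to the cell it came from. -/
lemma e_freeIso {p : S.obj X ⟶ A} (P : MorStr (S.freeAlg X) a p) :
    S.e X ◁ P.freeIso.hom = (a.eStr (S.e X ≫ p)).hom := by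
  have h₁ := S.eNat_comp (S.e X) p
  have h₂ := P.freeCell_unit
  have h₃ := S.e_right X
  have key : (a.eStr (S.e X ≫ p)).hom ≫ S.e X ◁ P.freeIso.inv = 𝟙 _ := by
    calc
      _ = (ρ_ _).inv ≫ (S.e X ≫ p) ◁ a.unit.hom ⊗≫ ((S.eNat (S.e X ≫ p)).hom ≫
          S.e X ◁ (S.fn.mapComp (S.e X) p).hom) ▷ a.str ⊗≫
          S.e X ◁ S.map (S.e X) ◁ P.freeCell.hom ⊗≫ S.e X ◁ (S.cells.right X).hom ▷ p ⊗≫ 𝟙 _ := by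
        simp [Alg.eStr, MorStr.freeIso, bicategoricalComp]
      _ = 𝟙 _ ⊗≫ S.e X ◁ (p ◁ a.unit.hom ⊗≫ (S.eNat p).hom ▷ a.str) ⊗≫
          ((S.eNat (S.e X)).hom ▷ (S.map p ≫ a.str) ≫
          (S.e X ≫ S.map (S.e X)) ◁ P.freeCell.hom) ⊗≫ S.e X ◁ (S.cells.right X).hom ▷ p ⊗≫
            𝟙 _ := by
        rw [h₁]; bicategory
      _ = 𝟙 _ ⊗≫ S.e X ◁ (p ◁ a.unit.hom ⊗≫ (S.eNat p).hom ▷ a.str ⊗≫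
          S.e (S.obj X) ◁ P.freeCell.hom) ⊗≫ (S.eNat (S.e X)).hom ▷ (S.m X ≫ p) ⊗≫
          S.e X ◁ (S.cells.right X).hom ▷ p ⊗≫ 𝟙 _ := by
        rw [← whisker_exchange]; simp [bicategoricalComp]
      _ = 𝟙 _ ⊗≫ (S.e X ◁ (S.cells.left X).hom ≫ (α_ _ _ _).inv ≫ (S.eNat (S.e X)).hom ▷ S.m X ≫
          (α_ _ _ _).hom ≫ S.e X ◁ (S.cells.right X).hom) ▷ p ⊗≫ 𝟙 _ := by
        rw [h₂]; simp [bicategoricalComp]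
      _ = _ := by rw [h₃]; simp [bicategoricalComp]
  rw [← cancel_mono (S.e X ◁ P.freeIso.inv), key]
  simp

lemma free_hom_ext {p q : S.obj X ⟶ A} {P : MorStr (S.freeAlg X) a p}
    {Q : MorStr (S.freeAlg X) a q} {φ ψ : p ⟶ q} (hφ : IsAlgCell P Q φ) (hψ : IsAlgCell P Q ψ)
    (h : S.e X ◁ φ = S.e X ◁ ψ) : φ = ψ := by
  rw [← cancel_mono Q.freeIso.hom, MorStr.freeIso_natural hφ, MorStr.freeIso_natural hψ, h]

lemma exists_free_lift {p q : S.obj X ⟶ A} (P : MorStr (S.freeAlg X) a p)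
    (Q : MorStr (S.freeAlg X) a q) (σ : S.e X ≫ p ⟶ S.e X ≫ q) :
    ∃ φ : p ⟶ q, IsAlgCell P Q φ ∧ S.e X ◁ φ = σ := by
  -- The formula is forced: by `freeIso_natural`, an algebra 2-cell that restricts to `σ`
  -- corresponds under the two isomorphisms to `S σ` whiskered with `a.str`.
  refine ⟨P.freeIso.hom ≫ S.fn.map₂ σ ▷ a.str ≫ Q.freeIso.inv, (isAlgCell_freeIso P).comp
    (((isAlgCell_map₂ (S := S.toPseudomonad) σ).whiskerRight a.strMor).comp
      (isAlgCell_freeIso Q).inv), ?_⟩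
  rw [← cancel_mono (S.e X ◁ Q.freeIso.hom)]
  simp only [whiskerLeft_comp, Category.assoc]
  rw [← whiskerLeft_comp, Iso.inv_hom_id, whiskerLeft_id, Category.comp_id, e_freeIso, e_freeIso,
    Alg.eStr_natural]

end TwoMonad

/-! ### The action of a morphism of pseudomonads on pseudomorphisms -/

section

variable {B : Type u₁} [Bicategory.{w₁, v₁} B]

/-- All cells are variables, here and in the auxiliary lemmas below, so that only the shape of the
pasting matters. The hypothesis `h₂` is the associativity law of the pseudomonad morphism and `h₁`
expands the constraint of the image algebra; moving inverses across turns them into the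
pseudomorphism axiom for the comparison. -/
lemma app_assoc_aux {y y₂ y₃ c d d₂ d' e f : B}
    {κ : y ⟶ c} {m₁ : y₂ ⟶ y} {m₂ Sm : y₃ ⟶ y₂} {Sκ : y₂ ⟶ d} {SSκ : y₃ ⟶ d₂} {md : d₂ ⟶ d}
    {κS : d ⟶ e} {Jm : e ⟶ c} {SκS : d₂ ⟶ d'} {SJm : d' ⟶ d} {SKm : d₂ ⟶ d} {κSS : d' ⟶ f}
    {JSm JmS : f ⟶ e} (w : m₁ ≫ κ ≅ Sκ ≫ κS ≫ Jm) (Sw : Sm ≫ Sκ ≅ SSκ ≫ SKm)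
    {d₁ : SKm ⟶ SκS ≫ SJm} {Jas : JSm ≫ Jm ⟶ JmS ≫ Jm} (nκ : SSκ ≫ md ≅ m₂ ≫ Sκ)
    {as : Sm ≫ m₁ ⟶ m₂ ≫ m₁} {nm : SJm ≫ κS ⟶ κSS ≫ JSm} (wS : md ≫ κS ≅ SκS ≫ κSS ≫ JmS)
    {A : SKm ≫ κS ≫ Jm ⟶ md ≫ κS ≫ Jm}
    (h₁ : A ⊗≫ wS.hom ▷ Jm = d₁ ▷ (κS ≫ Jm) ⊗≫ SκS ◁ nm ▷ Jm ⊗≫ (SκS ≫ κSS) ◁ Jas ⊗≫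
      𝟙 ((SκS ≫ κSS ≫ JmS) ≫ Jm))
    (h₂ : Sm ◁ w.hom ⊗≫ Sw.hom ▷ (κS ≫ Jm) ⊗≫ SSκ ◁ d₁ ▷ (κS ≫ Jm) ⊗≫ (SSκ ≫ SκS) ◁ nm ▷ Jm ⊗≫
        ((SSκ ≫ SκS) ≫ κSS) ◁ Jas =
      (α_ _ _ _).inv ≫ as ▷ κ ⊗≫ m₂ ◁ w.hom ⊗≫ nκ.inv ▷ (κS ≫ Jm) ⊗≫ SSκ ◁ wS.hom ▷ Jm ⊗≫
        𝟙 (((SSκ ≫ SκS) ≫ κSS) ≫ JmS ≫ Jm)) :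
    SSκ ◁ A ⊗≫ nκ.hom ▷ (κS ≫ Jm) ⊗≫ m₂ ◁ w.inv =
      (α_ _ _ _).inv ≫ Sw.inv ▷ (κS ≫ Jm) ⊗≫ Sm ◁ w.inv ⊗≫ as ▷ κ ≫ (α_ _ _ _).hom := by
  have h₃ : (Sm ◁ w.hom ⊗≫ Sw.hom ▷ (κS ≫ Jm) ⊗≫ SSκ ◁ A) ⊗≫ SSκ ◁ wS.hom ▷ Jm =
      (𝟙 _ ⊗≫ as ▷ κ ⊗≫ m₂ ◁ w.hom ⊗≫ nκ.inv ▷ (κS ≫ Jm) ⊗≫ 𝟙 (SSκ ≫ md ≫ κS ≫ Jm)) ⊗≫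
        SSκ ◁ wS.hom ▷ Jm := by
    calc
      _ = Sm ◁ w.hom ⊗≫ Sw.hom ▷ (κS ≫ Jm) ⊗≫ SSκ ◁ (A ⊗≫ wS.hom ▷ Jm) ⊗≫ 𝟙 _ := by bicategory
      _ = (Sm ◁ w.hom ⊗≫ Sw.hom ▷ (κS ≫ Jm) ⊗≫ SSκ ◁ d₁ ▷ (κS ≫ Jm) ⊗≫
          (SSκ ≫ SκS) ◁ nm ▷ Jm ⊗≫ ((SSκ ≫ SκS) ≫ κSS) ◁ Jas) ⊗≫ 𝟙 _ := by rw [h₁]; bicategory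
      _ = _ := by rw [h₂]; bicategory
  simp only [bicategoricalComp, cancel_mono] at h₃
  rw [← cancel_epi (Sm ◁ w.hom ≫ (α_ _ _ _).inv ≫ Sw.hom ▷ (κS ≫ Jm) ≫ (α_ _ _ _).hom)]
  have h₄ := congrArg (· ≫ (α_ _ _ _).inv ≫ nκ.hom ▷ (κS ≫ Jm) ≫ (α_ _ _ _).hom ≫ m₂ ◁ w.inv) h₃
  simp at h₄
  simp [bicategoricalComp, h₄]

lemma app_unit_aux {y y₂ c d e : B} {κ : y ⟶ c} {m : y₂ ⟶ y} {Sκ : y₂ ⟶ d} {κS : d ⟶ e}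
    {Jm : e ⟶ c} {es : y ⟶ y₂} {eJ : c ⟶ d} {Je : c ⟶ e} (w : m ≫ κ ≅ Sκ ≫ κS ≫ Jm)
    {l : 𝟙 y ⟶ es ≫ m} (nκ : κ ≫ eJ ≅ es ≫ Sκ) (u : eJ ≫ κS ≅ Je) {t : 𝟙 c ⟶ Je ≫ Jm}
    (h : l ▷ κ ⊗≫ es ◁ w.hom ⊗≫ nκ.inv ▷ (κS ≫ Jm) ⊗≫ κ ◁ u.hom ▷ Jm ⊗≫ 𝟙 (κ ≫ Je ≫ Jm) =
      (λ_ _).hom ≫ (ρ_ _).inv ≫ κ ◁ t) :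
    κ ◁ (t ≫ u.inv ▷ Jm ≫ (α_ _ _ _).hom) ⊗≫ nκ.hom ▷ (κS ≫ Jm) ⊗≫ es ◁ w.inv =
      (ρ_ _).hom ≫ (λ_ _).inv ≫ l ▷ κ ≫ (α_ _ _ _).hom := by
  have h' : κ ◁ t = (ρ_ _).hom ≫ (λ_ _).inv ≫ (l ▷ κ ⊗≫ es ◁ w.hom ⊗≫ nκ.inv ▷ (κS ≫ Jm) ⊗≫
      κ ◁ u.hom ▷ Jm ⊗≫ 𝟙 (κ ≫ Je ≫ Jm)) := by
    rw [h]; simp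
  rw [whiskerLeft_comp, h']
  simp [bicategoricalComp]

/-- Both sides are tested after composing with the invertible `w`, since `h₁` and `h₁'` know the
constraints of the image algebras only in that form. What remains is a pasting of naturality of the
multiplication comparison (`h₅`), naturality of `κ` at the structure cell (`h₃`) and the image of
the original axiom (`h₄`). -/
lemma mor_assoc_aux {y y' c c' z z' y₂ y₂' d d' e e' : B} {κ : y ⟶ c} {κ' : y' ⟶ c'} {a : c ⟶ z}
    {b : c' ⟶ z'} {f : z ⟶ z'} {Sf : y ⟶ y'} {SSf : y₂ ⟶ y₂'} {JSf : c ⟶ c'} {SJSf : d ⟶ d'}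
    {JSSf : e ⟶ e'} {m : y₂ ⟶ y} {m' : y₂' ⟶ y'} {Sκ : y₂ ⟶ d} {Sκ' : y₂' ⟶ d'} {Sa : d ⟶ y}
    {Sb : d' ⟶ y'} {Ska : y₂ ⟶ y} {Skb : y₂' ⟶ y'} {κS : d ⟶ e} {κS' : d' ⟶ e'} {Jm JSa : e ⟶ c}
    {Jm' JSb : e' ⟶ c'} (w : m ≫ κ ≅ Sκ ≫ κS ≫ Jm) {w' : m' ≫ κ' ⟶ Sκ' ≫ κS' ≫ Jm'}
    {A : Ska ≫ κ ≫ a ⟶ m ≫ κ ≫ a} {A' : Skb ≫ κ' ≫ b ⟶ m' ≫ κ' ≫ b}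
    {da : Ska ⟶ Sκ ≫ Sa} {db : Skb ⟶ Sκ' ≫ Sb} {na : Sa ≫ κ ⟶ κS ≫ JSa}
    {nb : Sb ≫ κ' ⟶ κS' ≫ JSb} {Ja : JSa ≫ a ⟶ Jm ≫ a} {Jb : JSb ≫ b ⟶ Jm' ≫ b}
    {nf : Sf ≫ κ' ⟶ κ ≫ JSf} {Jc : JSf ≫ b ⟶ a ≫ f} {Sc : SSf ≫ Skb ⟶ Ska ≫ Sf}
    {Snf : SSf ≫ Sκ' ⟶ Sκ ≫ SJSf} {SJc : SJSf ≫ Sb ⟶ Sa ≫ Sf} {JSc : JSSf ≫ JSb ⟶ JSa ≫ JSf}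
    {nSf : SJSf ≫ κS' ⟶ κS ≫ JSSf} {nα : SSf ≫ m' ⟶ m ≫ Sf} {Jn : JSSf ≫ Jm' ⟶ Jm ≫ JSf}
    (h₁ : A ⊗≫ w.hom ▷ a = da ▷ (κ ≫ a) ⊗≫ Sκ ◁ na ▷ a ⊗≫ (Sκ ≫ κS) ◁ Ja ⊗≫
      𝟙 ((Sκ ≫ κS ≫ Jm) ≫ a))
    (h₁' : A' ⊗≫ w' ▷ b = db ▷ (κ' ≫ b) ⊗≫ Sκ' ◁ nb ▷ b ⊗≫ (Sκ' ≫ κS') ◁ Jb ⊗≫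
      𝟙 ((Sκ' ≫ κS' ≫ Jm') ≫ b))
    (h₂ : Sc ⊗≫ da ▷ Sf ⊗≫ 𝟙 (Sκ ≫ Sa ≫ Sf) = SSf ◁ db ⊗≫ Snf ▷ Sb ⊗≫ Sκ ◁ SJc)
    (h₃ : SJc ▷ κ' ≫ (α_ _ _ _).hom ≫ Sa ◁ nf ≫ (α_ _ _ _).inv ≫ na ▷ JSf ≫ (α_ _ _ _).hom =
      (α_ _ _ _).hom ≫ SJSf ◁ nb ≫ (α_ _ _ _).inv ≫ nSf ▷ JSb ≫ (α_ _ _ _).hom ≫ κS ◁ JSc)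
    (h₄ : JSc ▷ b ⊗≫ JSa ◁ Jc ⊗≫ Ja ▷ f ≫ (α_ _ _ _).hom =
      (α_ _ _ _).hom ≫ JSSf ◁ Jb ⊗≫ Jn ▷ b ⊗≫ Jm ◁ Jc)
    (h₅ : SSf ◁ w' ⊗≫ Snf ▷ (κS' ≫ Jm') ⊗≫ Sκ ◁ nSf ▷ Jm' ⊗≫ (Sκ ≫ κS) ◁ Jn =
      (α_ _ _ _).inv ≫ nα ▷ κ' ⊗≫ m ◁ nf ⊗≫ w.hom ▷ JSf ⊗≫ 𝟙 ((Sκ ≫ κS) ≫ Jm ≫ JSf)) :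
    SSf ◁ A' ⊗≫ nα ▷ (κ' ≫ b) ⊗≫ m ◁ ((α_ _ _ _).inv ≫ nf ▷ b ⊗≫ κ ◁ Jc ⊗≫ 𝟙 ((κ ≫ a) ≫ f)) =
      (α_ _ _ _).inv ≫ Sc ▷ (κ' ≫ b) ⊗≫
        Ska ◁ ((α_ _ _ _).inv ≫ nf ▷ b ⊗≫ κ ◁ Jc ⊗≫ 𝟙 ((κ ≫ a) ≫ f)) ⊗≫
        A ▷ f ≫ (α_ _ _ _).hom := by
  have key : (SSf ◁ A' ⊗≫ nα ▷ (κ' ≫ b) ⊗≫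
      m ◁ ((α_ _ _ _).inv ≫ nf ▷ b ⊗≫ κ ◁ Jc ⊗≫ 𝟙 ((κ ≫ a) ≫ f))) ⊗≫
      w.hom ▷ (a ≫ f) =
      ((α_ _ _ _).inv ≫ Sc ▷ (κ' ≫ b) ⊗≫
        Ska ◁ ((α_ _ _ _).inv ≫ nf ▷ b ⊗≫ κ ◁ Jc ⊗≫ 𝟙 ((κ ≫ a) ≫ f)) ⊗≫
        A ▷ f ≫ (α_ _ _ _).hom) ⊗≫ w.hom ▷ (a ≫ f) := by
    calc
      _ = SSf ◁ A' ⊗≫ (nα ▷ κ' ⊗≫ m ◁ nf) ▷ b ⊗≫ ((m ≫ κ) ◁ Jc ≫ w.hom ▷ (a ≫ f)) := by bicategory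
      _ = SSf ◁ A' ⊗≫ ((α_ _ _ _).inv ≫ nα ▷ κ' ⊗≫ m ◁ nf ⊗≫ w.hom ▷ JSf ⊗≫
          𝟙 ((Sκ ≫ κS) ≫ Jm ≫ JSf)) ▷ b ⊗≫ (Sκ ≫ κS ≫ Jm) ◁ Jc := by
        rw [whisker_exchange]; bicategory
      _ = SSf ◁ (A' ⊗≫ w' ▷ b) ⊗≫ (Snf ▷ (κS' ≫ Jm') ⊗≫ Sκ ◁ nSf ▷ Jm' ⊗≫ (Sκ ≫ κS) ◁ Jn) ▷ b ⊗≫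
          (Sκ ≫ κS ≫ Jm) ◁ Jc := by
        rw [← h₅]; bicategory
      _ = SSf ◁ (db ▷ (κ' ≫ b)) ⊗≫ ((SSf ≫ Sκ') ◁ (nb ▷ b ⊗≫ κS' ◁ Jb) ≫
          Snf ▷ (κS' ≫ Jm' ≫ b)) ⊗≫ (Sκ ◁ nSf ▷ Jm' ⊗≫ (Sκ ≫ κS) ◁ Jn) ▷ b ⊗≫
          (Sκ ≫ κS ≫ Jm) ◁ Jc := by
        rw [h₁']; bicategory
      _ = SSf ◁ (db ▷ (κ' ≫ b)) ⊗≫ Snf ▷ (Sb ≫ κ' ≫ b) ⊗≫ Sκ ◁ SJSf ◁ nb ▷ b ⊗≫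
          Sκ ◁ ((SJSf ≫ κS') ◁ Jb ≫ nSf ▷ (Jm' ≫ b)) ⊗≫ ((Sκ ≫ κS) ◁ Jn) ▷ b ⊗≫
          (Sκ ≫ κS ≫ Jm) ◁ Jc := by
        rw [whisker_exchange]; bicategory
      _ = SSf ◁ (db ▷ (κ' ≫ b)) ⊗≫ Snf ▷ (Sb ≫ κ' ≫ b) ⊗≫ Sκ ◁ (SJSf ◁ nb ⊗≫ nSf ▷ JSb) ▷ b ⊗≫
          (Sκ ≫ κS) ◁ ((α_ _ _ _).hom ≫ JSSf ◁ Jb ⊗≫ Jn ▷ b ⊗≫ Jm ◁ Jc) ⊗≫ 𝟙 _ := by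
        rw [whisker_exchange]; bicategory
      _ = SSf ◁ (db ▷ (κ' ≫ b)) ⊗≫ Snf ▷ (Sb ≫ κ' ≫ b) ⊗≫ Sκ ◁ ((α_ _ _ _).hom ≫ SJSf ◁ nb ≫
          (α_ _ _ _).inv ≫ nSf ▷ JSb ≫ (α_ _ _ _).hom ≫ κS ◁ JSc) ▷ b ⊗≫
          (Sκ ≫ κS) ◁ (JSa ◁ Jc ⊗≫ Ja ▷ f) ⊗≫ 𝟙 _ := by
        rw [← h₄]; bicategory
      _ = 𝟙 _ ⊗≫ (SSf ◁ db ⊗≫ Snf ▷ Sb ⊗≫ Sκ ◁ SJc) ▷ (κ' ≫ b) ⊗≫ (Sκ ≫ Sa) ◁ nf ▷ b ⊗≫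
          Sκ ◁ (na ▷ (JSf ≫ b) ≫ (κS ≫ JSa) ◁ Jc) ⊗≫ (Sκ ≫ κS) ◁ Ja ▷ f ⊗≫ 𝟙 _ := by
        rw [← h₃]; bicategory
      _ = 𝟙 _ ⊗≫ (Sc ⊗≫ da ▷ Sf ⊗≫ 𝟙 (Sκ ≫ Sa ≫ Sf)) ▷ (κ' ≫ b) ⊗≫
          (Sκ ≫ Sa) ◁ (nf ▷ b ⊗≫ κ ◁ Jc) ⊗≫
          Sκ ◁ na ▷ (a ≫ f) ⊗≫ (Sκ ≫ κS) ◁ Ja ▷ f ⊗≫ 𝟙 _ := by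
        rw [← h₂, ← whisker_exchange na]; bicategory
      _ = 𝟙 _ ⊗≫ Sc ▷ (κ' ≫ b) ⊗≫ (da ▷ (Sf ≫ κ' ≫ b) ≫
          (Sκ ≫ Sa) ◁ (𝟙 (Sf ≫ κ' ≫ b) ⊗≫ nf ▷ b ⊗≫ κ ◁ Jc)) ⊗≫
          Sκ ◁ na ▷ (a ≫ f) ⊗≫ (Sκ ≫ κS) ◁ Ja ▷ f ⊗≫ 𝟙 _ := by bicategory
      _ = 𝟙 _ ⊗≫ Sc ▷ (κ' ≫ b) ⊗≫ Ska ◁ (nf ▷ b ⊗≫ κ ◁ Jc) ⊗≫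
          (da ▷ (κ ≫ a) ⊗≫ Sκ ◁ na ▷ a ⊗≫ (Sκ ≫ κS) ◁ Ja ⊗≫ 𝟙 ((Sκ ≫ κS ≫ Jm) ≫ a)) ▷ f ⊗≫
          𝟙 _ := by rw [← whisker_exchange]; bicategory
      _ = _ := by rw [← h₁]; bicategory
  simpa only [bicategoricalComp, cancel_mono] using key

lemma mor_unit_aux {y y' c c' z z' : B} {κ : y ⟶ c} {κ' : y' ⟶ c'} {a : c ⟶ z} {b : c' ⟶ z'}
    {f : z ⟶ z'} {Sf : y ⟶ y'} {JSf : c ⟶ c'} {e : z ⟶ y} {e' : z' ⟶ y'} {Je : z ⟶ c}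
    {Je' : z' ⟶ c'} (u : e ≫ κ ≅ Je) (u' : e' ≫ κ' ≅ Je') {t : 𝟙 z ⟶ Je ≫ a}
    {t' : 𝟙 z' ⟶ Je' ≫ b} {nf : Sf ≫ κ' ⟶ κ ≫ JSf} {Jc : JSf ≫ b ⟶ a ≫ f}
    {ne : f ≫ e' ⟶ e ≫ Sf} {Jne : f ≫ Je' ⟶ Je ≫ JSf}
    (h₁ : f ◁ u'.hom ≫ Jne = (α_ _ _ _).inv ≫ ne ▷ κ' ⊗≫ e ◁ nf ⊗≫ u.hom ▷ JSf)
    (h₂ : f ◁ t' ⊗≫ Jne ▷ b ⊗≫ Je ◁ Jc = (ρ_ _).hom ≫ (λ_ _).inv ≫ t ▷ f ≫ (α_ _ _ _).hom) :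
    f ◁ (t' ≫ u'.inv ▷ b ≫ (α_ _ _ _).hom) ⊗≫ ne ▷ (κ' ≫ b) ⊗≫
        e ◁ ((α_ _ _ _).inv ≫ nf ▷ b ⊗≫ κ ◁ Jc ⊗≫ 𝟙 ((κ ≫ a) ≫ f)) =
      (ρ_ _).hom ≫ (λ_ _).inv ≫ (t ≫ u.inv ▷ a ≫ (α_ _ _ _).hom) ▷ f ≫ (α_ _ _ _).hom := by
  have key : (f ◁ (t' ≫ u'.inv ▷ b ≫ (α_ _ _ _).hom) ⊗≫ ne ▷ (κ' ≫ b) ⊗≫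
        e ◁ ((α_ _ _ _).inv ≫ nf ▷ b ⊗≫ κ ◁ Jc ⊗≫ 𝟙 ((κ ≫ a) ≫ f))) ⊗≫ u.hom ▷ (a ≫ f) =
      ((ρ_ _).hom ≫ (λ_ _).inv ≫ (t ≫ u.inv ▷ a ≫ (α_ _ _ _).hom) ▷ f ≫ (α_ _ _ _).hom) ⊗≫
        u.hom ▷ (a ≫ f) := by
    calc
      _ = f ◁ (t' ≫ u'.inv ▷ b) ⊗≫ (ne ▷ κ' ⊗≫ e ◁ nf) ▷ b ⊗≫
          ((e ≫ κ) ◁ Jc ≫ u.hom ▷ (a ≫ f)) := by bicategory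
      _ = f ◁ (t' ≫ u'.inv ▷ b) ⊗≫ ((α_ _ _ _).inv ≫ ne ▷ κ' ⊗≫ e ◁ nf ⊗≫ u.hom ▷ JSf) ▷ b ⊗≫
          Je ◁ Jc := by
        rw [whisker_exchange]; bicategory
      _ = f ◁ t' ⊗≫ (f ◁ (u'.inv ≫ u'.hom)) ▷ b ⊗≫ Jne ▷ b ⊗≫ Je ◁ Jc := by
        rw [← h₁]; bicategory
      _ = (f ◁ t' ⊗≫ Jne ▷ b ⊗≫ Je ◁ Jc) := by rw [u'.inv_hom_id]; bicategory
      _ = _ := by rw [h₂]; simp [bicategoricalComp]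
  simpa only [bicategoricalComp, cancel_mono] using key

end

namespace CategoryTheory.Pseudofunctor

variable {B : Type u₁} [Bicategory.{w₁, v₁} B] {B' : Type u₂} [Bicategory.{w₂, v₂} B']
  (F : B ⥤ᵖ B')

lemma mapTriId_mor {z z' c c' : B} {a : c ⟶ z} {b : c' ⟶ z'} {f : z ⟶ z'} {g : c ⟶ c'} {e : z ⟶ c}
    {e' : z' ⟶ c'} (t : e ≫ a ≅ 𝟙 z) (t' : e' ≫ b ≅ 𝟙 z') (c : g ≫ b ≅ a ≫ f)
    (n : f ≫ e' ≅ e ≫ g)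
    (h : f ◁ t'.inv ⊗≫ n.hom ▷ b ⊗≫ e ◁ c.hom =
      (ρ_ _).hom ≫ (λ_ _).inv ≫ t.inv ▷ f ≫ (α_ _ _ _).hom) :
    F.map f ◁ (F.mapTriId t').inv ⊗≫ (F.mapSq n).hom ▷ F.map b ⊗≫ F.map e ◁ (F.mapSq c).hom =
      (ρ_ _).hom ≫ (λ_ _).inv ≫ (F.mapTriId t).inv ▷ F.map f ≫ (α_ _ _ _).hom := by
  have h' := congrArg (fun ξ => F.map f ◁ (F.mapId _).inv ≫ (F.mapComp f (𝟙 _)).inv ≫ F.map₂ ξ ≫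
    (F.mapComp e (a ≫ f)).hom ≫ F.map e ◁ (F.mapComp a f).hom) h
  simp [bicategoricalComp, Pseudofunctor.map₂_assoc_inv, Pseudofunctor.map₂_lunit_inv] at h'
  simpa [bicategoricalComp] using h'

/-- The image of the 2-cell of a composite, where `κ ≫ a` and `κ' ≫ b` are composites. -/
lemma mapSq_mor {y y' c c' z z' : B} {κ : y ⟶ c} {κ' : y' ⟶ c'} {a : c ⟶ z} {b : c' ⟶ z'}
    {f : z ⟶ z'} {g : c ⟶ c'} {h : y ⟶ y'} (n : h ≫ κ' ≅ κ ≫ g) (θ : g ≫ b ≅ a ≫ f) :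
    (F.mapSq (f := h) (g := κ' ≫ b) (h := κ ≫ a) (k := f)
      ((α_ h κ' b).symm ≪≫ whiskerRightIso n b ≪⊗≫ whiskerLeftIso κ θ ≪⊗≫
        Iso.refl ((κ ≫ a) ≫ f))).hom ⊗≫
      (F.mapComp κ a).hom ▷ F.map f ⊗≫ 𝟙 (F.map κ ≫ F.map a ≫ F.map f) =
    F.map h ◁ (F.mapComp κ' b).hom ⊗≫ (F.mapSq n).hom ▷ F.map b ⊗≫ F.map κ ◁ (F.mapSq θ).hom := by
  simp [bicategoricalComp, bicategoricalIsoComp, Pseudofunctor.map₂_assoc_inv]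

end CategoryTheory.Pseudofunctor

namespace PseudomonadMor

open Pseudomonad

variable {B : Type u₁} [Bicategory.{w₁, v₁} B] {B' : Type u₂} [Bicategory.{w₂, v₂} B']
  {J : B ⥤ᵖ B'} {S : Pseudomonad B} {S' : Pseudomonad B'} (K : PseudomonadMor J S S')

/-- The comparison `S' (J X) ⟶ J (S X)` is a pseudomorphism of pseudoalgebras. -/
def appMor (X : B) : MorStr (S'.freeAlg (J.obj X)) (K.mapAlg (S.freeAlg X)) (K.app X) where
  cell := (K.cells.mul X).symm
  cell_assoc := app_assoc_aux (K.cells.mul X) (S'.fn.mapSq (K.cells.mul X)) (S'.mNat (K.app X))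
    (K.cells.mul (S.obj X)) (K.algAssoc_mul (S.freeAlg X)) (K.coherence.mul_assoc X)
  cell_unit := app_unit_aux (K.cells.mul X) (S'.eNat (K.app X)) (K.cells.unit (S.obj X))
    (K.coherence.mul_left X)

variable {A A' A'' : B} {a : S.Alg A} {a' : S.Alg A'} {a'' : S.Alg A''}

/-- The image of a pseudomorphism under a morphism of pseudomonads. -/
def mapMor {f : A ⟶ A'} (F : MorStr a a' f) : MorStr (K.mapAlg a) (K.mapAlg a') (J.map f) where
  cell := (α_ _ _ _).symm ≪≫ whiskerRightIso (K.nat f) (J.map a'.str) ≪⊗≫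
    whiskerLeftIso (K.app A) (J.mapSq F.cell) ≪⊗≫
      Iso.refl ((K.app A ≫ J.map a.str) ≫ J.map f)
  cell_assoc := by
    have h := F.cell_assoc
    rw [← cancel_epi (α_ _ _ _).hom, Iso.hom_inv_id_assoc] at h
    exact mor_assoc_aux (K.cells.mul A) (K.algAssoc_mul a) (K.algAssoc_mul a')
      (Pseudofunctor.mapSq_mor S'.fn (K.nat f) (J.mapSq F.cell)) (K.nat_sq F.cell)
      (Pseudofunctor.mapSq_cube J _ _ _ _ _ _ h.symm) (K.coherence.mul_natural f)
  cell_unit := mor_unit_aux (K.cells.unit A) (K.cells.unit A') (K.coherence.unit_natural f)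
    (Pseudofunctor.mapTriId_mor J _ _ F.cell (S.eNat f) F.cell_unit)

/-- With the next two lemmas this makes `mapMor` pseudofunctorial within algebra 2-cells. Each
pastes the matching pseudonaturality law of `K` with an equation `h` for the images of the structure
cells under `J`. -/
lemma isAlgCell_map₂ {f g : A ⟶ A'} {F : MorStr a a' f} {G : MorStr a a' g} {φ : f ⟶ g}
    (hφ : IsAlgCell F G φ) : IsAlgCell (K.mapMor F) (K.mapMor G) (J.map₂ φ) := by
  have h : J.map₂ (S.fn.map₂ φ) ▷ J.map a'.str ≫ (J.mapSq G.cell).hom =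
      (J.mapSq F.cell).hom ≫ J.map a.str ◁ J.map₂ φ := by
    have h' := congrArg (fun ξ => (J.mapComp _ _).inv ≫ J.map₂ ξ ≫ (J.mapComp _ _).hom) hφ
    simp at h'
    simpa using h'
  have aux {y y' c c' z z' : B'} {κ : y ⟶ c} {κ' : y' ⟶ c'} {p : c ⟶ z} {q : c' ⟶ z'}
      {f g : z ⟶ z'} {Sf Sg : y ⟶ y'} {JSf JSg : c ⟶ c'} {nf : Sf ≫ κ' ⟶ κ ≫ JSf}
      {ng : Sg ≫ κ' ⟶ κ ≫ JSg} {cf : JSf ≫ q ⟶ p ≫ f} {cg : JSg ≫ q ⟶ p ≫ g} {φ : f ⟶ g}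
      {Sφ : Sf ⟶ Sg} {JSφ : JSf ⟶ JSg} (h₁ : Sφ ▷ κ' ≫ ng = nf ≫ κ ◁ JSφ)
      (h₂ : JSφ ▷ q ≫ cg = cf ≫ p ◁ φ) :
      Sφ ▷ (κ' ≫ q) ≫ (α_ _ _ _).inv ≫ ng ▷ q ⊗≫ κ ◁ cg ⊗≫ 𝟙 ((κ ≫ p) ≫ g) =
        ((α_ _ _ _).inv ≫ nf ▷ q ⊗≫ κ ◁ cf ⊗≫ 𝟙 ((κ ≫ p) ≫ f)) ≫ (κ ≫ p) ◁ φ := by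
    calc
      _ = 𝟙 _ ⊗≫ (Sφ ▷ κ' ≫ ng) ▷ q ⊗≫ κ ◁ cg ⊗≫ 𝟙 ((κ ≫ p) ≫ g) := by bicategory
      _ = 𝟙 _ ⊗≫ nf ▷ q ⊗≫ κ ◁ (JSφ ▷ q ≫ cg) ⊗≫ 𝟙 ((κ ≫ p) ≫ g) := by rw [h₁]; bicategory
      _ = _ := by rw [h₂]; bicategory
  exact aux (K.nat_natural φ) h

lemma isAlgCell_mapComp {f : A ⟶ A'} {g : A' ⟶ A''} (F : MorStr a a' f) (G : MorStr a' a'' g) :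
    IsAlgCell (K.mapMor (F.comp G)) ((K.mapMor F).comp (K.mapMor G)) (J.mapComp f g).hom := by
  have h : (J.mapSq (F.comp G).cell).hom ≫ J.map a.str ◁ (J.mapComp f g).hom =
      J.map₂ (S.fn.mapComp f g).hom ▷ J.map a''.str ≫ (J.mapComp (S.map f) (S.map g)).hom ▷ _ ≫
        (α_ _ _ _).hom ≫ J.map (S.map f) ◁ (J.mapSq G.cell).hom ≫ (α_ _ _ _).inv ≫
        (J.mapSq F.cell).hom ▷ J.map g ≫ (α_ _ _ _).hom := by
    simp [MorStr.comp, Pseudofunctor.map₂_assoc_inv]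
  have aux {y₁ y₂ y₃ c₁ c₂ c₃ z₁ z₂ z₃ : B'} {κ₁ : y₁ ⟶ c₁} {κ₂ : y₂ ⟶ c₂} {κ₃ : y₃ ⟶ c₃}
      {p₁ : c₁ ⟶ z₁} {p₂ : c₂ ⟶ z₂} {p₃ : c₃ ⟶ z₃} {f : z₁ ⟶ z₂} {g : z₂ ⟶ z₃} {k : z₁ ⟶ z₃}
      {Sf : y₁ ⟶ y₂} {Sg : y₂ ⟶ y₃} {Sk : y₁ ⟶ y₃} {φ : k ⟶ f ≫ g}
      {JSf : c₁ ⟶ c₂} {JSg : c₂ ⟶ c₃} {JSk : c₁ ⟶ c₃} {nf : Sf ≫ κ₂ ⟶ κ₁ ≫ JSf}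
      {ng : Sg ≫ κ₃ ⟶ κ₂ ≫ JSg} {nk : Sk ≫ κ₃ ⟶ κ₁ ≫ JSk} {cf : JSf ≫ p₂ ⟶ p₁ ≫ f}
      {cg : JSg ≫ p₃ ⟶ p₂ ≫ g} {ck : JSk ≫ p₃ ⟶ p₁ ≫ k} {T : y₁ ⟶ y₃}
      {σ : Sk ⟶ T} {τ : T ⟶ Sf ≫ Sg} {T' : c₁ ⟶ c₃}
      {σ' : JSk ⟶ T'} {τ' : T' ⟶ JSf ≫ JSg}
      (h₁ : nk ≫ κ₁ ◁ (σ' ≫ τ') = (σ ≫ τ) ▷ κ₃ ≫ (α_ _ _ _).hom ≫ Sf ◁ ng ≫ (α_ _ _ _).inv ≫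
        nf ▷ JSg ≫ (α_ _ _ _).hom)
      (h₂ : ck ≫ p₁ ◁ φ = σ' ▷ p₃ ≫ τ' ▷ p₃ ≫ (α_ _ _ _).hom ≫ JSf ◁ cg ≫ (α_ _ _ _).inv ≫
        cf ▷ g ≫ (α_ _ _ _).hom) :
      σ ▷ (κ₃ ≫ p₃) ≫ (τ ▷ (κ₃ ≫ p₃) ≫ (α_ _ _ _).hom ≫
          Sf ◁ ((α_ _ _ _).inv ≫ ng ▷ p₃ ⊗≫ κ₂ ◁ cg ⊗≫ 𝟙 ((κ₂ ≫ p₂) ≫ g)) ≫ (α_ _ _ _).inv ≫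
          ((α_ _ _ _).inv ≫ nf ▷ p₂ ⊗≫ κ₁ ◁ cf ⊗≫ 𝟙 ((κ₁ ≫ p₁) ≫ f)) ▷ g ≫ (α_ _ _ _).hom) =
        ((α_ _ _ _).inv ≫ nk ▷ p₃ ⊗≫ κ₁ ◁ ck ⊗≫ 𝟙 ((κ₁ ≫ p₁) ≫ k)) ≫ (κ₁ ≫ p₁) ◁ φ := by
    symm
    calc
      _ = 𝟙 _ ⊗≫ nk ▷ p₃ ⊗≫ κ₁ ◁ (ck ≫ p₁ ◁ φ) ⊗≫ 𝟙 _ := by bicategory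
      _ = 𝟙 _ ⊗≫ (nk ≫ κ₁ ◁ (σ' ≫ τ')) ▷ p₃ ⊗≫ κ₁ ◁ (JSf ◁ cg ≫ (α_ _ _ _).inv ≫
        cf ▷ g ≫ (α_ _ _ _).hom) ⊗≫ 𝟙 _ := by rw [h₂]; bicategory
      _ = 𝟙 _ ⊗≫ (σ ≫ τ) ▷ (κ₃ ≫ p₃) ⊗≫ Sf ◁ ng ▷ p₃ ⊗≫ (nf ▷ (JSg ≫ p₃) ≫ (κ₁ ≫ JSf) ◁ cg) ⊗≫
        κ₁ ◁ cf ▷ g ⊗≫ 𝟙 _ := by rw [h₁]; bicategory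
      _ = _ := by rw [← whisker_exchange]; bicategory
  exact aux (K.nat_comp f g) h

lemma isAlgCell_mapId (a : S.Alg A) :
    IsAlgCell (K.mapMor (MorStr.id a)) (MorStr.id (K.mapAlg a)) (J.mapId A).hom := by
  have h : (J.mapSq (MorStr.id a).cell).hom ≫ J.map a.str ◁ (J.mapId A).hom =
      J.map₂ (S.fn.mapId A).hom ▷ J.map a.str ≫ (J.mapId (S.obj A)).hom ▷ J.map a.str ≫
        (λ_ _).hom ≫ (ρ_ _).inv := by
    simp [MorStr.id, Pseudofunctor.map₂_runit_inv]
  have aux {y c z : B'} {κ : y ⟶ c} {p : c ⟶ z} {k : z ⟶ z} {Sk T : y ⟶ y} {JSk T' : c ⟶ c}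
      {nk : Sk ≫ κ ⟶ κ ≫ JSk} {ck : JSk ≫ p ⟶ p ≫ k} {φ : k ⟶ 𝟙 z} {σ : Sk ⟶ T} {τ : T ⟶ 𝟙 y}
      {σ' : JSk ⟶ T'} {τ' : T' ⟶ 𝟙 c}
      (h₁ : nk ≫ κ ◁ σ' ≫ κ ◁ τ' = σ ▷ κ ≫ τ ▷ κ ≫ (λ_ _).hom ≫ (ρ_ _).inv)
      (h₂ : ck ≫ p ◁ φ = σ' ▷ p ≫ τ' ▷ p ≫ (λ_ _).hom ≫ (ρ_ _).inv) :
      σ ▷ (κ ≫ p) ≫ (τ ▷ (κ ≫ p) ≫ (λ_ _).hom ≫ (ρ_ _).inv) =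
        ((α_ _ _ _).inv ≫ nk ▷ p ⊗≫ κ ◁ ck ⊗≫ 𝟙 ((κ ≫ p) ≫ k)) ≫ (κ ≫ p) ◁ φ := by
    symm
    calc
      _ = 𝟙 _ ⊗≫ nk ▷ p ⊗≫ κ ◁ (ck ≫ p ◁ φ) ⊗≫ 𝟙 _ := by bicategory
      _ = 𝟙 _ ⊗≫ (nk ≫ κ ◁ σ' ≫ κ ◁ τ') ▷ p ⊗≫ 𝟙 _ := by rw [h₂]; bicategory
      _ = _ := by rw [h₁]; bicategory
  exact aux (K.nat_id A) h

end PseudomonadMor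

/-! ### Pseudoalgebras equivalent to free ones -/

namespace Pseudomonad

variable {B : Type u₁} [Bicategory.{w₁, v₁} B] {S : Pseudomonad B} {A A' A'' : B}
  {a : S.Alg A} {a' : S.Alg A'} {a'' : S.Alg A''}

/-- Whiskering with an equivalence reflects algebra 2-cells. -/
lemma IsAlgCell.of_whiskerLeft {u : A ⟶ A'} (hu : IsEquivalence u) (U : MorStr a a' u)
    {g h : A' ⟶ A''} {G : MorStr a' a'' g} {H : MorStr a' a'' h} {φ : g ⟶ h}
    (hφ : IsAlgCell (U.comp G) (U.comp H) (u ◁ φ)) : IsAlgCell G H φ := by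
  have hSu : IsEquivalence (S.map u) := hu.map S.fn
  unfold IsAlgCell at *
  have key : ((S.fn.mapComp u g).hom ▷ a''.str ≫ (α_ _ _ _).hom) ≫
      S.map u ◁ (S.fn.map₂ φ ▷ a''.str ≫ H.cell.hom) ≫
      ((α_ _ _ _).inv ≫ U.cell.hom ▷ h ≫ (α_ _ _ _).hom) =
      ((S.fn.mapComp u g).hom ▷ a''.str ≫ (α_ _ _ _).hom) ≫
      S.map u ◁ (G.cell.hom ≫ a'.str ◁ φ) ≫
      ((α_ _ _ _).inv ≫ U.cell.hom ▷ h ≫ (α_ _ _ _).hom) := by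
    calc
      _ = S.fn.map₂ (u ◁ φ) ▷ a''.str ≫ (U.comp H).cell.hom := by
        simp [MorStr.comp]
      _ = (S.fn.mapComp u g).hom ▷ a''.str ⊗≫ S.map u ◁ G.cell.hom ⊗≫
          (U.cell.hom ▷ g ≫ (a.str ≫ u) ◁ φ) ⊗≫ 𝟙 _ := by
        rw [hφ]; simp [MorStr.comp, bicategoricalComp]
      _ = _ := by rw [← whisker_exchange]; bicategory
  exact hSu.whiskerLeft_injective (by simpa only [cancel_epi, cancel_mono] using key)

end Pseudomonad

namespace TwoMonad

open Pseudomonad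

variable {B : Type u₁} [Bicategory.{w₁, v₁} B] [Bicategory.Strict B] {S : TwoMonad B}
  {X Y Z : B} {y : S.Alg Y} {z : S.Alg Z} {k : S.obj X ⟶ Y} {j : X ⟶ Y}

/-! A pseudoalgebra equivalent to a free one is free. -/

/-- Whiskering with the equivalence `k` is faithful and reduces the claim to the free algebra; `ι`
exchanges restriction along `S.e X ≫ k` for restriction along `j`. -/
lemma free_hom_ext_of_isEquivalence (hk : IsEquivalence k) (U : MorStr (S.freeAlg X) y k)
    (ι : S.e X ≫ k ≅ j) {g h : Y ⟶ Z} {G : MorStr y z g} {H : MorStr y z h} {φ ψ : g ⟶ h}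
    (hφ : IsAlgCell G H φ) (hψ : IsAlgCell G H ψ) (e : j ◁ φ = j ◁ ψ) : φ = ψ := by
  refine hk.whiskerLeft_injective (free_hom_ext (hφ.whiskerLeft U) (hψ.whiskerLeft U) ?_)
  have key (χ : g ⟶ h) : S.e X ◁ k ◁ χ =
      (α_ _ _ _).inv ≫ ι.hom ▷ g ≫ j ◁ χ ≫ ι.inv ▷ h ≫ (α_ _ _ _).hom := by
    rw [whisker_exchange_assoc]; simp
  rw [key, key, e]

lemma exists_free_lift_of_isEquivalence (hk : IsEquivalence k) (U : MorStr (S.freeAlg X) y k)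
    (ι : S.e X ≫ k ≅ j) {g h : Y ⟶ Z} (G : MorStr y z g) (H : MorStr y z h)
    (σ : j ≫ g ⟶ j ≫ h) : ∃ φ : g ⟶ h, IsAlgCell G H φ ∧ j ◁ φ = σ := by
  obtain ⟨χ, hχ, e⟩ := exists_free_lift (U.comp G) (U.comp H)
    ((α_ _ _ _).inv ≫ ι.hom ▷ g ≫ σ ≫ ι.inv ▷ h ≫ (α_ _ _ _).hom)
  obtain ⟨φ, rfl⟩ := hk.exists_whiskerLeft χ
  refine ⟨φ, .of_whiskerLeft hk U hχ, ?_⟩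
  have key : S.e X ◁ k ◁ φ =
      (α_ _ _ _).inv ≫ ι.hom ▷ g ≫ j ◁ φ ≫ ι.inv ▷ h ≫ (α_ _ _ _).hom := by
    rw [whisker_exchange_assoc]; simp
  rw [key] at e
  simpa only [cancel_epi, cancel_mono] using e

/-- On the free algebra the extension of `f` is `S.map f ≫ z.str`. It factors through the
equivalence `k`, and the factor inherits a pseudomorphism structure by descent. -/
lemma exists_free_ext_of_isEquivalence (hk : IsEquivalence k) (U : MorStr (S.freeAlg X) y k)
    (ι : S.e X ≫ k ≅ j) (z : S.Alg Z) (f : X ⟶ Z) :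
    ∃ g : Y ⟶ Z, Nonempty (MorStr y z g) ∧ Nonempty (f ≅ j ≫ g) := by
  obtain ⟨g, ⟨τ⟩⟩ := hk.exists_iso (S.map f ≫ z.str)
  obtain ⟨H, -⟩ := MorStr.exists_of_comp_isEquivalence hk U
    (((S.freeMor f).comp z.strMor).ofIso τ)
  exact ⟨g, ⟨H⟩, ⟨z.eStr f ≪≫ whiskerLeftIso (S.e X) τ ≪≫ (α_ _ _ _).symm ≪≫
    whiskerRightIso ι g⟩⟩

/-- The free algebra of a 2-monad is strict. -/
abbrev freeStrictAlg (S : TwoMonad B) (X : B) : StrictAlg S.toPseudomonad where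
  carrier := S.obj X
  alg := S.freeAlg X
  isStrict := ⟨S.assoc_eq X, S.left_eq X⟩

end TwoMonad

/-! ### The displayed Kleisli bicategory of a lifting and its free objects -/

namespace PseudoLifting

open Pseudomonad

variable {C : Type u₁} [Bicategory.{w₁, v₁} C] [Bicategory.Strict C] {D : Type u₂}
  [Bicategory.{w₂, v₂} D] [Bicategory.Strict D] {J : C ⥤ᵖ D} {T : RelPseudomonad J}
  {S : TwoMonad D} {R : RestrictsAlong J S} (L : PseudoLifting T R)

/-- The Kleisli bicategory of the lifted relative pseudomonad, displayed over the Kleisli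
bicategory. -/
def structuredBicat :
    StructuredBicat.{w₂, w₂} (fun A : StrictAlg R.monad.toPseudomonad => T.toKl A.carrier) where
  Str {A B} (f : J.obj A.carrier ⟶ T.obj B.carrier) := MorStr (R.mor.mapAlg A.alg) (L.alg B) f
  IsCell F G φ := IsAlgCell F G φ
  id A := L.unitStr A
  comp F G := MorStr.comp F (L.extStr G)
  isCell_id F := isAlgCell_id F
  isCell_comp h h' := IsAlgCell.comp h h'
  isCell_inv h := IsAlgCell.inv h
  isCell_whiskerLeft F _ _ _ _ _ h := (L.ext_cell _ _ _ h).whiskerLeft F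
  isCell_whiskerRight H h := IsAlgCell.whiskerRight (L.extStr H) h
  -- The Kleisli associator is the associator of `D` followed by an inverse of `μ`, and the unitors
  -- come from `η` and `θ`, so the three conditions on the structural cells of a lifting are
  -- consumed here and in the next two fields.
  isCell_associator F G H := IsAlgCell.comp (isAlgCell_associator F (L.extStr G) (L.extStr H))
    ((L.mu_cell G H).inv.whiskerLeft F)
  isCell_leftUnitor F := (L.eta_cell F).inv
  isCell_rightUnitor F := ((L.theta_cell _).whiskerLeft F).comp (isAlgCell_rightUnitor F)

/-- Composition with the image of a morphism of `C` in the Kleisli bicategory. -/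
def freeCompIso {X Y : C} (f : X ⟶ Y) {Z : C} (h : J.obj Y ⟶ T.obj Z) :
    (J.map f ≫ T.unit Y) ≫ T.ext.obj h ≅ J.map f ≫ h :=
  α_ _ _ _ ≪≫ whiskerLeftIso (J.map f) (T.eta h).symm

/-- Naturality of `η` removes the extension functor. This carries the universal property along `J (e
X)` in `D` over to its image in the Kleisli bicategory. -/
lemma freeCompIso_natural {X Y : C} (f : X ⟶ Y) {Z : C} {h h' : J.obj Y ⟶ T.obj Z}
    (φ : h ⟶ h') :
    (J.map f ≫ T.unit Y) ◁ T.ext.map φ =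
      (freeCompIso f h).hom ≫ J.map f ◁ φ ≫ (freeCompIso f h').inv := by
  have h₁ : T.unit Y ◁ T.ext.map φ = (T.eta h).inv ≫ φ ≫ (T.eta h').hom := by
    rw [T.eta_natural, Iso.inv_hom_id_assoc]
  rw [comp_whiskerLeft, h₁]
  simp only [freeCompIso, Iso.trans_hom, Iso.trans_inv, whiskerLeftIso_hom, whiskerLeftIso_inv,
    Iso.symm_hom, Iso.symm_inv, whiskerLeft_comp, Category.assoc]

end PseudoLifting

namespace PseudoLifting

open Pseudomonad

variable {C : Type u₁} [Bicategory.{w₁, v₁} C] [Bicategory.Strict C] {D : Type u₂}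
  [Bicategory.{w₂, v₂} D] [Bicategory.Strict D] {J : C ⥤ᵖ D} {T : RelPseudomonad J}
  {S : TwoMonad D} {R : RestrictsAlong J S} (L : PseudoLifting T R)

section

variable {X : C} {A : StrictAlg R.monad.toPseudomonad}

/-- The component of `R.mor` at `X` is an equivalence and a pseudomorphism out of the free algebra
on `J X`, and it takes the unit to `J (e X)`. The results on algebras equivalent to free ones
therefore apply with `j = J (e X)`, here and in the next two lemmas. -/
lemma exists_ext (f : J.obj X ⟶ T.obj A.carrier) : ∃ g : J.obj (R.monad.obj X) ⟶ T.obj A.carrier,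
    Nonempty (MorStr (R.mor.mapAlg (R.monad.freeAlg X)) (L.alg A) g) ∧
      Nonempty (f ≅ J.map (R.monad.e X) ≫ g) :=
  TwoMonad.exists_free_ext_of_isEquivalence (R.equiv X) (R.mor.appMor X) (R.mor.cells.unit X)
    (L.alg A) f

variable {g h : J.obj (R.monad.obj X) ⟶ T.obj A.carrier}

lemma exists_lift (G : MorStr (R.mor.mapAlg (R.monad.freeAlg X)) (L.alg A) g)
    (H : MorStr (R.mor.mapAlg (R.monad.freeAlg X)) (L.alg A) h)
    (σ : (J.map (R.monad.e X) ≫ T.unit _) ≫ T.ext.obj g ⟶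
      (J.map (R.monad.e X) ≫ T.unit _) ≫ T.ext.obj h) :
    ∃ φ : g ⟶ h, IsAlgCell G H φ ∧ (J.map (R.monad.e X) ≫ T.unit _) ◁ T.ext.map φ = σ := by
  obtain ⟨φ, hφ, e⟩ := TwoMonad.exists_free_lift_of_isEquivalence (R.equiv X) (R.mor.appMor X)
    (R.mor.cells.unit X) G H ((freeCompIso _ g).inv ≫ σ ≫ (freeCompIso _ h).hom)
  refine ⟨φ, hφ, ?_⟩
  rw [freeCompIso_natural, e]
  simp only [Category.assoc, Iso.hom_inv_id_assoc, Iso.hom_inv_id, Category.comp_id]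

lemma lift_ext {G : MorStr (R.mor.mapAlg (R.monad.freeAlg X)) (L.alg A) g}
    {H : MorStr (R.mor.mapAlg (R.monad.freeAlg X)) (L.alg A) h} {φ ψ : g ⟶ h}
    (hφ : IsAlgCell G H φ) (hψ : IsAlgCell G H ψ)
    (e : (J.map (R.monad.e X) ≫ T.unit _) ◁ T.ext.map φ =
      (J.map (R.monad.e X) ≫ T.unit _) ◁ T.ext.map ψ) : φ = ψ := by
  refine TwoMonad.free_hom_ext_of_isEquivalence (R.equiv X) (R.mor.appMor X)
    (R.mor.cells.unit X) hφ hψ ?_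
  rw [freeCompIso_natural, freeCompIso_natural] at e
  simpa only [cancel_epi, cancel_mono] using e

end

/-- Free algebras of the restricted 2-monad are free in the displayed Kleisli bicategory. -/
noncomputable def freeObjects : FreeObjects L.structuredBicat where
  -- The displayed bicategory contains strict algebras only, so strictness of the free algebra is
  -- essential.
  free X := R.monad.freeStrictAlg (T.ofKl X)
  e X := T.free.map (R.monad.e (T.ofKl X))
  ext {X A} f := (L.exists_ext (X := T.ofKl X) (A := A) f).choose
  extStr {X A} f := (L.exists_ext (X := T.ofKl X) (A := A) f).choose_spec.1.some
  eta {X A} f := (L.exists_ext (X := T.ofKl X) (A := A) f).choose_spec.2.some ≪≫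
    (freeCompIso _ _).symm
  lift {_ A _ _} H H' σ := (L.exists_lift (A := A) H H' σ).choose
  isCell_lift {_ A _ _} H H' σ := (L.exists_lift (A := A) H H' σ).choose_spec.1
  e_lift {_ A _ _} H H' σ := (L.exists_lift (A := A) H H' σ).choose_spec.2
  hom_ext {_ A _ _ _ _ _ _} hφ hψ e := L.lift_ext (A := A) hφ hψ e

end PseudoLifting

/-! ### Comparison of the free algebras of a 2-monad with free objects -/

open Pseudomonad in
/-- Data that exhibit the free objects of a displayed bicategory `𝔸` over `K` as images of the free
algebras of a 2-monad `M` on `C` under a pseudofunctor `L` from `C` to `K`: pseudomorphisms between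
strict `M`-algebras are sent to structured morphisms, pseudofunctorially, and there are structured
morphisms `k X` from the free object on `L X` to `L (M X)` that are compatible with the units. -/
structure AlgComparison {C : Type u₁} [Bicategory.{w₁, v₁} C] [Bicategory.Strict C]
    (M : TwoMonad C) {K : Type u₂} [Bicategory.{w₂, v₂} K] (L : C ⥤ᵖ K)
    {𝔸 : StructuredBicat.{w₂, w₃} (fun A : StrictAlg M.toPseudomonad => L.obj A.carrier)}
    (𝔽 : FreeObjects 𝔸) where
  str {A B : StrictAlg M.toPseudomonad} {f : A.carrier ⟶ B.carrier} (F : MorStr A.alg B.alg f) :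
    𝔸.Str (A := A) (B := B) (L.map f)
  isCell_map₂ {A B : StrictAlg M.toPseudomonad} {f g : A.carrier ⟶ B.carrier}
    {F : MorStr A.alg B.alg f} {G : MorStr A.alg B.alg g} {φ : f ⟶ g} (hφ : IsAlgCell F G φ) :
    𝔸.IsCell (str F) (str G) (L.map₂ φ)
  isCell_mapComp {A B E : StrictAlg M.toPseudomonad} {f : A.carrier ⟶ B.carrier}
    {g : B.carrier ⟶ E.carrier} (F : MorStr A.alg B.alg f) (G : MorStr B.alg E.alg g) :
    𝔸.IsCell (str (F.comp G)) (𝔸.comp (str F) (str G)) (L.mapComp f g).hom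
  isCell_mapId (A : StrictAlg M.toPseudomonad) :
    𝔸.IsCell (str (MorStr.id A.alg)) (𝔸.id A) (L.mapId A.carrier).hom
  k (X : C) : 𝔽.S (L.obj X) ⟶ L.obj (M.obj X)
  kStr (X : C) : 𝔸.Str (A := 𝔽.free (L.obj X)) (B := M.freeStrictAlg X) (k X)
  unit (X : C) : 𝔽.e (L.obj X) ≫ k X ≅ L.map (M.e X)

namespace AlgComparison

open Pseudomonad

variable {C : Type u₁} [Bicategory.{w₁, v₁} C] [Bicategory.Strict C]
  {M : TwoMonad C} {K : Type u₂} [Bicategory.{w₂, v₂} K] {L : C ⥤ᵖ K}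
  {𝔸 : StructuredBicat.{w₂, w₃} (fun A : StrictAlg M.toPseudomonad => L.obj A.carrier)}
  {𝔽 : FreeObjects 𝔸} (Q : AlgComparison M L 𝔽)

/-- The image of the pseudomorphism of free algebras `M f`. -/
def freeStr {X Y : C} (f : X ⟶ Y) :
    𝔸.Str (A := M.freeStrictAlg X) (B := M.freeStrictAlg Y) (L.map (M.map f)) :=
  Q.str (A := M.freeStrictAlg X) (B := M.freeStrictAlg Y) (M.freeMor f)

/-- The image of the structure map of an algebra. -/
def strStr (A : StrictAlg M.toPseudomonad) :
    𝔸.Str (A := M.freeStrictAlg A.carrier) (B := A) (L.map A.alg.str) :=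
  Q.str (A := M.freeStrictAlg A.carrier) (B := A) A.alg.strMor

/-- Pseudonaturality of the comparison. -/
def kN {X Y : C} (f : X ⟶ Y) : 𝔽.map (L.map f) ≫ Q.k Y ≅ Q.k X ≫ L.map (M.map f) :=
  𝔽.liftIso (A := M.freeStrictAlg Y) (𝔸.comp (𝔽.mapStr (L.map f)) (Q.kStr Y))
    (𝔸.comp (Q.kStr X) (Q.freeStr f))
    ((α_ _ _ _).symm ≪≫ whiskerRightIso (𝔽.eN (L.map f)).symm (Q.k Y) ≪≫ α_ _ _ _ ≪≫
      whiskerLeftIso (L.map f) (Q.unit Y) ≪≫ L.mapSq (M.eNat f) ≪≫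
      whiskerRightIso (Q.unit X).symm (L.map (M.map f)) ≪≫ α_ _ _ _)

lemma isCell_kN {X Y : C} (f : X ⟶ Y) :
    𝔸.IsCell (A := 𝔽.free (L.obj X)) (B := M.freeStrictAlg Y)
      (𝔸.comp (𝔽.mapStr (L.map f)) (Q.kStr Y)) (𝔸.comp (Q.kStr X) (Q.freeStr f)) (Q.kN f).hom :=
  𝔽.isCell_lift _ _ _

/-- The defining equation of `kN` as a lift. It doubles as naturality of the unit comparison, and
every law for `kN` is checked against it. -/
lemma unit_kN {X Y : C} (f : X ⟶ Y) :
    (𝔽.eN (L.map f)).hom ▷ Q.k Y ≫ (α_ _ _ _).hom ≫ 𝔽.e (L.obj X) ◁ (Q.kN f).hom ≫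
        (α_ _ _ _).inv ≫ (Q.unit X).hom ▷ L.map (M.map f) =
      (α_ _ _ _).hom ≫ L.map f ◁ (Q.unit Y).hom ≫ (L.mapSq (M.eNat f)).hom := by
  have h : 𝔽.e (L.obj X) ◁ (Q.kN f).hom = _ :=
    𝔽.e_lift (A := M.freeStrictAlg Y) _ _ _
  rw [h]
  simp

/-- The comparison identifies the image of the structure map of an algebra with the action. -/
def kAct (A : StrictAlg M.toPseudomonad) : Q.k A.carrier ≫ L.map A.alg.str ≅ 𝔽.act A :=
  𝔽.liftIso (A := A) (𝔸.comp (Q.kStr A.carrier) (Q.strStr A)) (𝔽.actStr A)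
    ((α_ _ _ _).symm ≪≫ whiskerRightIso (Q.unit A.carrier) (L.map A.alg.str) ≪≫
      L.mapTriId A.alg.unit.symm ≪≫ 𝔽.actUnit A)

lemma isCell_kAct (A : StrictAlg M.toPseudomonad) :
    𝔸.IsCell (A := 𝔽.free (L.obj A.carrier)) (B := A)
      (𝔸.comp (Q.kStr A.carrier) (Q.strStr A)) (𝔽.actStr A) (Q.kAct A).hom :=
  𝔽.isCell_lift _ _ _

lemma e_kAct (A : StrictAlg M.toPseudomonad) :
    𝔽.e (L.obj A.carrier) ◁ (Q.kAct A).hom = (α_ _ _ _).inv ≫ (Q.unit A.carrier).hom ▷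
      L.map A.alg.str ≫ (L.mapTriId A.alg.unit.symm).hom ≫ (𝔽.actUnit A).hom :=
  𝔽.e_lift _ _ _

lemma isCell_mapSq {A B E V : StrictAlg M.toPseudomonad} {f : A.carrier ⟶ B.carrier}
    {g : B.carrier ⟶ V.carrier} {f' : A.carrier ⟶ E.carrier} {g' : E.carrier ⟶ V.carrier}
    {F : MorStr A.alg B.alg f} {G : MorStr B.alg V.alg g} {F' : MorStr A.alg E.alg f'}
    {G' : MorStr E.alg V.alg g'} {θ : f ≫ g ≅ f' ≫ g'}
    (hθ : IsAlgCell (F.comp G) (F'.comp G') θ.hom) :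
    𝔸.IsCell (𝔸.comp (Q.str F) (Q.str G)) (𝔸.comp (Q.str F') (Q.str G')) (L.mapSq θ).hom :=
  𝔸.isCell_comp (𝔸.isCell_inv (Q.isCell_mapComp F G))
    (𝔸.isCell_comp (Q.isCell_map₂ hθ) (Q.isCell_mapComp F' G'))

section

variable {X Y Z : C}

/-- By uniqueness of lifts: along the universal arrow the equation turns into `h`, the image under
`L` of naturality of the unit of `M`. The pasting itself is isolated in `aux`. -/
lemma kN_natural {f g : X ⟶ Y} (φ : f ⟶ g) :
    𝔽.map₂ (L.map₂ φ) ▷ Q.k Y ≫ (Q.kN g).hom =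
      (Q.kN f).hom ≫ Q.k X ◁ L.map₂ (M.fn.map₂ φ) := by
  refine 𝔽.hom_ext (A := M.freeStrictAlg Y) (𝔸.isCell_comp (𝔸.isCell_whiskerRight _
      (𝔽.isCell_map₂ _)) (Q.isCell_kN g)) (𝔸.isCell_comp (Q.isCell_kN f)
      (𝔸.isCell_whiskerLeft _ (Q.isCell_map₂ (Pseudomonad.isAlgCell_map₂ φ)))) ?_
  have h : L.map₂ φ ▷ L.map (M.e Y) ≫ (L.mapSq (M.eNat g)).hom =
      (L.mapSq (M.eNat f)).hom ≫ L.map (M.e X) ◁ L.map₂ (M.fn.map₂ φ) := by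
    have h' := congrArg (fun ξ => (L.mapComp _ _).inv ≫ L.map₂ ξ ≫ (L.mapComp _ _).hom)
      (M.eNat_natural φ)
    simp at h'
    simpa using h'
  have aux {x x' y y' l l' : K} {f g : x ⟶ y} {e : x ⟶ x'} {e' : y ⟶ y'} {Sf Sg : x' ⟶ y'}
      {k : x' ⟶ l} {k' : y' ⟶ l'} {j : x ⟶ l} {j' : y ⟶ l'} {Mf Mg : l ⟶ l'} {φ : f ⟶ g}
      {Sφ : Sf ⟶ Sg} {Mφ : Mf ⟶ Mg} (nf : f ≫ e' ≅ e ≫ Sf) {ng : g ≫ e' ⟶ e ≫ Sg}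
      {kf : Sf ≫ k' ⟶ k ≫ Mf} {kg : Sg ≫ k' ⟶ k ≫ Mg} (u : e ≫ k ≅ j) {u' : e' ≫ k' ⟶ j'}
      {qf : f ≫ j' ⟶ j ≫ Mf} {qg : g ≫ j' ⟶ j ≫ Mg}
      (h₁ : nf.hom ▷ k' ≫ (α_ _ _ _).hom ≫ e ◁ kf ≫ (α_ _ _ _).inv ≫ u.hom ▷ Mf =
        (α_ _ _ _).hom ≫ f ◁ u' ≫ qf)
      (h₂ : ng ▷ k' ≫ (α_ _ _ _).hom ≫ e ◁ kg ≫ (α_ _ _ _).inv ≫ u.hom ▷ Mg =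
        (α_ _ _ _).hom ≫ g ◁ u' ≫ qg)
      (h₃ : φ ▷ e' ≫ ng = nf.hom ≫ e ◁ Sφ) (h₄ : φ ▷ j' ≫ qg = qf ≫ j ◁ Mφ) :
      e ◁ (Sφ ▷ k' ≫ kg) = e ◁ (kf ≫ k ◁ Mφ) := by
    rw [← cancel_mono ((α_ _ _ _).inv ≫ u.hom ▷ Mg),
      ← cancel_epi (nf.hom ▷ k' ≫ (α_ _ _ _).hom)]
    calc
      _ = (nf.hom ≫ e ◁ Sφ) ▷ k' ≫ (α_ _ _ _).hom ≫ e ◁ kg ≫ (α_ _ _ _).inv ≫ u.hom ▷ Mg := by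
        bicategory
      _ = φ ▷ e' ▷ k' ≫ (ng ▷ k' ≫ (α_ _ _ _).hom ≫ e ◁ kg ≫ (α_ _ _ _).inv ≫ u.hom ▷ Mg) := by
        rw [← h₃]; bicategory
      _ = 𝟙 _ ⊗≫ (φ ▷ (e' ≫ k') ≫ g ◁ u') ≫ qg := by rw [h₂]; bicategory
      _ = 𝟙 _ ⊗≫ f ◁ u' ≫ (φ ▷ j' ≫ qg) := by rw [← whisker_exchange]; bicategory
      _ = ((α_ _ _ _).hom ≫ f ◁ u' ≫ qf) ≫ j ◁ Mφ := by rw [h₄]; bicategory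
      _ = nf.hom ▷ k' ≫ (α_ _ _ _).hom ≫ e ◁ kf ≫ (α_ _ _ _).inv ≫ (u.hom ▷ Mf ≫ j ◁ Mφ) := by
        rw [← h₁]; bicategory
      _ = _ := by rw [← whisker_exchange]; bicategory
  exact aux (𝔽.eN (L.map f)) (Q.unit X) (Q.unit_kN f) (Q.unit_kN g) (𝔽.eN_natural (L.map₂ φ)) h

lemma kN_id (X : C) : (Q.kN (𝟙 X)).hom ≫ Q.k X ◁ L.map₂ (M.fn.mapId X).hom ≫
      Q.k X ◁ (L.mapId (M.obj X)).hom =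
    𝔽.map₂ (L.mapId X).hom ▷ Q.k X ≫ (𝔽.mapId (L.obj X)).hom ▷ Q.k X ≫
      (λ_ (Q.k X)).hom ≫ (ρ_ (Q.k X)).inv := by
  refine 𝔽.hom_ext (A := M.freeStrictAlg X) (𝔸.isCell_comp (Q.isCell_kN _) (𝔸.isCell_comp
      (𝔸.isCell_whiskerLeft _ (Q.isCell_map₂ (Pseudomonad.isAlgCell_mapId X)))
      (𝔸.isCell_whiskerLeft _ (Q.isCell_mapId _))))
    (𝔸.isCell_comp (𝔸.isCell_whiskerRight _ (𝔽.isCell_map₂ _)) (𝔸.isCell_comp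
      (𝔸.isCell_whiskerRight _ 𝔽.isCell_mapId) (𝔸.isCell_comp (𝔸.isCell_leftUnitor _)
      (𝔸.isCell_rightUnitor_inv _)))) ?_
  have h : (L.mapSq (M.eNat (𝟙 X))).hom ≫ L.map (M.e X) ◁ L.map₂ (M.fn.mapId X).hom ≫
      L.map (M.e X) ◁ (L.mapId _).hom =
      (L.mapId X).hom ▷ L.map (M.e X) ≫ (λ_ _).hom ≫ (ρ_ _).inv := by
    have h' := congrArg (fun ξ => (L.mapComp _ _).inv ≫ L.map₂ ξ ≫ (L.mapComp _ _).hom ≫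
      L.map (M.e X) ◁ (L.mapId _).hom) (M.eNat_id X)
    simp [Pseudofunctor.map₂_runit_inv] at h'
    simpa using h'
  have aux {x x' l : K} {f : x ⟶ x} {e : x ⟶ x'} {Sf Si : x' ⟶ x'}
      {k : x' ⟶ l} {j : x ⟶ l} {Mf Mi : l ⟶ l} {φ : f ⟶ 𝟙 x}
      {Sφ : Sf ⟶ Si} {σ : Si ⟶ 𝟙 x'} {μ : Mf ⟶ Mi} {τ : Mi ⟶ 𝟙 l} (nf : f ≫ e ≅ e ≫ Sf)
      {ni : 𝟙 x ≫ e ⟶ e ≫ Si}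
      {kf : Sf ≫ k ⟶ k ≫ Mf} (u : e ≫ k ≅ j) {qf : f ≫ j ⟶ j ≫ Mf}
      (h₁ : nf.hom ▷ k ≫ (α_ _ _ _).hom ≫ e ◁ kf ≫ (α_ _ _ _).inv ≫ u.hom ▷ Mf =
        (α_ _ _ _).hom ≫ f ◁ u.hom ≫ qf)
      (h₂ : φ ▷ e ≫ ni = nf.hom ≫ e ◁ Sφ) (h₃ : ni ≫ e ◁ σ = (λ_ _).hom ≫ (ρ_ _).inv)
      (h₄ : qf ≫ j ◁ μ ≫ j ◁ τ = φ ▷ j ≫ (λ_ _).hom ≫ (ρ_ _).inv) :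
      e ◁ (kf ≫ k ◁ μ ≫ k ◁ τ) = e ◁ (Sφ ▷ k ≫ σ ▷ k ≫ (λ_ _).hom ≫ (ρ_ _).inv) := by
    rw [← cancel_mono ((α_ _ _ _).inv ≫ u.hom ▷ 𝟙 l),
      ← cancel_epi (nf.hom ▷ k ≫ (α_ _ _ _).hom)]
    calc
      _ = nf.hom ▷ k ≫ (α_ _ _ _).hom ≫ e ◁ kf ≫ (α_ _ _ _).inv ≫
          ((e ≫ k) ◁ (μ ≫ τ) ≫ u.hom ▷ 𝟙 l) := by bicategory
      _ = (nf.hom ▷ k ≫ (α_ _ _ _).hom ≫ e ◁ kf ≫ (α_ _ _ _).inv ≫ u.hom ▷ Mf) ≫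
          j ◁ (μ ≫ τ) := by rw [whisker_exchange]; bicategory
      _ = (α_ _ _ _).hom ≫ f ◁ u.hom ≫ (qf ≫ j ◁ μ ≫ j ◁ τ) := by rw [h₁]; bicategory
      _ = (α_ _ _ _).hom ≫ (f ◁ u.hom ≫ φ ▷ j) ≫ (λ_ _).hom ≫ (ρ_ _).inv := by
        rw [h₄]; bicategory
      _ = φ ▷ e ▷ k ≫ ((λ_ _).hom ≫ (ρ_ _).inv) ▷ k ⊗≫ u.hom ▷ 𝟙 l := by
        rw [whisker_exchange]; bicategory
      _ = (φ ▷ e ≫ ni) ▷ k ⊗≫ e ◁ σ ▷ k ⊗≫ u.hom ▷ 𝟙 l := by rw [← h₃]; bicategory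
      _ = _ := by rw [h₂]; bicategory
  exact aux (𝔽.eN (L.map (𝟙 X))) (Q.unit X) (Q.unit_kN (𝟙 X)) (𝔽.eN_natural (L.mapId X).hom)
    𝔽.eN_id h

/-- Along the universal arrow, `kN (f ≫ g)` is governed by the unit square of `M` at `f ≫ g`. Its
composition law `h` splits that square, and the two pieces reassemble into `kN f` and `kN g`. -/
lemma kN_comp (f : X ⟶ Y) (g : Y ⟶ Z) :
    (Q.kN (f ≫ g)).hom ≫ Q.k X ◁ (L.map₂ (M.fn.mapComp f g).hom ≫
        (L.mapComp (M.map f) (M.map g)).hom) =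
      (𝔽.map₂ (L.mapComp f g).hom ≫ (𝔽.mapComp (L.map f) (L.map g)).hom) ▷ Q.k Z ≫
        (α_ _ _ _).hom ≫ 𝔽.map (L.map f) ◁ (Q.kN g).hom ≫ (α_ _ _ _).inv ≫
          (Q.kN f).hom ▷ L.map (M.map g) ≫ (α_ _ _ _).hom := by
  refine 𝔽.hom_ext (A := M.freeStrictAlg Z) (𝔸.isCell_comp (Q.isCell_kN _)
      (𝔸.isCell_whiskerLeft _ (𝔸.isCell_comp (Q.isCell_map₂ (Pseudomonad.isAlgCell_mapComp f g))
      (Q.isCell_mapComp (A := M.freeStrictAlg X) (B := M.freeStrictAlg Y) (E := M.freeStrictAlg Z)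
      (M.freeMor f) (M.freeMor g)))))
    (𝔸.isCell_comp (𝔸.isCell_whiskerRight _ (𝔸.isCell_comp (𝔽.isCell_map₂ _)
      (𝔽.isCell_mapComp _ _))) (𝔸.isCell_comp (𝔸.isCell_associator _ _ _) (𝔸.isCell_comp
      (𝔸.isCell_whiskerLeft _ (Q.isCell_kN g)) (𝔸.isCell_comp (𝔸.isCell_associator_inv _ _ _)
      (𝔸.isCell_comp (𝔸.isCell_whiskerRight _ (Q.isCell_kN f))
      (𝔸.isCell_associator _ _ _)))))) ?_
  have h : (L.mapSq (M.eNat (f ≫ g))).hom ≫ L.map (M.e X) ◁ (L.map₂ (M.fn.mapComp f g).hom ≫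
      (L.mapComp (M.map f) (M.map g)).hom) =
      (L.mapComp f g).hom ▷ L.map (M.e Z) ≫ (α_ _ _ _).hom ≫ L.map f ◁ (L.mapSq (M.eNat g)).hom ≫
        (α_ _ _ _).inv ≫ (L.mapSq (M.eNat f)).hom ▷ L.map (M.map g) ≫ (α_ _ _ _).hom := by
    have h' := congrArg (fun ξ => (L.mapComp _ _).inv ≫ L.map₂ ξ ≫ (L.mapComp _ _).hom ≫
      L.map (M.e X) ◁ (L.mapComp _ _).hom) (M.eNat_comp f g)
    simp [Pseudofunctor.map₂_assoc_inv] at h'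
    simpa using h'
  have aux {x x' y y' z z' l l' l'' : K} {f : x ⟶ y} {g : y ⟶ z} {p : x ⟶ z} {e : x ⟶ x'}
      {e' : y ⟶ y'} {e'' : z ⟶ z'} {Sf : x' ⟶ y'} {Sg : y' ⟶ z'} {Sp Sfg : x' ⟶ z'} {k : x' ⟶ l}
      {k' : y' ⟶ l'} {k'' : z' ⟶ l''} {j : x ⟶ l} {j' : y ⟶ l'} {j'' : z ⟶ l''} {Mf : l ⟶ l'}
      {Mg : l' ⟶ l''} {Mp : l ⟶ l''} {φ : p ⟶ f ≫ g} {Sφ : Sp ⟶ Sfg} {σ : Sfg ⟶ Sf ≫ Sg}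
      {μ : Mp ⟶ Mf ≫ Mg} {nf : f ≫ e' ⟶ e ≫ Sf} {ng : g ≫ e'' ⟶ e' ≫ Sg}
      (np : p ≫ e'' ≅ e ≫ Sp) {nfg : (f ≫ g) ≫ e'' ⟶ e ≫ Sfg} {kf : Sf ≫ k' ⟶ k ≫ Mf}
      {kg : Sg ≫ k'' ⟶ k' ≫ Mg} {kp : Sp ≫ k'' ⟶ k ≫ Mp} (u : e ≫ k ≅ j) {u' : e' ≫ k' ⟶ j'}
      {u'' : e'' ≫ k'' ⟶ j''} {qf : f ≫ j' ⟶ j ≫ Mf} {qg : g ≫ j'' ⟶ j' ≫ Mg}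
      {qp : p ≫ j'' ⟶ j ≫ Mp}
      (h₁ : nf ▷ k' ≫ (α_ _ _ _).hom ≫ e ◁ kf ≫ (α_ _ _ _).inv ≫ u.hom ▷ Mf =
        (α_ _ _ _).hom ≫ f ◁ u' ≫ qf)
      (h₂ : ng ▷ k'' ≫ (α_ _ _ _).hom ≫ e' ◁ kg ≫ (α_ _ _ _).inv ≫ u' ▷ Mg =
        (α_ _ _ _).hom ≫ g ◁ u'' ≫ qg)
      (h₃ : np.hom ▷ k'' ≫ (α_ _ _ _).hom ≫ e ◁ kp ≫ (α_ _ _ _).inv ≫ u.hom ▷ Mp =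
        (α_ _ _ _).hom ≫ p ◁ u'' ≫ qp)
      (h₄ : φ ▷ e'' ≫ nfg = np.hom ≫ e ◁ Sφ)
      (h₅ : nfg ≫ e ◁ σ = (α_ _ _ _).hom ≫ f ◁ ng ≫ (α_ _ _ _).inv ≫ nf ▷ Sg ≫ (α_ _ _ _).hom)
      (h₆ : qp ≫ j ◁ μ = φ ▷ j'' ≫ (α_ _ _ _).hom ≫ f ◁ qg ≫ (α_ _ _ _).inv ≫ qf ▷ Mg ≫
        (α_ _ _ _).hom) :
      e ◁ (kp ≫ k ◁ μ) = e ◁ ((Sφ ≫ σ) ▷ k'' ≫ (α_ _ _ _).hom ≫ Sf ◁ kg ≫ (α_ _ _ _).inv ≫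
        kf ▷ Mg ≫ (α_ _ _ _).hom) := by
    rw [← cancel_mono ((α_ _ _ _).inv ≫ u.hom ▷ (Mf ≫ Mg)),
      ← cancel_epi (np.hom ▷ k'' ≫ (α_ _ _ _).hom)]
    calc
      _ = np.hom ▷ k'' ≫ (α_ _ _ _).hom ≫ e ◁ kp ≫ (α_ _ _ _).inv ≫
          ((e ≫ k) ◁ μ ≫ u.hom ▷ (Mf ≫ Mg)) := by bicategory
      _ = (np.hom ▷ k'' ≫ (α_ _ _ _).hom ≫ e ◁ kp ≫ (α_ _ _ _).inv ≫ u.hom ▷ Mp) ≫ j ◁ μ := by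
        rw [whisker_exchange]; bicategory
      _ = (α_ _ _ _).hom ≫ (p ◁ u'' ≫ φ ▷ j'') ≫ (α_ _ _ _).hom ≫ f ◁ qg ≫ (α_ _ _ _).inv ≫
          qf ▷ Mg ≫ (α_ _ _ _).hom := by rw [h₃, Category.assoc, Category.assoc, h₆]; bicategory
      _ = φ ▷ e'' ▷ k'' ⊗≫ f ◁ ((α_ _ _ _).hom ≫ g ◁ u'' ≫ qg) ⊗≫ qf ▷ Mg ⊗≫ 𝟙 _ := by
        rw [whisker_exchange]; bicategory
      _ = φ ▷ e'' ▷ k'' ⊗≫ f ◁ (ng ▷ k'' ⊗≫ e' ◁ kg) ⊗≫ ((α_ _ _ _).hom ≫ f ◁ u' ≫ qf) ▷ Mg ⊗≫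
          𝟙 _ := by rw [← h₂]; bicategory
      _ = φ ▷ e'' ▷ k'' ⊗≫ f ◁ ng ▷ k'' ⊗≫ ((f ≫ e') ◁ kg ≫ nf ▷ (k' ≫ Mg)) ⊗≫
          e ◁ kf ▷ Mg ⊗≫ u.hom ▷ (Mf ≫ Mg) := by rw [← h₁]; bicategory
      _ = φ ▷ e'' ▷ k'' ⊗≫ ((α_ _ _ _).hom ≫ f ◁ ng ≫ (α_ _ _ _).inv ≫ nf ▷ Sg ≫
          (α_ _ _ _).hom) ▷ k'' ⊗≫ e ◁ Sf ◁ kg ⊗≫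
          e ◁ kf ▷ Mg ⊗≫ u.hom ▷ (Mf ≫ Mg) := by rw [whisker_exchange]; bicategory
      _ = (φ ▷ e'' ≫ nfg) ▷ k'' ⊗≫ e ◁ σ ▷ k'' ⊗≫ e ◁ Sf ◁ kg ⊗≫
          e ◁ kf ▷ Mg ⊗≫ u.hom ▷ (Mf ≫ Mg) := by rw [← h₅]; bicategory
      _ = _ := by rw [h₄]; bicategory
  exact aux (𝔽.eN (L.map (f ≫ g))) (Q.unit X) (Q.unit_kN f) (Q.unit_kN g) (Q.unit_kN (f ≫ g))
    (𝔽.eN_natural (L.mapComp f g).hom) (𝔽.eN_comp (L.map f) (L.map g)) h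

end

end AlgComparison

/-! ### Pasting lemmas for the multiplication comparison -/

section

variable {B : Type u₁} [Bicategory.{w₁, v₁} B]

/-- The comparison is made of inverses of `ak` and `c`, so these are composed onto the far end. Then
`h₂` and `h₁` turn them into the primed cells, which cancel at the near end. -/
lemma mul_natural_aux {z₂ z₂' z₁ z₁' y y' l l' d d' : B}
    {SSf : z₂ ⟶ z₂'} {Sf : z₁ ⟶ z₁'} {a : z₂ ⟶ z₁} {a' : z₂' ⟶ z₁'} {k : z₁ ⟶ l} {k' : z₁' ⟶ l'}
    {Sk : z₂ ⟶ d} {Sk' : z₂' ⟶ d'} {km : d ⟶ y} {km' : d' ⟶ y'} {m : y ⟶ l} {m' : y' ⟶ l'}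
    {b : d ⟶ l} {b' : d' ⟶ l'} {Mf : l ⟶ l'} {SMf : d ⟶ d'} {MMf : y ⟶ y'}
    (ak : Sk ≫ b ≅ a ≫ k) (ak' : Sk' ≫ b' ≅ a' ≫ k') (c : km ≫ m ≅ b) (c' : km' ≫ m' ≅ b')
    {nf : SSf ≫ a' ⟶ a ≫ Sf} {kf : Sf ≫ k' ⟶ k ≫ Mf} {Skf : SSf ≫ Sk' ⟶ Sk ≫ SMf}
    {kMf : SMf ≫ km' ⟶ km ≫ MMf} {Ln : MMf ≫ m' ⟶ m ≫ Mf} {nMf : SMf ≫ b' ⟶ b ≫ Mf}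
    (h₁ : Skf ▷ b' ≫ (α_ _ _ _).hom ≫ Sk ◁ nMf ≫ (α_ _ _ _).inv ≫ ak.hom ▷ Mf ≫ (α_ _ _ _).hom =
      (α_ _ _ _).hom ≫ SSf ◁ ak'.hom ≫ (α_ _ _ _).inv ≫ nf ▷ k' ≫ (α_ _ _ _).hom ≫ a ◁ kf)
    (h₂ : kMf ▷ m' ≫ (α_ _ _ _).hom ≫ km ◁ Ln ≫ (α_ _ _ _).inv ≫ c.hom ▷ Mf =
      (α_ _ _ _).hom ≫ SMf ◁ c'.hom ≫ nMf) :
    SSf ◁ (ak'.inv ≫ Sk' ◁ c'.inv) ⊗≫ Skf ▷ (km' ≫ m') ⊗≫ Sk ◁ kMf ▷ m' ⊗≫ (Sk ≫ km) ◁ Ln =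
      (α_ _ _ _).inv ≫ nf ▷ k' ⊗≫ a ◁ kf ⊗≫ (ak.inv ≫ Sk ◁ c.inv) ▷ Mf ⊗≫
        𝟙 ((Sk ≫ km) ≫ m ≫ Mf) := by
  have key : SSf ◁ (ak'.inv ≫ Sk' ◁ c'.inv) ⊗≫ Skf ▷ (km' ≫ m') ⊗≫ Sk ◁ kMf ▷ m' ⊗≫
      (Sk ≫ km) ◁ Ln ⊗≫ Sk ◁ c.hom ▷ Mf ⊗≫ ak.hom ▷ Mf =
      (α_ _ _ _).inv ≫ nf ▷ k' ⊗≫ a ◁ kf ⊗≫ 𝟙 ((a ≫ k) ≫ Mf) := by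
    calc
      _ = SSf ◁ (ak'.inv ≫ Sk' ◁ c'.inv) ⊗≫ Skf ▷ (km' ≫ m') ⊗≫ Sk ◁ (kMf ▷ m' ≫
          (α_ _ _ _).hom ≫ km ◁ Ln ≫ (α_ _ _ _).inv ≫ c.hom ▷ Mf) ⊗≫ ak.hom ▷ Mf := by bicategory
      _ = SSf ◁ (ak'.inv ≫ Sk' ◁ c'.inv) ⊗≫ (Skf ▷ (km' ≫ m') ≫ (Sk ≫ SMf) ◁ c'.hom) ⊗≫
          Sk ◁ nMf ⊗≫ ak.hom ▷ Mf := by rw [h₂]; bicategory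
      _ = SSf ◁ ak'.inv ⊗≫ (SSf ≫ Sk') ◁ (c'.inv ≫ c'.hom) ⊗≫ (Skf ▷ b' ≫ (α_ _ _ _).hom ≫
          Sk ◁ nMf ≫ (α_ _ _ _).inv ≫ ak.hom ▷ Mf ≫ (α_ _ _ _).hom) ⊗≫ 𝟙 ((a ≫ k) ≫ Mf) := by
        rw [← whisker_exchange]; bicategory
      _ = SSf ◁ (ak'.inv ≫ ak'.hom) ⊗≫ nf ▷ k' ⊗≫ a ◁ kf ⊗≫ 𝟙 ((a ≫ k) ≫ Mf) := by
        rw [h₁, c'.inv_hom_id]; bicategory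
      _ = _ := by rw [ak'.inv_hom_id]; bicategory
  simp [bicategoricalComp] at key
  simp [bicategoricalComp, ← reassoc_of% key]

/-- The same cancellation for associativity: `h₃` is naturality of `kAct` at the multiplication,
`h₂` splits the action on a composite, and `h₁` is naturality of the action at the comparison
square. -/
lemma mul_assoc_aux {z₃ z₂ z₁ y₂ y l₂ l₁ l d₂ : B}
    {Sa a₂ : z₃ ⟶ z₂} {a : z₂ ⟶ z₁} {k : z₁ ⟶ l} {Sk : z₂ ⟶ y} {SSk : z₃ ⟶ y₂} {am : y₂ ⟶ y}
    {km : y ⟶ l₁} {m : l₁ ⟶ l} {b : y ⟶ l} {Skm : y₂ ⟶ d₂} {SkM : y₂ ⟶ y} {Sm : d₂ ⟶ y}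
    {kmm : d₂ ⟶ l₂} {Mm m₂ : l₂ ⟶ l₁} {bm : d₂ ⟶ l₁}
    (ak : Sk ≫ b ≅ a ≫ k) (c : km ≫ m ≅ b) (aSk : SSk ≫ am ≅ a₂ ≫ Sk)
    (akm : Skm ≫ bm ≅ am ≫ km) (cm : kmm ≫ m₂ ≅ bm) {aa : Sa ≫ a ⟶ a₂ ≫ a}
    {Smul : Sa ≫ Sk ⟶ SSk ≫ SkM} {δ : SkM ⟶ Skm ≫ Sm} {kNm : Sm ≫ km ⟶ kmm ≫ Mm}
    {La : Mm ≫ m ⟶ m₂ ≫ m} {aG : SkM ≫ b ⟶ am ≫ km ≫ m} {as : Sm ≫ b ⟶ bm ≫ m}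
    (h₁ : Smul ▷ b ≫ (α_ _ _ _).hom ≫ SSk ◁ aG ≫ (α_ _ _ _).inv ≫ aSk.hom ▷ (km ≫ m) ≫
        (α_ _ _ _).hom =
      (α_ _ _ _).hom ≫ Sa ◁ ak.hom ≫ (α_ _ _ _).inv ≫ aa ▷ k ≫ (α_ _ _ _).hom ≫
        a₂ ◁ (ak.inv ≫ Sk ◁ c.inv))
    (h₂ : aG = δ ▷ b ≫ (α_ _ _ _).hom ≫ Skm ◁ as ≫ (α_ _ _ _).inv ≫ akm.hom ▷ m ≫ (α_ _ _ _).hom)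
    (h₃ : kNm ▷ m ≫ (α_ _ _ _).hom ≫ kmm ◁ La ≫ (α_ _ _ _).inv ≫ cm.hom ▷ m =
      (α_ _ _ _).hom ≫ Sm ◁ c.hom ≫ as) :
    Sa ◁ (ak.inv ≫ Sk ◁ c.inv) ⊗≫ Smul ▷ (km ≫ m) ⊗≫ SSk ◁ δ ▷ (km ≫ m) ⊗≫
        (SSk ≫ Skm) ◁ kNm ▷ m ⊗≫ ((SSk ≫ Skm) ≫ kmm) ◁ La =
      (α_ _ _ _).inv ≫ aa ▷ k ⊗≫ a₂ ◁ (ak.inv ≫ Sk ◁ c.inv) ⊗≫ aSk.inv ▷ (km ≫ m) ⊗≫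
        SSk ◁ (akm.inv ≫ Skm ◁ cm.inv) ▷ m ⊗≫ 𝟙 (((SSk ≫ Skm) ≫ kmm) ≫ m₂ ≫ m) := by
  have key : Sa ◁ (ak.inv ≫ Sk ◁ c.inv) ⊗≫ Smul ▷ (km ≫ m) ⊗≫ SSk ◁ δ ▷ (km ≫ m) ⊗≫
        (SSk ≫ Skm) ◁ kNm ▷ m ⊗≫ ((SSk ≫ Skm) ≫ kmm) ◁ La ⊗≫ (SSk ≫ Skm) ◁ cm.hom ▷ m ⊗≫
        SSk ◁ akm.hom ▷ m ⊗≫ aSk.hom ▷ (km ≫ m) =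
      (α_ _ _ _).inv ≫ aa ▷ k ⊗≫ a₂ ◁ (ak.inv ≫ Sk ◁ c.inv) ⊗≫ 𝟙 ((a₂ ≫ Sk) ≫ km ≫ m) := by
    calc
      _ = Sa ◁ (ak.inv ≫ Sk ◁ c.inv) ⊗≫ Smul ▷ (km ≫ m) ⊗≫ SSk ◁ δ ▷ (km ≫ m) ⊗≫
          (SSk ≫ Skm) ◁ (kNm ▷ m ≫ (α_ _ _ _).hom ≫ kmm ◁ La ≫ (α_ _ _ _).inv ≫ cm.hom ▷ m) ⊗≫
          SSk ◁ akm.hom ▷ m ⊗≫ aSk.hom ▷ (km ≫ m) := by bicategory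
      _ = Sa ◁ (ak.inv ≫ Sk ◁ c.inv) ⊗≫ Smul ▷ (km ≫ m) ⊗≫ SSk ◁ (δ ▷ (km ≫ m) ≫
          (Skm ≫ Sm) ◁ c.hom) ⊗≫ (SSk ≫ Skm) ◁ as ⊗≫ SSk ◁ akm.hom ▷ m ⊗≫
          aSk.hom ▷ (km ≫ m) := by rw [h₃]; bicategory
      _ = Sa ◁ (ak.inv ≫ Sk ◁ c.inv) ⊗≫ (Smul ▷ (km ≫ m) ≫ (SSk ≫ SkM) ◁ c.hom) ⊗≫
          SSk ◁ (δ ▷ b ≫ (α_ _ _ _).hom ≫ Skm ◁ as ≫ (α_ _ _ _).inv ≫ akm.hom ▷ m ≫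
            (α_ _ _ _).hom) ⊗≫ aSk.hom ▷ (km ≫ m) := by rw [← whisker_exchange]; bicategory
      _ = Sa ◁ ak.inv ⊗≫ (Sa ≫ Sk) ◁ (c.inv ≫ c.hom) ⊗≫ (Smul ▷ b ≫ (α_ _ _ _).hom ≫ SSk ◁ aG ≫
          (α_ _ _ _).inv ≫ aSk.hom ▷ (km ≫ m) ≫ (α_ _ _ _).hom) ⊗≫ 𝟙 ((a₂ ≫ Sk) ≫ km ≫ m) := by
        rw [← h₂, ← whisker_exchange]; bicategory
      _ = Sa ◁ (ak.inv ≫ ak.hom) ⊗≫ aa ▷ k ⊗≫ a₂ ◁ (ak.inv ≫ Sk ◁ c.inv) ⊗≫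
          𝟙 ((a₂ ≫ Sk) ≫ km ≫ m) := by
        rw [h₁, c.inv_hom_id]; bicategory
      _ = _ := by rw [ak.inv_hom_id]; bicategory
  simp [bicategoricalComp] at key
  simp [bicategoricalComp, ← reassoc_of% key]

/-- No uniqueness of lifts is needed: the two factors of the comparison are lifts, and `h₁` and `h₂`
are their defining equations along the universal arrows. -/
lemma mul_left_aux {z₂ z₁ y l₁ l : B} {e : z₁ ⟶ z₂} {a : z₂ ⟶ z₁} {k : z₁ ⟶ l} {Sk : z₂ ⟶ y}
    {km : y ⟶ l₁} {m : l₁ ⟶ l} {b : y ⟶ l} {el : l ⟶ y} {Le : l ⟶ l₁} (ak : Sk ≫ b ≅ a ≫ k)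
    (c : km ≫ m ≅ b) (ek : k ≫ el ≅ e ≫ Sk) {u : el ≫ km ⟶ Le} {l₀ : 𝟙 z₁ ⟶ e ≫ a}
    (lb : 𝟙 l ≅ el ≫ b) (t : Le ≫ m ≅ 𝟙 l)
    (h₁ : ((ρ_ k).inv ≫ k ◁ lb.hom ≫ (α_ _ _ _).inv ≫ ek.hom ▷ b ≫ (α_ _ _ _).hom) ≫ e ◁ ak.hom =
      (λ_ k).inv ≫ l₀ ▷ k ≫ (α_ _ _ _).hom)
    (h₂ : el ◁ c.hom = (α_ _ _ _).inv ≫ u ▷ m ≫ t.hom ≫ lb.hom) :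
    l₀ ▷ k ⊗≫ e ◁ (ak.inv ≫ Sk ◁ c.inv) ⊗≫ ek.inv ▷ (km ≫ m) ⊗≫ k ◁ u ▷ m ⊗≫
      𝟙 (k ≫ Le ≫ m) = (λ_ _).hom ≫ (ρ_ _).inv ≫ k ◁ t.inv := by
  have h₁' : l₀ ▷ k = (λ_ k).hom ≫ (((ρ_ k).inv ≫ k ◁ lb.hom ≫ (α_ _ _ _).inv ≫ ek.hom ▷ b ≫
      (α_ _ _ _).hom) ≫ e ◁ ak.hom) ≫ (α_ _ _ _).inv := by rw [h₁]; simp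
  have h₂' : u ▷ m = (α_ _ _ _).hom ≫ el ◁ c.hom ≫ lb.inv ≫ t.inv := by rw [h₂]; simp
  calc
    _ = (λ_ k).hom ≫ (ρ_ k).inv ≫ k ◁ lb.hom ⊗≫ (ek.hom ▷ b ≫ (e ≫ Sk) ◁ c.inv) ⊗≫
        ek.inv ▷ (km ≫ m) ⊗≫ k ◁ (el ◁ c.hom ≫ lb.inv ≫ t.inv) := by
      rw [h₁', h₂']; simp [bicategoricalComp]
    _ = _ := by
      rw [← whisker_exchange]; simp [bicategoricalComp]

/-- The prefix common to both sides lets interchange bring `mul` next to `l₀`, where the left unit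
law `h₁` absorbs it. The unit squares are then passed along by `h₂`, `h₃` and `h₄`, and the two
remaining loops close by `h₅` for the 2-monad and `h₆` for free objects. -/
lemma mul_right_aux {x x₁ x₂ l l₁ y : B} {e : x ⟶ x₁} {e' : x₁ ⟶ x₂} {a : x₂ ⟶ x₁} {k : x₁ ⟶ l}
    {Se : x₁ ⟶ x₂} {Sk : x₂ ⟶ y} {km : y ⟶ l₁} {m : l₁ ⟶ l} {Le : x ⟶ l} {el : l ⟶ y}
    {Le' LMe : l ⟶ l₁} {SLe Sek : x₁ ⟶ y} {mul : a ≫ k ⟶ Sk ≫ km ≫ m} {n : e ≫ e' ⟶ e ≫ Se}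
    {ek : k ≫ el ⟶ e' ≫ Sk} {nek : (e ≫ k) ≫ el ⟶ e ≫ Sek} {nL : Le ≫ el ⟶ e ≫ SLe}
    (δ : Sek ≅ Se ≫ Sk) (u : e ≫ k ≅ Le) (u' : el ≫ km ≅ Le') {Su : Sek ⟶ SLe}
    {kN : SLe ≫ km ⟶ k ≫ LMe} {ne : Le ≫ Le' ⟶ Le ≫ LMe} {r : LMe ≫ m ⟶ 𝟙 l}
    (t : Le' ≫ m ≅ 𝟙 l) {l₀ : 𝟙 x₁ ⟶ e' ≫ a} {r₀ : Se ≫ a ⟶ 𝟙 x₁}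
    (h₁ : l₀ ▷ k ⊗≫ e' ◁ mul = (λ_ _).hom ≫ (ρ_ _).inv ≫ k ◁ t.inv ⊗≫ k ◁ u'.inv ▷ m ⊗≫
      ek ▷ (km ≫ m) ⊗≫ 𝟙 (e' ≫ Sk ≫ km ≫ m))
    (h₂ : nek ≫ e ◁ δ.hom = (α_ _ _ _).hom ≫ e ◁ ek ≫ (α_ _ _ _).inv ≫ n ▷ Sk ≫ (α_ _ _ _).hom)
    (h₃ : u.hom ▷ el ≫ nL = nek ≫ e ◁ Su)
    (h₄ : nL ▷ km ≫ (α_ _ _ _).hom ≫ e ◁ kN ≫ (α_ _ _ _).inv ≫ u.hom ▷ LMe =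
      (α_ _ _ _).hom ≫ Le ◁ u'.hom ≫ ne)
    (h₅ : Le ◁ t.inv ≫ (α_ _ _ _).inv ≫ ne ▷ m ≫ (α_ _ _ _).hom ≫ Le ◁ r = 𝟙 _)
    (h₆ : ((ρ_ e).inv ≫ e ◁ l₀ ≫ (α_ _ _ _).inv ≫ n ▷ a ≫ (α_ _ _ _).hom) ≫ e ◁ r₀ = (ρ_ e).inv) :
    (e ◁ l₀ ▷ k ⊗≫ n ▷ (a ≫ k) ⊗≫ 𝟙 (e ≫ Se ≫ a ≫ k)) ≫ e ◁ (Se ◁ mul ⊗≫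
      (δ.inv ≫ Su) ▷ (km ≫ m) ⊗≫ kN ▷ m ⊗≫ k ◁ r ≫ (ρ_ _).hom) =
    (e ◁ l₀ ▷ k ⊗≫ n ▷ (a ≫ k) ⊗≫ 𝟙 (e ≫ Se ≫ a ≫ k)) ≫
      e ◁ ((α_ _ _ _).inv ≫ r₀ ▷ k ≫ (λ_ _).hom) := by
  have h₂' : e ◁ ek ⊗≫ n ▷ Sk = (α_ _ _ _).inv ≫ nek ≫ e ◁ δ.hom ≫ (α_ _ _ _).inv := by
    rw [reassoc_of% h₂]; simp [bicategoricalComp]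
  rw [← cancel_mono u.hom]
  calc
    _ = 𝟙 (e ≫ 𝟙 x₁ ≫ k) ⊗≫ e ◁ l₀ ▷ k ⊗≫ (n ▷ (a ≫ k) ≫ (e ≫ Se) ◁ mul) ⊗≫ e ◁ (
        (δ.inv ≫ Su) ▷ (km ≫ m) ⊗≫ kN ▷ m ⊗≫ k ◁ r ≫ (ρ_ _).hom) ≫ u.hom := by bicategory
    _ = 𝟙 (e ≫ 𝟙 x₁ ≫ k) ⊗≫ e ◁ (l₀ ▷ k ⊗≫ e' ◁ mul) ⊗≫ n ▷ (Sk ≫ km ≫ m) ⊗≫ e ◁ (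
        (δ.inv ≫ Su) ▷ (km ≫ m) ⊗≫ kN ▷ m ⊗≫ k ◁ r) ⊗≫ u.hom := by
      rw [← whisker_exchange]; bicategory
    _ = 𝟙 (e ≫ 𝟙 x₁ ≫ k) ⊗≫ e ◁ k ◁ t.inv ⊗≫ e ◁ k ◁ u'.inv ▷ m ⊗≫ (e ◁ ek ⊗≫ n ▷ Sk) ▷ (km ≫ m) ⊗≫
        e ◁ ((δ.inv ≫ Su) ▷ (km ≫ m) ⊗≫ kN ▷ m ⊗≫ k ◁ r) ⊗≫ u.hom := by
      rw [h₁]; bicategory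
    _ = 𝟙 (e ≫ 𝟙 x₁ ≫ k) ⊗≫ e ◁ k ◁ t.inv ⊗≫ e ◁ k ◁ u'.inv ▷ m ⊗≫
        (nek ≫ e ◁ (δ.hom ≫ δ.inv) ≫ e ◁ Su) ▷
        (km ≫ m) ⊗≫ e ◁ (kN ▷ m ⊗≫ k ◁ r) ⊗≫ u.hom := by
      rw [h₂']; bicategory
    _ = 𝟙 (e ≫ 𝟙 x₁ ≫ k) ⊗≫ e ◁ k ◁ t.inv ⊗≫ e ◁ k ◁ u'.inv ▷ m ⊗≫ (nek ≫ e ◁ Su) ▷ (km ≫ m) ⊗≫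
        e ◁ (kN ▷ m ⊗≫ k ◁ r) ⊗≫ u.hom := by
      rw [δ.hom_inv_id, whiskerLeft_id, Category.id_comp]
    _ = 𝟙 (e ≫ 𝟙 x₁ ≫ k) ⊗≫ e ◁ k ◁ t.inv ⊗≫ e ◁ k ◁ u'.inv ▷ m ⊗≫ u.hom ▷ (el ≫ km ≫ m) ⊗≫
        nL ▷ km ▷ m ⊗≫ e ◁ kN ▷ m ⊗≫ ((e ≫ k) ◁ r ≫ u.hom ▷ 𝟙 l) ⊗≫ 𝟙 Le := by
      rw [← h₃]; bicategory
    _ = 𝟙 (e ≫ 𝟙 x₁ ≫ k) ⊗≫ e ◁ k ◁ t.inv ⊗≫ e ◁ k ◁ u'.inv ▷ m ⊗≫ u.hom ▷ (el ≫ km ≫ m) ⊗≫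
        (nL ▷ km ≫ (α_ _ _ _).hom ≫ e ◁ kN ≫ (α_ _ _ _).inv ≫ u.hom ▷ LMe) ▷ m ⊗≫ Le ◁ r ⊗≫
        𝟙 Le := by
      rw [whisker_exchange]; bicategory
    _ = 𝟙 (e ≫ 𝟙 x₁ ≫ k) ⊗≫
        ((e ≫ k) ◁ (t.inv ≫ u'.inv ▷ m ≫ (α_ _ _ _).hom) ≫ u.hom ▷ (el ≫ km ≫ m)) ⊗≫
        Le ◁ u'.hom ▷ m ⊗≫ ne ▷ m ⊗≫ Le ◁ r ⊗≫ 𝟙 Le := by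
      rw [h₄]; bicategory
    _ = 𝟙 (e ≫ 𝟙 x₁ ≫ k) ⊗≫ u.hom ▷ 𝟙 l ⊗≫ Le ◁ t.inv ⊗≫ (Le ◁ (u'.inv ≫ u'.hom) ▷ m) ⊗≫ ne ▷ m ⊗≫
        Le ◁ r ⊗≫ 𝟙 Le := by
      rw [whisker_exchange]; bicategory
    _ = 𝟙 (e ≫ 𝟙 x₁ ≫ k) ⊗≫ u.hom ▷ 𝟙 l ⊗≫ (Le ◁ t.inv ≫ (α_ _ _ _).inv ≫ ne ▷ m ≫ (α_ _ _ _).hom ≫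
        Le ◁ r) ⊗≫ 𝟙 Le := by
      rw [u'.inv_hom_id]; bicategory
    _ = 𝟙 (e ≫ 𝟙 x₁ ≫ k) ⊗≫ (ρ_ e).inv ▷ k ⊗≫ u.hom := by
      rw [h₅]; bicategory
    _ = 𝟙 (e ≫ 𝟙 x₁ ≫ k) ⊗≫
        (((ρ_ e).inv ≫ e ◁ l₀ ≫ (α_ _ _ _).inv ≫ n ▷ a ≫ (α_ _ _ _).hom) ≫ e ◁ r₀) ▷ k ⊗≫
        u.hom := by
      rw [h₆]
    _ = _ := by bicategory

end

/-! ### The comparison as a morphism of pseudomonads -/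

namespace AlgComparison

open Pseudomonad

variable {C : Type u₁} [Bicategory.{w₁, v₁} C] [Bicategory.Strict C]
  {M : TwoMonad C} {K : Type u₂} [Bicategory.{w₂, v₂} K] {L : C ⥤ᵖ K}
  {𝔸 : StructuredBicat.{w₂, w₃} (fun A : StrictAlg M.toPseudomonad => L.obj A.carrier)}
  {𝔽 : FreeObjects 𝔸} (Q : AlgComparison M L 𝔽)

section

variable {A B : StrictAlg M.toPseudomonad} {g : A.carrier ⟶ B.carrier}

/-- By uniqueness of lifts. Along the universal arrow, the defining equations of `kN`, `kAct` and
`actN` meet the image under `L` of the unit axiom of `G`. -/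
lemma kAct_natural (G : MorStr A.alg B.alg g) :
    (Q.kN g).hom ▷ L.map B.alg.str ≫ (α_ _ _ _).hom ≫
        Q.k A.carrier ◁ (L.mapSq G.cell).hom ≫ (α_ _ _ _).inv ≫ (Q.kAct A).hom ▷ L.map g =
      (α_ _ _ _).hom ≫ 𝔽.map (L.map g) ◁ (Q.kAct B).hom ≫
        (𝔽.actN (A := A) (B := B) (Q.str G)).hom := by
  refine 𝔽.hom_ext (A := B) (𝔸.isCell_comp (𝔸.isCell_whiskerRight (Q.strStr B) (Q.isCell_kN g))
      (𝔸.isCell_comp (𝔸.isCell_associator _ _ _) (𝔸.isCell_comp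
      (𝔸.isCell_whiskerLeft _ (Q.isCell_mapSq (A := M.freeStrictAlg A.carrier)
        (B := M.freeStrictAlg B.carrier) (E := A) (V := B) (isAlgCell_cell G)))
      (𝔸.isCell_comp (𝔸.isCell_associator_inv _ _ _)
      (𝔸.isCell_whiskerRight _ (Q.isCell_kAct A))))))
    (𝔸.isCell_comp (𝔸.isCell_associator _ _ _) (𝔸.isCell_comp
      (𝔸.isCell_whiskerLeft _ (Q.isCell_kAct B)) (𝔽.isCell_actN (A := A) (B := B) _))) ?_
  have aux {x x' z z' l l' : K} {f : x ⟶ x'} {e : x ⟶ z} {e' : x' ⟶ z'} {Sf : z ⟶ z'} {k : z ⟶ l}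
      {k' : z' ⟶ l'} {p : l ⟶ x} {q : l' ⟶ x'} {Mf : l ⟶ l'} {a : z ⟶ x} {a' : z' ⟶ x'} {j : x ⟶ l}
      {j' : x' ⟶ l'} (n : f ≫ e' ≅ e ≫ Sf) {kf : Sf ≫ k' ⟶ k ≫ Mf} {c : Mf ≫ q ⟶ p ≫ f}
      {A : k ≫ p ⟶ a} {A' : k' ≫ q ⟶ a'} {aN : Sf ≫ a' ⟶ a ≫ f} {u : e ≫ k ⟶ j} {u' : e' ≫ k' ⟶ j'}
      {s : f ≫ j' ⟶ j ≫ Mf} (t : j ≫ p ≅ 𝟙 x) (t' : j' ≫ q ≅ 𝟙 x') {v : 𝟙 x ⟶ e ≫ a}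
      {v' : 𝟙 x' ⟶ e' ≫ a'}
      (h₁ : n.hom ▷ k' ≫ (α_ _ _ _).hom ≫ e ◁ kf ≫ (α_ _ _ _).inv ≫ u ▷ Mf =
        (α_ _ _ _).hom ≫ f ◁ u' ≫ s)
      (h₂ : e ◁ A = (α_ _ _ _).inv ≫ u ▷ p ≫ t.hom ≫ v)
      (h₃ : e' ◁ A' = (α_ _ _ _).inv ≫ u' ▷ q ≫ t'.hom ≫ v')
      (h₄ : f ◁ t'.inv ⊗≫ s ▷ q ⊗≫ j ◁ c =
        (ρ_ _).hom ≫ (λ_ _).inv ≫ t.inv ▷ f ≫ (α_ _ _ _).hom)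
      (h₅ : ((ρ_ f).inv ≫ f ◁ v' ≫ (α_ _ _ _).inv ≫ n.hom ▷ a' ≫ (α_ _ _ _).hom) ≫ e ◁ aN =
        (λ_ f).inv ≫ v ▷ f ≫ (α_ _ _ _).hom) :
      e ◁ (kf ▷ q ≫ (α_ _ _ _).hom ≫ k ◁ c ≫ (α_ _ _ _).inv ≫ A ▷ f) =
        e ◁ ((α_ _ _ _).hom ≫ Sf ◁ A' ≫ aN) := by
    have h₄' : s ▷ q ⊗≫ j ◁ c = (α_ _ _ _).hom ≫ f ◁ t'.hom ≫ (ρ_ _).hom ≫ (λ_ _).inv ≫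
        t.inv ▷ f ≫ (α_ _ _ _).hom := by
      rw [← h₄]; simp [bicategoricalComp]
    rw [← cancel_epi ((α_ _ _ _).inv ≫ (α_ _ _ _).inv ▷ q ≫ n.hom ▷ k' ▷ q ≫
      (α_ _ _ _).hom ▷ q ≫ (α_ _ _ _).hom)]
    -- The common value of both sides: contract the unit triangle of the target algebra, then insert
    -- the unit of the action on the source.
    trans 𝟙 (f ≫ (e' ≫ k') ≫ q) ⊗≫ f ◁ (u' ▷ q ≫ t'.hom) ⊗≫ v ▷ f ⊗≫ 𝟙 (e ≫ a ≫ f)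
    · calc
        _ = 𝟙 _ ⊗≫ n.hom ▷ k' ▷ q ⊗≫ e ◁ kf ▷ q ⊗≫ e ◁ k ◁ c ⊗≫ (e ◁ A) ▷ f ⊗≫ 𝟙 _ := by
          bicategory
        _ = 𝟙 _ ⊗≫ n.hom ▷ k' ▷ q ⊗≫ e ◁ kf ▷ q ⊗≫ ((e ≫ k) ◁ c ≫ u ▷ (p ≫ f)) ⊗≫
            (t.hom ≫ v) ▷ f ⊗≫ 𝟙 _ := by rw [h₂]; bicategory
        _ = 𝟙 _ ⊗≫ (n.hom ▷ k' ≫ (α_ _ _ _).hom ≫ e ◁ kf ≫ (α_ _ _ _).inv ≫ u ▷ Mf) ▷ q ⊗≫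
            j ◁ c ⊗≫ (t.hom ≫ v) ▷ f ⊗≫ 𝟙 _ := by rw [whisker_exchange]; bicategory
        _ = 𝟙 _ ⊗≫ f ◁ u' ▷ q ⊗≫ (s ▷ q ⊗≫ j ◁ c) ⊗≫ (t.hom ≫ v) ▷ f ⊗≫ 𝟙 _ := by
          rw [h₁]; bicategory
        _ = 𝟙 _ ⊗≫ f ◁ (u' ▷ q ≫ t'.hom) ⊗≫ (t.inv ≫ t.hom) ▷ f ⊗≫ v ▷ f ⊗≫ 𝟙 _ := by
          rw [h₄']; bicategory
        _ = _ := by rw [t.inv_hom_id]; bicategory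
    · symm
      calc
        _ = 𝟙 _ ⊗≫ (n.hom ▷ (k' ≫ q) ≫ (e ≫ Sf) ◁ A') ⊗≫ e ◁ aN := by bicategory
        _ = 𝟙 _ ⊗≫ f ◁ (e' ◁ A') ⊗≫ n.hom ▷ a' ⊗≫ e ◁ aN := by
          rw [← whisker_exchange]; bicategory
        _ = 𝟙 _ ⊗≫ f ◁ (u' ▷ q ≫ t'.hom) ⊗≫ (((ρ_ f).inv ≫ f ◁ v' ≫ (α_ _ _ _).inv ≫
            n.hom ▷ a' ≫ (α_ _ _ _).hom) ≫ e ◁ aN) := by rw [h₃]; bicategory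
        _ = _ := by rw [h₅]; bicategory
  exact aux (𝔽.eN (L.map g)) (L.mapTriId A.alg.unit.symm) (L.mapTriId B.alg.unit.symm)
    (Q.unit_kN g) (Q.e_kAct A) (Q.e_kAct B)
    (L.mapTriId_mor A.alg.unit.symm B.alg.unit.symm G.cell (M.eNat g) G.cell_unit)
    (𝔽.eAct_actN (A := A) (B := B) (Q.str G))

end

/-- Compatibility of the comparison with the multiplications. -/
def mul (X : C) : 𝔽.act (𝔽.free (L.obj X)) ≫ Q.k X ≅
    𝔽.map (Q.k X) ≫ Q.k (M.obj X) ≫ L.map (M.m X) :=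
  (𝔽.actN (A := 𝔽.free (L.obj X)) (B := M.freeStrictAlg X) (Q.kStr X)).symm ≪≫
    whiskerLeftIso (𝔽.map (Q.k X)) (Q.kAct (M.freeStrictAlg X)).symm

lemma isCell_mul (X : C) :
    𝔸.IsCell (A := 𝔽.free (𝔽.S (L.obj X))) (B := M.freeStrictAlg X)
      (𝔸.comp (𝔽.actStr (𝔽.free (L.obj X))) (Q.kStr X))
      (𝔸.comp (𝔽.mapStr (Q.k X)) (𝔸.comp (Q.kStr (M.obj X)) (Q.strStr (M.freeStrictAlg X))))
      (Q.mul X).hom :=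
  𝔸.isCell_comp (𝔸.isCell_inv (𝔽.isCell_actN (A := 𝔽.free (L.obj X)) (B := M.freeStrictAlg X)
    (Q.kStr X))) (𝔸.isCell_whiskerLeft _ (𝔸.isCell_inv (Q.isCell_kAct (M.freeStrictAlg X))))

end AlgComparison

section

variable {B : Type u₁} [Bicategory.{w₁, v₁} B]

/-- This strips the prefix from `mul_right_aux`, which is invertible because `l₀` and `n` are. The
left unit law is first solved for the part containing `mul`. -/
lemma mul_right_cancel_aux {x x₁ x₂ l l₁ y : B} {e : x ⟶ x₁} {e' : x₁ ⟶ x₂} {a : x₂ ⟶ x₁}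
    {k : x₁ ⟶ l} {Se : x₁ ⟶ x₂} {Sk : x₂ ⟶ y} {km : y ⟶ l₁} {m : l₁ ⟶ l} {Le : x ⟶ l} {el : l ⟶ y}
    {Le' LMe : l ⟶ l₁} {SLe Sek : x₁ ⟶ y} {mul : a ≫ k ⟶ Sk ≫ km ≫ m} (n : e ≫ e' ≅ e ≫ Se)
    (ek : k ≫ el ≅ e' ≫ Sk) {nek : (e ≫ k) ≫ el ⟶ e ≫ Sek} {nL : Le ≫ el ⟶ e ≫ SLe}
    (δ : Sek ≅ Se ≫ Sk) (u : e ≫ k ≅ Le) (u' : el ≫ km ≅ Le') {Su : Sek ⟶ SLe}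
    {kN : SLe ≫ km ⟶ k ≫ LMe} {ne : Le ≫ Le' ⟶ Le ≫ LMe} {r : LMe ≫ m ⟶ 𝟙 l}
    (t : Le' ≫ m ≅ 𝟙 l) (l₀ : 𝟙 x₁ ≅ e' ≫ a) {r₀ : Se ≫ a ⟶ 𝟙 x₁}
    (h₁ : l₀.hom ▷ k ⊗≫ e' ◁ mul ⊗≫ ek.inv ▷ (km ≫ m) ⊗≫ k ◁ u'.hom ▷ m ⊗≫
      𝟙 (k ≫ Le' ≫ m) = (λ_ _).hom ≫ (ρ_ _).inv ≫ k ◁ t.inv)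
    (h₂ : nek ≫ e ◁ δ.hom =
      (α_ _ _ _).hom ≫ e ◁ ek.hom ≫ (α_ _ _ _).inv ≫ n.hom ▷ Sk ≫ (α_ _ _ _).hom)
    (h₃ : u.hom ▷ el ≫ nL = nek ≫ e ◁ Su)
    (h₄ : nL ▷ km ≫ (α_ _ _ _).hom ≫ e ◁ kN ≫ (α_ _ _ _).inv ≫ u.hom ▷ LMe =
      (α_ _ _ _).hom ≫ Le ◁ u'.hom ≫ ne)
    (h₅ : Le ◁ t.inv ≫ (α_ _ _ _).inv ≫ ne ▷ m ≫ (α_ _ _ _).hom ≫ Le ◁ r = 𝟙 _)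
    (h₆ : ((ρ_ e).inv ≫ e ◁ l₀.hom ≫ (α_ _ _ _).inv ≫ n.hom ▷ a ≫ (α_ _ _ _).hom) ≫ e ◁ r₀ =
      (ρ_ e).inv) :
    e ◁ (Se ◁ mul ≫ (α_ _ _ _).inv ≫ (δ.inv ≫ Su) ▷ (km ≫ m) ≫ (α_ _ _ _).inv ≫ kN ▷ m ≫
      (α_ _ _ _).hom ≫ k ◁ r ≫ (ρ_ _).hom) = e ◁ ((α_ _ _ _).inv ≫ r₀ ▷ k ≫ (λ_ _).hom) := by
  have h₁' : l₀.hom ▷ k ⊗≫ e' ◁ mul = (λ_ _).hom ≫ (ρ_ _).inv ≫ k ◁ t.inv ⊗≫ k ◁ u'.inv ▷ m ⊗≫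
      ek.hom ▷ (km ≫ m) ⊗≫ 𝟙 (e' ≫ Sk ≫ km ≫ m) := by
    rw [← cancel_epi ((ρ_ _).hom ≫ (λ_ _).inv), Category.assoc, Category.assoc,
      Iso.inv_hom_id_assoc, Iso.hom_inv_id_assoc] at h₁
    rw [← h₁]
    simp [bicategoricalComp]
  have h := mul_right_aux δ u u' t h₁' h₂ h₃ h₄ h₅ h₆
  let P := whiskerLeftIso e (whiskerRightIso l₀ k) ≪⊗≫ whiskerRightIso n (a ≫ k) ≪⊗≫
    Iso.refl (e ≫ Se ≫ a ≫ k)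
  rw [← cancel_epi P.hom]
  simpa [P, bicategoricalIsoComp, bicategoricalComp] using h

end

namespace AlgComparison

open Pseudomonad

variable {C : Type u₁} [Bicategory.{w₁, v₁} C] [Bicategory.Strict C]
  {M : TwoMonad C} {K : Type u₂} [Bicategory.{w₂, v₂} K] {L : C ⥤ᵖ K}
  {𝔸 : StructuredBicat.{w₂, w₃} (fun A : StrictAlg M.toPseudomonad => L.obj A.carrier)}
  {𝔽 : FreeObjects 𝔸} (Q : AlgComparison M L 𝔽)

lemma mul_left (X : C) : (𝔽.actUnit (𝔽.free (L.obj X))).hom ▷ Q.k X ⊗≫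
        𝔽.e (𝔽.S (L.obj X)) ◁ (Q.mul X).hom ⊗≫
        (𝔽.eN (Q.k X)).inv ▷ (Q.k (M.obj X) ≫ L.map (M.m X)) ⊗≫
        Q.k X ◁ (Q.unit (M.obj X)).hom ▷ L.map (M.m X) ⊗≫
        𝟙 (Q.k X ≫ L.map (M.e (M.obj X)) ≫ L.map (M.m X)) =
      (λ_ _).hom ≫ (ρ_ _).inv ≫ Q.k X ◁ (L.mapTriId (M.cells.left X).symm).inv :=
  mul_left_aux (𝔽.actN (A := 𝔽.free (L.obj X)) (B := M.freeStrictAlg X) (Q.kStr X))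
    (Q.kAct (M.freeStrictAlg X)) (𝔽.eN (Q.k X)) (𝔽.actUnit (M.freeStrictAlg X))
    (L.mapTriId (M.cells.left X).symm)
    (𝔽.eAct_actN (A := 𝔽.free (L.obj X)) (B := M.freeStrictAlg X) (Q.kStr X))
    (Q.e_kAct (M.freeStrictAlg X))

/-- Unlike the left unit law this is not a defining equation. Tested along the universal arrow, it
follows from the left unit law and from the unit identities `e_right` of `M` and `eAct_right` of the
free objects. -/
lemma mul_right (X : C) :
    𝔽.map (𝔽.e (L.obj X)) ◁ (Q.mul X).hom ≫ (α_ _ _ _).inv ≫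
        ((𝔽.mapComp (𝔽.e (L.obj X)) (Q.k X)).inv ≫ 𝔽.map₂ (Q.unit X).hom) ▷
          (Q.k (M.obj X) ≫ L.map (M.m X)) ≫ (α_ _ _ _).inv ≫
        (Q.kN (M.e X)).hom ▷ L.map (M.m X) ≫ (α_ _ _ _).hom ≫
        Q.k X ◁ (L.mapTriId (M.cells.right X)).hom ≫ (ρ_ _).hom =
      (α_ _ _ _).inv ≫ (𝔽.right (L.obj X)).hom ▷ Q.k X ≫ (λ_ _).hom := by
  refine 𝔽.hom_ext (A := M.freeStrictAlg X)
    (𝔸.isCell_comp (𝔸.isCell_whiskerLeft _ (Q.isCell_mul X)) (𝔸.isCell_comp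
      (𝔸.isCell_associator_inv _ _ _) (𝔸.isCell_comp (𝔸.isCell_whiskerRight _
      (𝔸.isCell_comp (𝔸.isCell_inv (𝔽.isCell_mapComp _ _)) (𝔽.isCell_map₂ _))) (𝔸.isCell_comp
      (𝔸.isCell_associator_inv _ _ _) (𝔸.isCell_comp (𝔸.isCell_whiskerRight _
      (Q.isCell_kN (M.e X))) (𝔸.isCell_comp (𝔸.isCell_associator _ _ _) (𝔸.isCell_comp
      (𝔸.isCell_whiskerLeft _ (𝔸.isCell_comp (𝔸.isCell_comp (𝔸.isCell_inv
        (Q.isCell_mapComp (A := M.freeStrictAlg X) (B := M.freeStrictAlg (M.obj X))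
          (E := M.freeStrictAlg X) (M.freeMor (M.e X)) (M.freeAlg X).strMor))
        (Q.isCell_map₂ (A := M.freeStrictAlg X) (B := M.freeStrictAlg X)
          (TwoMonad.isAlgCell_right (S := M) X))) (Q.isCell_mapId (M.freeStrictAlg X))))
      (𝔸.isCell_rightUnitor _))))))))
    (𝔸.isCell_comp (𝔸.isCell_associator_inv _ _ _) (𝔸.isCell_comp
      (𝔸.isCell_whiskerRight _ (𝔽.isCell_right _)) (𝔸.isCell_leftUnitor _))) ?_
  have h : L.map (M.e X) ◁ (L.mapTriId (M.cells.left X).symm).inv ≫ (α_ _ _ _).inv ≫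
      (L.mapSq (M.eNat (M.e X))).hom ▷ L.map (M.m X) ≫ (α_ _ _ _).hom ≫
      L.map (M.e X) ◁ (L.mapTriId (M.cells.right X)).hom = 𝟙 _ := by
    have h' := congrArg (fun ξ => L.map (M.e X) ◁ (L.mapId _).inv ≫ (L.mapComp _ _).inv ≫
      L.map₂ ξ ≫ (L.mapComp _ _).hom ≫ L.map (M.e X) ◁ (L.mapId _).hom)
          (TwoMonad.e_right (S := M) X)
    simp [Pseudofunctor.map₂_assoc_inv] at h'
    simpa using h'
  exact mul_right_cancel_aux (𝔽.eN (𝔽.e (L.obj X))) (𝔽.eN (Q.k X))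
    (𝔽.mapComp (𝔽.e (L.obj X)) (Q.k X)) (Q.unit X) (Q.unit (M.obj X))
    (L.mapTriId (M.cells.left X).symm) (𝔽.actUnit (𝔽.free (L.obj X)))
    (Q.mul_left X) (𝔽.eN_comp _ _) (𝔽.eN_natural (Q.unit X).hom) (Q.unit_kN (M.e X)) h
    (𝔽.eAct_right (L.obj X))

/-- The comparison as a pseudonatural transformation. -/
def morData : PseudomonadMorData L M.toPseudomonad 𝔽.pseudomonad where
  trans :=
    { app := Q.k
      naturality := fun f => Q.kN f
      naturality_naturality := fun φ => Q.kN_natural φ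
      naturality_id := fun X => by
        have h := Q.kN_id X
        rw [← whiskerLeft_comp, ← comp_whiskerRight_assoc] at h
        exact h
      naturality_comp := fun f g => Q.kN_comp f g }

/-- The compatibility 2-cells of the comparison. -/
def morCells : Q.morData.Cells where
  unit := Q.unit
  mul := Q.mul

/-- Naturality and associativity of `mul` both rest on `actN_sq`, for the squares `kN f` and `mul
X`, combined with `kAct_natural` at `M.map f` and at the multiplication of `M`. -/
lemma morCoherence : Q.morData.Coherence Q.morCells where
  unit_natural {X Y} f := by
    have aux {x y x' y' l l' : K} {f : x ⟶ y} {e : x ⟶ x'} {e' : y ⟶ y'} {Sf : x' ⟶ y'}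
        {k : x' ⟶ l} {k' : y' ⟶ l'} {j : x ⟶ l} {j' : y ⟶ l'} {Mf : l ⟶ l'} {n : f ≫ e' ⟶ e ≫ Sf}
        {kf : Sf ≫ k' ⟶ k ≫ Mf} {u : e ≫ k ⟶ j} {u' : e' ≫ k' ⟶ j'} {q : f ≫ j' ⟶ j ≫ Mf}
        (h : n ▷ k' ≫ (α_ _ _ _).hom ≫ e ◁ kf ≫ (α_ _ _ _).inv ≫ u ▷ Mf =
          (α_ _ _ _).hom ≫ f ◁ u' ≫ q) :
        f ◁ u' ≫ q = (α_ _ _ _).inv ≫ n ▷ k' ⊗≫ e ◁ kf ⊗≫ u ▷ Mf := by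
      rw [← cancel_epi (α_ _ _ _).hom, ← h]
      simp [bicategoricalComp]
    exact aux (Q.unit_kN f)
  mul_natural {X Y} f :=
    mul_natural_aux (𝔽.actN (A := 𝔽.free (L.obj X)) (B := M.freeStrictAlg X) (Q.kStr X))
      (𝔽.actN (A := 𝔽.free (L.obj Y)) (B := M.freeStrictAlg Y) (Q.kStr Y))
      (Q.kAct (M.freeStrictAlg X)) (Q.kAct (M.freeStrictAlg Y))
      (𝔽.actN_sq (A := 𝔽.free (L.obj X)) (B := 𝔽.free (L.obj Y)) (E := M.freeStrictAlg X)
        (V := M.freeStrictAlg Y) _ (Q.isCell_kN f))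
      (Q.kAct_natural (A := M.freeStrictAlg X) (B := M.freeStrictAlg Y) (M.freeMor f))
  mul_assoc X :=
    mul_assoc_aux (𝔽.actN (A := 𝔽.free (L.obj X)) (B := M.freeStrictAlg X) (Q.kStr X))
      (Q.kAct (M.freeStrictAlg X)) (𝔽.actN (𝔽.mapStr (Q.k X)))
      (𝔽.actN (A := 𝔽.free (L.obj (M.obj X))) (B := M.freeStrictAlg (M.obj X)) (Q.kStr (M.obj X)))
      (Q.kAct (M.freeStrictAlg (M.obj X)))
      (𝔽.actN_sq (A := 𝔽.free (𝔽.S (L.obj X))) (B := 𝔽.free (L.obj X))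
        (E := 𝔽.free (L.obj (M.obj X))) (V := M.freeStrictAlg X) _ (Q.isCell_mul X))
      (𝔽.actN_comp (A := 𝔽.free (L.obj (M.obj X))) (B := M.freeStrictAlg (M.obj X))
        (E := M.freeStrictAlg X) (Q.kStr (M.obj X)) (Q.strStr (M.freeStrictAlg X)))
      (Q.kAct_natural (A := M.freeStrictAlg (M.obj X)) (B := M.freeStrictAlg X)
        (M.freeAlg X).strMor)
  mul_right X := by
    have aux {x x₁ l l₁ y : K} {e : x ⟶ x₁} {a : x₁ ⟶ x} {k : x ⟶ l} {Sk : x₁ ⟶ y} {km : y ⟶ l₁}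
        {m : l₁ ⟶ l} {LMe : l ⟶ l₁} {SLe : x ⟶ y} {mul : a ≫ k ⟶ Sk ≫ km ≫ m} {s : e ≫ Sk ⟶ SLe}
        {kN : SLe ≫ km ⟶ k ≫ LMe} {r : LMe ≫ m ⟶ 𝟙 l} {r₀ : e ≫ a ⟶ 𝟙 x}
        (h : e ◁ mul ≫ (α_ _ _ _).inv ≫ s ▷ (km ≫ m) ≫ (α_ _ _ _).inv ≫ kN ▷ m ≫
          (α_ _ _ _).hom ≫ k ◁ r ≫ (ρ_ _).hom = (α_ _ _ _).inv ≫ r₀ ▷ k ≫ (λ_ _).hom) :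
        e ◁ mul ⊗≫ s ▷ (km ≫ m) ⊗≫ kN ▷ m ⊗≫ k ◁ r ≫ (ρ_ _).hom =
          (α_ _ _ _).inv ≫ r₀ ▷ k ≫ (λ_ _).hom := by
      rw [← h]
      simp [bicategoricalComp]
    exact aux (Q.mul_right X)
  mul_left X := Q.mul_left X

/-- The comparison as a morphism of pseudomonads. -/
def mor : PseudomonadMor L M.toPseudomonad 𝔽.pseudomonad where
  toPseudomonadMorData := Q.morData
  cells := Q.morCells
  coherence := Q.morCoherence

end AlgComparison

/-! ### The extension obtained from a lifting -/

namespace PseudoLifting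

open Pseudomonad

variable {C : Type u₁} [Bicategory.{w₁, v₁} C] [Bicategory.Strict C] {D : Type u₂}
  [Bicategory.{w₂, v₂} D] [Bicategory.Strict D] {J : C ⥤ᵖ D} {T : RelPseudomonad J}
  {S : TwoMonad D} {R : RestrictsAlong J S} (L : PseudoLifting T R)

/-- The image of a pseudomorphism of strict algebras in the Kleisli bicategory. -/
def freeMapStr {A B : StrictAlg R.monad.toPseudomonad} {f : A.carrier ⟶ B.carrier}
    (F : MorStr A.alg B.alg f) :
    MorStr (R.mor.mapAlg A.alg) (L.alg B) (J.map f ≫ T.unit B.carrier) :=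
  (R.mor.mapMor F).comp (L.unitStr B)

/-- The free functor to the Kleisli bicategory sends the free algebras of the restricted 2-monad to
free objects. -/
noncomputable def algComparison : AlgComparison R.monad T.free L.freeObjects where
  str F := L.freeMapStr F
  isCell_map₂ hφ := IsAlgCell.whiskerRight (L.unitStr _) (R.mor.isAlgCell_map₂ hφ)
  -- The composition constraint of the free pseudofunctor inserts `η` at the second factor, hence
  -- the use of `eta_cell`.
  isCell_mapComp F G :=
    ((R.mor.isAlgCell_mapComp F G).whiskerRight (L.unitStr _)).comp
      ((isAlgCell_associator _ _ _).comp
        (((L.eta_cell (L.freeMapStr G)).whiskerLeft (R.mor.mapMor F)).comp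
          (isAlgCell_associator _ _ _).inv))
  isCell_mapId A :=
    ((R.mor.isAlgCell_mapId A.alg).whiskerRight (L.unitStr A)).comp (isAlgCell_leftUnitor _)
  -- The free object on `X` was chosen with carrier `S X`, so the identity is available, with the
  -- lifted unit as its structure. The extension demands exactly these components.
  k X := 𝟙 (T.toKl (R.monad.obj X))
  kStr X := L.structuredBicat.id (R.monad.freeStrictAlg X)
  unit X := ρ_ (T.free.map (R.monad.e X))

/-- The pseudomonad of free objects extends the restricted 2-monad. -/
noncomputable def extension : Extension T R L.freeObjects.pseudomonad where
  mor := L.algComparison.mor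
  obj_eq _ := rfl
  app_eq _ := HEq.rfl

end PseudoLifting

theorem theorem6p3 {C : Type u₁} [Bicategory.{w₁, v₁} C] [Bicategory.Strict C]
    {D : Type u₂} [Bicategory.{w₂, v₂} D] [Bicategory.Strict D] (J : C ⥤ᵖ D)
    (T : RelPseudomonad J) (S : TwoMonad D) (R : RestrictsAlong J S)
    (h : Nonempty (StrictLifting T R) ∨ Nonempty (PseudoLifting T R)) :
    ∃ St : Pseudomonad T.Kleisli, Nonempty (Extension T R St) := by
  -- A strict lifting is used only through the pseudolifting it contains.
  obtain ⟨⟨L⟩⟩ | ⟨⟨L⟩⟩ := h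
  · exact ⟨_, ⟨L.toPseudoLifting.extension⟩⟩
  · exact ⟨_, ⟨L.extension⟩⟩
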